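/- Let $(\Omega,g)$ be a compact smooth Riemannian manifold of dimension $n\ge 1$ with nonempty smooth boundary $\partial\Omega$. For a (relatively) open set $U\subseteq\Omega$ write $U^\circ=U\setminus\partial\Omega$. We say that $U$ has *Lipschitz boundary* if every point of the topological boundary of $U^\circ$ in $\Omega$ has a smooth chart of $\Omega$ in which $U^\circ$ is, in a neighbourhood in $\mathbb R^n$ of the image of the point, the region lying strictly on one side of the graph (over some hyperplane) of a Lipschitz function. (At a point of $\partial\Omega$ the chart takes values in a half-space of $\mathbb R^n$, and a full neighbourhood in $\mathbb R^n$ is meant.) Let $H^1(U)$ be the space of $u\in L^2(U)$ (with respect to the Riemannian volume $dV$) that have a square-integrable weak gradient $\nabla u$ on $U^\circ$, and let $H^1_0(U)$ be the closure of $C_c^\infty(U^\circ)$ in $H^1(U)$. A real number $\mu$ is a Neumann (respectively Dirichlet) eigenvalue of the Laplacian on $U$ if there is $u\ne 0$ in $H^1(U)$ (respectively in $H^1_0(U)$) with $$\int_U g(\nabla u,\nabla v)\,dV=\mu\int_U uv\,dV$$ for all $v\in H^1(U)$ (respectively all $v\in H^1_0(U)$); its multiplicity is the dimension of the space of such $u$,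 together with $0$. Let $\lambda_1(U)$ be the first Dirichlet eigenvalue of $U$, and let $N(U)$ be the number of Neumann eigenvalues $\mu\le\lambda_1(U)$ of $U$, counted with multiplicity ($N(\emptyset)=0$). Suppose that $U_1,\dots,U_K\subseteq\Omega$ are mutually disjoint open sets with Lipschitz boundary whose closures cover $\Omega$. Then $$N(\Omega)\le\sum_{i=1}^K N(U_i).$$ -/

import Mathlib

open MeasureTheory Set Filter Topology Bundle
open scoped Manifold ContDiff

noncomputable section

namespace NeumannDirichlet

/-- Smooth Riemannian metrics on an `n`-dimensional smooth manifold with boundary `M`. -/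
abbrev Metric (n : ℕ) [NeZero n] (M : Type*) [TopologicalSpace M]
    [ChartedSpace (EuclideanHalfSpace n) M] [IsManifold (𝓡∂ n) ∞ M] : Type _ :=
  ContMDiffRiemannianMetric (𝓡∂ n) ∞ (EuclideanSpace ℝ (Fin n))
    (fun y : M => TangentSpace (𝓡∂ n) y)

section LipschitzBoundary

/-- Near `z₀`, the set `D` is the strict epigraph, in the direction of the unit vector `e`, of a
Lipschitz function `γ` of the coordinates orthogonal to `e`
(a point `z` is `z' + t • e` with `z'` orthogonal to `e` and `t = ⟪e, z⟫`; the invariance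
of `γ` says that `γ z` depends on `z'` only). -/
def IsLipschitzEpigraphNear {n : ℕ} (D : Set (EuclideanSpace ℝ (Fin n)))
    (z₀ : EuclideanSpace ℝ (Fin n)) : Prop :=
  ∃ (e : EuclideanSpace ℝ (Fin n)) (γ : EuclideanSpace ℝ (Fin n) → ℝ) (L : NNReal),
    ‖e‖ = 1 ∧ LipschitzWith L γ ∧ (∀ (z : EuclideanSpace ℝ (Fin n)) (t : ℝ), γ (z + t • e) = γ z) ∧
      ∀ᶠ z in 𝓝 z₀, z ∈ D ↔ γ z < inner ℝ e z

/-- The open set `U` of the manifold with boundary `M` has Lipschitz boundary: in suitable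
smooth coordinates around each boundary point of `U \ ∂M`, the set `U \ ∂M` is locally the
region on one side of the graph of a Lipschitz function.  The points of `∂M` that lie in the
closure of `U` count as boundary points; there, the coordinates take values in a half-space of `ℝⁿ`
and the graph condition is imposed on a full neighbourhood in `ℝⁿ`. -/
def HasLipschitzBoundary (n : ℕ) [NeZero n] {M : Type*} [TopologicalSpace M]
    [ChartedSpace (EuclideanHalfSpace n) M] (U : Set M) : Prop :=
  ∀ p ∈ frontier (U ∩ (𝓡∂ n).interior M),
    ∃ φ ∈ IsManifold.maximalAtlas (𝓡∂ n) ∞ M, p ∈ φ.source ∧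
      IsLipschitzEpigraphNear
        (φ.extend (𝓡∂ n) '' (U ∩ (𝓡∂ n).interior M ∩ φ.source)) (φ.extend (𝓡∂ n) p)

end LipschitzBoundary

variable {n : ℕ} [NeZero n] {M : Type*} [TopologicalSpace M]
  [ChartedSpace (EuclideanHalfSpace n) M] [IsManifold (𝓡∂ n) ∞ M]

section Coordinates

/-- The tangent vector `∑ vⁱ ∂ᵢ` at the point `y`, for the coordinates of the chart at `x`. -/
def coordVector (x y : M) (v : EuclideanSpace ℝ (Fin n)) : TangentSpace (𝓡∂ n) y :=
  (trivializationAt (EuclideanSpace ℝ (Fin n)) (TangentSpace (𝓡∂ n) : M → Type _) x).symmL ℝ y v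

/-- The Gram matrix `g_{ij}(y) = g_y(∂ᵢ, ∂ⱼ)` of the metric in the chart at `x`. -/
def gram (g : Metric n M) (x y : M) : Matrix (Fin n) (Fin n) ℝ :=
  Matrix.of fun i j => g.inner y (coordVector x y (EuclideanSpace.single i 1))
    (coordVector x y (EuclideanSpace.single j 1))

/-- The measure `√(det g_{ij}) dz` of the chart at `x`, transported to the manifold
(it vanishes outside of the domain of the chart). -/
def chartVolume [MeasurableSpace M] (g : Metric n M) (x : M) : Measure M :=
  (((volume : Measure (EuclideanSpace ℝ (Fin n))).restrict (extChartAt (𝓡∂ n) x).target).withDensity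
    fun z => ENNReal.ofReal (√(gram g x ((extChartAt (𝓡∂ n) x).symm z)).det)).map
      (extChartAt (𝓡∂ n) x).symm

/-- The Riemannian volume measure: the least measure that dominates the measures
`√(det g_{ij}) dz` of all the charts.  As these agree on the overlaps of the
charts, it restricts to each of them on the domain of that chart. -/
def vol [MeasurableSpace M] (g : Metric n M) : Measure M := ⨆ x : M, chartVolume g x

/-- The part of the open set `U \ ∂M` that lies in the chart at `x`, in coordinates;
an open subset of `ℝⁿ`. -/
def chartDomain (n : ℕ) [NeZero n] {M : Type*} [TopologicalSpace M]
    [ChartedSpace (EuclideanHalfSpace n) M] (x : M) (U : Set M) :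
    Set (EuclideanSpace ℝ (Fin n)) :=
  (extChartAt (𝓡∂ n) x).target ∩ (extChartAt (𝓡∂ n) x).symm ⁻¹' (U ∩ (𝓡∂ n).interior M)

/-- The function `z ↦ g(X, ∑ vⁱ ∂ᵢ)` in the coordinates `z` of the chart at `x`. -/
def chartPairing (g : Metric n M) (X : ∀ y : M, TangentSpace (𝓡∂ n) y) (x : M)
    (v z : EuclideanSpace ℝ (Fin n)) : ℝ :=
  g.inner ((extChartAt (𝓡∂ n) x).symm z) (X ((extChartAt (𝓡∂ n) x).symm z))
    (coordVector x ((extChartAt (𝓡∂ n) x).symm z) v)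

end Coordinates

section Sobolev

/-- The vector field `X` is the weak gradient of `u` on `U \ ∂M`: in each chart, the weak
derivative of `u` in the direction `∑ vⁱ ∂ᵢ` is `g(X, ∑ vⁱ ∂ᵢ)`. -/
def IsWeakGradient (g : Metric n M) (U : Set M) (u : M → ℝ)
    (X : ∀ y : M, TangentSpace (𝓡∂ n) y) : Prop :=
  ∀ (x : M) (v : EuclideanSpace ℝ (Fin n)) (ψ : EuclideanSpace ℝ (Fin n) → ℝ),
    ContDiff ℝ ∞ ψ → HasCompactSupport ψ → tsupport ψ ⊆ chartDomain n x U →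
      ∫ z in chartDomain n x U, u ((extChartAt (𝓡∂ n) x).symm z) * fderiv ℝ ψ z v =
        -∫ z in chartDomain n x U, chartPairing g X x v z * ψ z

variable [MeasurableSpace M]

/-- `u` belongs to the Sobolev space `H¹(U)`, with weak gradient `X`: both are square integrable on
`U` for the Riemannian volume.  The vector field `X` is measurable in the sense that its
components `g(X, ∑ vⁱ ∂ᵢ)` in each chart are. -/
structure IsH1 (g : Metric n M) (U : Set M) (u : M → ℝ)
    (X : ∀ y : M, TangentSpace (𝓡∂ n) y) : Prop where
  memLp : MemLp u 2 ((vol g).restrict U)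
  aestronglyMeasurable : ∀ (x : M) (v : EuclideanSpace ℝ (Fin n)),
    AEStronglyMeasurable (chartPairing g X x v) (volume.restrict (chartDomain n x U))
  integrable : Integrable (fun y => g.inner y (X y) (X y)) ((vol g).restrict U)
  weak : IsWeakGradient g U u X

/-- `u` belongs to the Sobolev space `H¹₀(U)`, with weak gradient `X`: it is the limit in `H¹(U)`
of smooth functions with compact support in `U \ ∂M`. -/
def IsH10 (g : Metric n M) (U : Set M) (u : M → ℝ)
    (X : ∀ y : M, TangentSpace (𝓡∂ n) y) : Prop :=
  IsH1 g U u X ∧ ∀ ε : ℝ, 0 < ε → ∃ (ψ : M → ℝ) (Y : ∀ y : M, TangentSpace (𝓡∂ n) y),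
    ContMDiff (𝓡∂ n) 𝓘(ℝ, ℝ) ∞ ψ ∧ HasCompactSupport ψ ∧
      tsupport ψ ⊆ U ∩ (𝓡∂ n).interior M ∧ IsH1 g U ψ Y ∧
      ∫ y in U, (u y - ψ y) ^ 2 ∂(vol g) +
        ∫ y in U, g.inner y (X y - Y y) (X y - Y y) ∂(vol g) < ε

end Sobolev

section Eigenvalues

variable [MeasurableSpace M]

/-- `u` is zero or an eigenfunction, for the eigenvalue `μ`, of the Laplacian on `U` with
form domain `D` (a set of pairs of a function and its gradient):
`∫_U g(∇u, ∇v) = μ ∫_U u v` for all `v` in the form domain. -/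
def IsEigenfunction (g : Metric n M) (U : Set M)
    (D : (M → ℝ) → (∀ y : M, TangentSpace (𝓡∂ n) y) → Prop) (μ : ℝ) (u : M → ℝ) : Prop :=
  ∃ X, D u X ∧ ∀ v Y, D v Y →
    ∫ y in U, g.inner y (X y) (Y y) ∂(vol g) = μ * ∫ y in U, u y * v y ∂(vol g)

/-- The eigenspace in `L²(U)` of the Laplacian on `U` with form domain `D`.  (For `H¹(U)` and
`H¹₀(U)` the eigenfunctions, with zero, already form a linear subspace.) -/
def eigenspace (g : Metric n M) (U : Set M)
    (D : (M → ℝ) → (∀ y : M, TangentSpace (𝓡∂ n) y) → Prop) (μ : ℝ) :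
    Submodule ℝ (Lp ℝ 2 ((vol g).restrict U)) :=
  Submodule.span ℝ {f | IsEigenfunction g U D μ f}

/-- The multiplicity of `μ` as a Neumann eigenvalue of `U` (zero if it is not an eigenvalue). -/
def neumannMultiplicity (g : Metric n M) (U : Set M) (μ : ℝ) : ℕ∞ :=
  Cardinal.toENat (Module.rank ℝ (eigenspace g U (IsH1 g U) μ))

/-- The first Dirichlet eigenvalue `λ₁(U)`. -/
def firstDirichletEigenvalue (g : Metric n M) (U : Set M) : ℝ :=
  sInf {l : ℝ | eigenspace g U (IsH10 g U) l ≠ ⊥}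

/-- `N(U)`, the number of Neumann eigenvalues of `U`, counted with multiplicity, that do not
exceed the first Dirichlet eigenvalue of `U`: an eigenvalue `μ` of multiplicity `m` gives the
`m` pairs `(μ, 0), …, (μ, m - 1)`. -/
def neumannCount (g : Metric n M) (U : Set M) : ℕ∞ :=
  Set.encard {p : ℝ × ℕ |
    p.1 ≤ firstDirichletEigenvalue g U ∧ (p.2 : ℕ∞) < neumannMultiplicity g U p.1}

end Eigenvalues

end NeumannDirichlet

end

/-! Write l for λ₁(Ω) and suppose that N(Ω) exceeds ∑ N(Uᵢ). The span of ∑ N(Uᵢ) + 1 orthonormal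
Neumann eigenfunctions of Ω with eigenvalues at most l contains a nonzero f whose restriction to
each Uᵢ is orthogonal to N(Uᵢ) orthonormal Neumann eigenfunctions of Uᵢ with eigenvalues at most
λ₁(Uᵢ): these are only ∑ N(Uᵢ) linear conditions. As an element of the span, f satisfies ∫_Ω |∇f|² ≤
l ∫_Ω f². On a piece where f is not zero almost everywhere, the orthogonality gives ∫_{Uᵢ} |∇f|² >
λ₁(Uᵢ) ∫_{Uᵢ} f², and λ₁(Uᵢ) ≥ l, since test functions of Uᵢ extend by zero to Ω. Summing over the
pieces yields a contradiction. The inequality on the pieces is strict because N counts the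
eigenvalues equal to λ₁ as well.

The spectral input is that a Rayleigh quotient, constrained by orthogonality to finitely many
eigenvectors, attains its infimum at an eigenvector (`exists_eigenvector_of_orthogonal`). This rests
on completeness (`exists_tendsto_of_cauchy`) and on the compactness of H¹ in L²
(`HasLipschitzBoundary.exists_subseq_cauchy`). The summation also needs the topological boundaries
of the pieces to be null (`integral_eq_sum_of_partition`).

The Lipschitz hypothesis enters only through a cone condition, `HasConeAt`: near a point of the
closure, the set is mapped into itself by small translations in a ball of directions. For
compactness (`exists_subseq_cauchy_of_cone`), a function is compared with its averages over small
translates in these directions; the error is controlled by the gradient on segments that stay in the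
domain, and the averages converge along a subsequence. No extension operator is involved. For
nullity (`HasConeAt.exists_ball_frontier_null`), translates of the boundary along the axis are
disjoint. Compactness on Ω is inherited from the pieces.

Functions are carried with their gradients as pairs in `l2Pairs`, with two positive semidefinite
forms, `energyForm` and `massForm`. The counting function is handled through finite orthonormal
families of eigenfunctions, `IsEigenfamily`. -/

set_option linter.unusedSectionVars false

/-! ### The direct method for a pair of semidefinite forms -/

section Variational

variable {V : Type*} [AddCommGroup V] [Module ℝ V]

/-- Cauchy–Schwarz for a positive semidefinite symmetric form. -/
lemma form_sq_le {b : V →ₗ[ℝ] V →ₗ[ℝ] ℝ} (hs : ∀ u v, b u v = b v u) (hp : ∀ u, 0 ≤ b u u)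
    (u v : V) : b u v ^ 2 ≤ b u u * b v v := by
  have h : ∀ t : ℝ, 0 ≤ b v v * (t * t) + (2 * b u v) * t + b u u := fun t => by
    have := hp (u + t • v)
    simp only [map_add, map_smul, LinearMap.add_apply, LinearMap.smul_apply, smul_eq_mul,
      hs v u] at this
    linarith
  have := discrim_le_zero h
  rw [discrim] at this
  nlinarith

lemma form_add_le {b : V →ₗ[ℝ] V →ₗ[ℝ] ℝ} (hs : ∀ u v, b u v = b v u) (hp : ∀ u, 0 ≤ b u u)
    (u v : V) : b (u + v) (u + v) ≤ 2 * b u u + 2 * b v v := by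
  have := hp (u - v)
  simp only [map_sub, map_add, LinearMap.sub_apply, LinearMap.add_apply, hs v u] at *
  linarith

/-- The space carries no topology: convergence means that the form of the difference tends to zero,
and Cauchy–Schwarz turns this into convergence of the values of the form. -/
lemma form_tendsto_right {b : V →ₗ[ℝ] V →ₗ[ℝ] ℝ} (hs : ∀ u v, b u v = b v u)
    (hp : ∀ u, 0 ≤ b u u) {v : ℕ → V} {u : V}
    (h : Tendsto (fun k => b (v k - u) (v k - u)) atTop (𝓝 0)) (w : V) :
    Tendsto (fun k => b (v k) w) atTop (𝓝 (b u w)) := by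
  have h1 : Tendsto (fun k => b (v k - u) w ^ 2) atTop (𝓝 0) := by
    refine squeeze_zero (fun _ => sq_nonneg _) (fun k => form_sq_le hs hp _ _) ?_
    simpa using h.mul_const (b w w)
  have h2 : Tendsto (fun k => b (v k - u) w) atTop (𝓝 0) := by
    have := h1.sqrt
    simp only [Real.sqrt_sq_eq_abs, Real.sqrt_zero] at this
    exact (tendsto_zero_iff_abs_tendsto_zero _).2 this
  have := h2.add_const (b u w)
  simpa using this

lemma form_tendsto_self {b : V →ₗ[ℝ] V →ₗ[ℝ] ℝ} (hs : ∀ u v, b u v = b v u)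
    (hp : ∀ u, 0 ≤ b u u) {v : ℕ → V} {u : V}
    (h : Tendsto (fun k => b (v k - u) (v k - u)) atTop (𝓝 0)) :
    Tendsto (fun k => b (v k) (v k)) atTop (𝓝 (b u u)) := by
  have h1 := ((form_tendsto_right hs hp h u).const_mul 2).add (h.sub_const (b u u))
  convert h1 using 2
  · simp only [map_sub, LinearMap.sub_apply, hs u (v _)]
    ring
  · ring

/-- Direct method: below the Rayleigh quotient of a vector orthogonal to finitely many
eigenvectors there is an eigenvalue with an eigenvector orthogonal to them. -/
theorem exists_eigenvector_of_orthogonal {a b : V →ₗ[ℝ] V →ₗ[ℝ] ℝ}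
    (has : ∀ u v, a u v = a v u) (hap : ∀ u, 0 ≤ a u u)
    (hbs : ∀ u v, b u v = b v u) (hbp : ∀ u, 0 ≤ b u u)
    (hcpt : ∀ v : ℕ → V, (∃ C : ℝ, ∀ k, a (v k) (v k) + b (v k) (v k) ≤ C) →
      ∃ φ : ℕ → ℕ, StrictMono φ ∧ ∀ ε > 0, ∃ N, ∀ k ≥ N, ∀ l ≥ N,
        b (v (φ k) - v (φ l)) (v (φ k) - v (φ l)) < ε)
    (hcomplete : ∀ v : ℕ → V, (∀ ε > 0, ∃ N, ∀ k ≥ N, ∀ l ≥ N,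
        a (v k - v l) (v k - v l) + b (v k - v l) (v k - v l) < ε) →
      ∃ u, Tendsto (fun k => a (v k - u) (v k - u) + b (v k - u) (v k - u)) atTop (𝓝 0))
    {ι : Type*} [Finite ι] {e : ι → V} {μ : ι → ℝ}
    (he1 : ∀ i, b (e i) (e i) = 1) (he2 : ∀ i j, i ≠ j → b (e i) (e j) = 0)
    (heig : ∀ i v, a (e i) v = μ i * b (e i) v)
    {f : V} (hfe : ∀ i, b f (e i) = 0) (hf : 0 < b f f) :
    ∃ (m : ℝ) (u : V), m * b f f ≤ a f f ∧ b u u = 1 ∧ (∀ i, b u (e i) = 0) ∧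
      ∀ v, a u v = m * b u v := by
  classical
  cases nonempty_fintype ι
  set S : Set V := {v | b v v = 1 ∧ ∀ i, b v (e i) = 0} with hS
  set m : ℝ := sInf ((fun v => a v v) '' S) with hm
  have hbdd : BddBelow ((fun v => a v v) '' S) := ⟨0, by rintro _ ⟨v, -, rfl⟩; exact hap v⟩
  -- Homogeneity extends the bound by the infimum `m` from normalised vectors to the whole
  -- orthogonal complement; for `b v v = 0` it reduces to `a v v ≥ 0`.
  have hmle : ∀ v, (∀ i, b v (e i) = 0) → m * b v v ≤ a v v := by
    intro v hv
    rcases (hbp v).eq_or_lt with h0 | h0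
    · rw [← h0, mul_zero]; exact hap v
    · set c : ℝ := (√(b v v))⁻¹ with hc
      have hcc : c * c * b v v = 1 := by
        rw [hc, ← mul_inv, Real.mul_self_sqrt h0.le, inv_mul_cancel₀ h0.ne']
      have hmem : c • v ∈ S := by
        refine ⟨?_, fun i => by simp [hv i]⟩
        simp only [map_smul, LinearMap.smul_apply, smul_eq_mul]
        linarith
      have h1 : m ≤ a (c • v) (c • v) := csInf_le hbdd ⟨_, hmem, rfl⟩
      simp only [map_smul, LinearMap.smul_apply, smul_eq_mul] at h1
      calc m * b v v ≤ (c * (c * a v v)) * b v v := mul_le_mul_of_nonneg_right h1 h0.le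
        _ = (c * c * b v v) * a v v := by ring
        _ = a v v := by rw [hcc, one_mul]
  have hSne : S.Nonempty := by
    set c : ℝ := (√(b f f))⁻¹ with hc
    refine ⟨c • f, ?_, fun i => by simp [hfe i]⟩
    simp only [map_smul, LinearMap.smul_apply, smul_eq_mul]
    rw [← mul_assoc, hc, ← mul_inv, Real.mul_self_sqrt hf.le, inv_mul_cancel₀ hf.ne']
  have hex : ∀ k : ℕ, ∃ v ∈ S, a v v < m + 1 / ((k : ℝ) + 1) := by
    intro k
    have hk : m < m + 1 / ((k : ℝ) + 1) := by
      have : (0 : ℝ) < 1 / ((k : ℝ) + 1) := by positivity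
      linarith
    obtain ⟨_, ⟨v, hv, rfl⟩, hlt⟩ := exists_lt_of_csInf_lt (hSne.image _) hk
    exact ⟨v, hv, hlt⟩
  choose w hwS hwlt using hex
  have hm0 : 0 ≤ m := le_csInf (hSne.image _) (by rintro _ ⟨v, -, rfl⟩; exact hap v)
  obtain ⟨φ, hφ, hcau⟩ := hcpt w ⟨m + 2, fun k => by
    have h1 := hwlt k
    have h2 : (1 : ℝ) / ((k : ℝ) + 1) ≤ 1 := by
      rw [div_le_one (by positivity)]; linarith [(k.cast_nonneg : (0 : ℝ) ≤ k)]
    rw [(hwS k).1]; linarith⟩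
  -- Parallelogram identity: `v + z` is again admissible, so `a (v + z) (v + z) ≥ m * b (v + z) (v +
  -- z) = m * (4 - b (v - z) (v - z))`. Hence a minimising sequence that is Cauchy for `b` is Cauchy
  -- for `a` too.
  have hdiff : ∀ v ∈ S, ∀ z ∈ S, a (v - z) (v - z) ≤
      2 * (a v v - m) + 2 * (a z z - m) + m * b (v - z) (v - z) := by
    intro v hv z hz
    have h1 := hmle (v + z) (fun i => by simp [hv.2 i, hz.2 i])
    have h2 := hv.1
    have h3 := hz.1
    simp only [map_add, map_sub, LinearMap.add_apply, LinearMap.sub_apply, has z v, hbs z v,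
      h2, h3] at *
    nlinarith
  have hlim0 : Tendsto (fun k : ℕ => a (w (φ k)) (w (φ k)) - m) atTop (𝓝 0) := by
    have h0 : Tendsto (fun k : ℕ => a (w k) (w k) - m) atTop (𝓝 0) := by
      refine squeeze_zero (fun k => ?_) (fun k => ?_) tendsto_one_div_add_atTop_nhds_zero_nat
      · have := csInf_le hbdd ⟨_, hwS k, rfl⟩
        simp only at this
        linarith
      · linarith [hwlt k]
    exact h0.comp hφ.tendsto_atTop
  obtain ⟨u, hu⟩ := hcomplete (fun k => w (φ k)) (fun ε hε => by
    obtain ⟨N1, hN1⟩ := hcau (ε / (2 * (m + 1))) (by positivity)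
    obtain ⟨N2, hN2⟩ := (hlim0.eventually (gt_mem_nhds (show 0 < ε / 8 by positivity))
      ).exists_forall_of_atTop
    refine ⟨max N1 N2, fun k hk l hl => ?_⟩
    have h1 := hN1 k (le_of_max_le_left hk) l (le_of_max_le_left hl)
    have h2 := hN2 k (le_of_max_le_right hk)
    have h3 := hN2 l (le_of_max_le_right hl)
    have h4 := hdiff _ (hwS (φ k)) _ (hwS (φ l))
    have h5 : (m + 1) * b (w (φ k) - w (φ l)) (w (φ k) - w (φ l)) < ε / 2 := by
      rw [lt_div_iff₀ (by positivity)] at h1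
      linarith
    linarith)
  have hua : Tendsto (fun k => a (w (φ k) - u) (w (φ k) - u)) atTop (𝓝 0) :=
    squeeze_zero (fun _ => hap _) (fun k => by linarith [hbp (w (φ k) - u)]) hu
  have hub : Tendsto (fun k => b (w (φ k) - u) (w (φ k) - u)) atTop (𝓝 0) :=
    squeeze_zero (fun _ => hbp _) (fun k => by linarith [hap (w (φ k) - u)]) hu
  have huu : b u u = 1 := tendsto_nhds_unique (form_tendsto_self hbs hbp hub)
    (by simp [(hwS _).1])
  have hue : ∀ i, b u (e i) = 0 := fun i =>
    tendsto_nhds_unique (form_tendsto_right hbs hbp hub (e i)) (by simp [(hwS _).2 i])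
  have hau : a u u = m := by
    refine tendsto_nhds_unique (form_tendsto_self has hap hua) ?_
    simpa using hlim0.add_const m
  -- the form `a - m b` is nonnegative on the orthogonal complement and vanishes at `u`
  have hW : ∀ v, (∀ i, b v (e i) = 0) → a u v = m * b u v := by
    intro v hv
    have h : ∀ t : ℝ, 0 ≤ (a v v - m * b v v) * (t * t) + (2 * (a u v - m * b u v)) * t + 0 := by
      intro t
      have := hmle (u + t • v) (fun i => by simp [hue i, hv i])
      simp only [map_add, map_smul, LinearMap.add_apply, LinearMap.smul_apply, smul_eq_mul,
        has v u, hbs v u, hau, huu] at this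
      linarith
    have := discrim_le_zero h
    rw [discrim] at this
    have h2 : (a u v - m * b u v) ^ 2 ≤ 0 := by nlinarith
    have h3 : a u v - m * b u v = 0 := by
      have := sq_nonneg (a u v - m * b u v)
      exact pow_eq_zero_iff two_ne_zero |>.1 (le_antisymm h2 this)
    linarith
  refine ⟨m, u, hmle f hfe, huu, hue, fun v => ?_⟩
  -- An arbitrary `v` differs from an element of the complement by its projection to the span of the
  -- `e j`. On that span both sides of the equation vanish, because the `e j` are themselves
  -- eigenvectors orthogonal to `u`.
  have hv : ∀ i, b (v - ∑ j, b v (e j) • e j) (e i) = 0 := by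
    intro i
    simp only [map_sub, map_sum, map_smul, LinearMap.sub_apply, LinearMap.sum_apply,
      LinearMap.smul_apply, smul_eq_mul]
    rw [Finset.sum_eq_single i (fun j _ hj => by rw [he2 j i hj, mul_zero]) (by simp), he1]
    ring
  have h1 := hW _ hv
  have h2 : ∀ j, a u (e j) = 0 := fun j => by rw [has, heig, hbs, hue, mul_zero]
  simpa [map_sub, map_sum, h2, hue] using h1

end Variational

/-! ### Translation estimates and local Rellich compactness in a Euclidean domain -/

section EuclideanRellich

/-- With `M` the total mass and `I` the integral, expanding `∫ (M f - I)² ≥ 0` gives `M (M ∫ f² -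
I²) ≥ 0`. -/
lemma sq_integral_le_measureReal_mul {α : Type*} [MeasurableSpace α] {ν : Measure α}
    [IsFiniteMeasure ν] {f : α → ℝ} (hf : MemLp f 2 ν) :
    (∫ x, f x ∂ν) ^ 2 ≤ ν.real univ * ∫ x, f x ^ 2 ∂ν := by
  have hi : Integrable f ν := hf.integrable one_le_two
  have hsq : Integrable (fun x => f x ^ 2) ν := hf.integrable_sq
  set M := ν.real univ with hM
  set I := ∫ x, f x ∂ν with hI
  have h : 0 ≤ ∫ x, (M * f x - I) ^ 2 ∂ν := integral_nonneg fun _ => sq_nonneg _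
  have h2 : ∫ x, (M * f x - I) ^ 2 ∂ν = M ^ 2 * ∫ x, f x ^ 2 ∂ν - 2 * M * I * I + M * I ^ 2 := by
    have : ∀ x, (M * f x - I) ^ 2 = (M ^ 2 * f x ^ 2 - 2 * M * I * f x) + I ^ 2 := fun x => by ring
    have h3 : Integrable (fun x => M ^ 2 * f x ^ 2 - 2 * M * I * f x) ν :=
      (hsq.const_mul _).sub (hi.const_mul _)
    simp only [this]
    rw [integral_add h3 (integrable_const _),
      integral_sub (hsq.const_mul _) (hi.const_mul _), integral_const_mul, integral_const_mul,
      integral_const, smul_eq_mul]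
  rcases (measureReal_nonneg (μ := ν) (s := univ)).eq_or_lt with h0 | h0
  · have hν : ν = 0 := by
      rw [← Measure.measure_univ_eq_zero]
      exact (measureReal_eq_zero_iff).1 h0.symm
    simp [hI, hν]
  · have h3 : 0 ≤ M * (M * ∫ x, f x ^ 2 ∂ν - I ^ 2) := by rw [h2] at h; nlinarith
    have := nonneg_of_mul_nonneg_right h3 h0
    linarith

lemma integral_mul_le_sqrt_mul_sqrt {α : Type*} [MeasurableSpace α] {ν : Measure α}
    {f g : α → ℝ} (hf : MemLp f 2 ν) (hg : MemLp g 2 ν) :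
    ∫ x, f x * g x ∂ν ≤ √(∫ x, f x ^ 2 ∂ν) * √(∫ x, g x ^ 2 ∂ν) := by
  have h1 : ∫ x, f x * g x ∂ν ≤ ∫ x, ‖f x‖ * ‖g x‖ ∂ν :=
    integral_mono (hf.integrable_mul hg) (hf.norm.integrable_mul hg.norm)
      fun x => by simpa using le_abs_self (f x * g x)
  have h2 := integral_mul_norm_le_Lp_mul_Lq (μ := ν) (f := f) (g := g) (p := 2) (q := 2)
    Real.HolderConjugate.two_two (by simpa using hf) (by simpa using hg)
  simpa [Real.sqrt_eq_rpow] using h1.trans h2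

variable {E : Type*} [NormedAddCommGroup E] [NormedSpace ℝ E] [FiniteDimensional ℝ E]
  [MeasurableSpace E] [BorelSpace E]

/-- The average of a test function over the segments `[z - ζ, z]`. -/
noncomputable def segmentAverage (φ : E → ℝ) (ζ z : E) : ℝ := ∫ s in (0 : ℝ)..1, φ (z - s • ζ)

/-- The average is a convolution against the push-forward of Lebesgue measure to the segment `[0,
ζ]`, so its smoothness follows from that of convolutions with smooth kernels. -/
lemma segmentAverage_eq_convolution (φ : E → ℝ) (hφ : Continuous φ) (ζ : E) :
    segmentAverage φ ζ = convolution (fun _ : E => (1 : ℝ)) φ (ContinuousLinearMap.mul ℝ ℝ)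
      ((volume.restrict (Ioc (0 : ℝ) 1)).map (fun s : ℝ => s • ζ)) := by
  ext z
  rw [segmentAverage, intervalIntegral.integral_of_le zero_le_one, convolution, integral_map]
  · simp
  · fun_prop
  · exact (by fun_prop : Continuous _).aestronglyMeasurable

lemma contDiff_segmentAverage {φ : E → ℝ} (hφ : ContDiff ℝ ∞ φ) (hc : HasCompactSupport φ)
    (ζ : E) : ContDiff ℝ ∞ (segmentAverage φ ζ) := by
  rw [segmentAverage_eq_convolution φ hφ.continuous]
  exact hc.contDiff_convolution_right _ (locallyIntegrable_const _) hφ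

/-- Along the line `z + t • ζ` the average is the integral of `r ↦ φ (z + r • ζ)` over `[t - 1, t]`;
the fundamental theorem of calculus gives the derivative. A finite difference is thus a directional
derivative of a test function, against which a weak derivative can be tested. -/
lemma fderiv_segmentAverage {φ : E → ℝ} (hφ : ContDiff ℝ ∞ φ) (hc : HasCompactSupport φ)
    (ζ z : E) : fderiv ℝ (segmentAverage φ ζ) z ζ = φ z - φ (z - ζ) := by
  have hcont : Continuous fun r : ℝ => φ (z + r • ζ) := by
    have := hφ.continuous
    fun_prop
  have hd : Differentiable ℝ (segmentAverage φ ζ) :=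
    (contDiff_segmentAverage hφ hc ζ).differentiable (by simp)
  have h1 : HasDerivAt (fun t : ℝ => segmentAverage φ ζ (z + t • ζ))
      (fderiv ℝ (segmentAverage φ ζ) z ζ) 0 := by
    have h2 : HasDerivAt (fun t : ℝ => z + t • ζ) ζ 0 := by
      simpa using ((hasDerivAt_id (0 : ℝ)).smul_const ζ).const_add z
    have h3 : HasFDerivAt (segmentAverage φ ζ) (fderiv ℝ (segmentAverage φ ζ) z)
        (z + (0 : ℝ) • ζ) := by simpa using (hd z).hasFDerivAt
    exact h3.comp_hasDerivAt 0 h2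
  have h4 : ∀ t : ℝ, segmentAverage φ ζ (z + t • ζ) =
      (∫ r in (0 : ℝ)..t, φ (z + r • ζ)) - ∫ r in (0 : ℝ)..(t - 1), φ (z + r • ζ) := by
    intro t
    rw [intervalIntegral.integral_interval_sub_left (hcont.intervalIntegrable _ _)
      (hcont.intervalIntegrable _ _)]
    have := intervalIntegral.integral_comp_sub_left (a := 0) (b := 1)
      (fun r : ℝ => φ (z + r • ζ)) t
    rw [sub_zero] at this
    rw [← this, segmentAverage]
    congr 1; ext s; congr 1
    module
  have h5 : HasDerivAt (fun t : ℝ => segmentAverage φ ζ (z + t • ζ)) (φ z - φ (z - ζ)) 0 := by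
    have hA := (hcont.integral_hasStrictDerivAt 0 0).hasDerivAt
    have hB := (hcont.integral_hasStrictDerivAt 0 (0 - 1)).hasDerivAt.comp_sub_const 0 1
    have := hA.sub hB
    have e1 : (fun t : ℝ => segmentAverage φ ζ (z + t • ζ)) =
        (fun u => ∫ r in (0 : ℝ)..u, φ (z + r • ζ)) - fun u => ∫ r in (0 : ℝ)..u - 1, φ (z + r • ζ) :=
      funext h4
    rw [e1]
    have e2 : z + ((0 : ℝ) - 1) • ζ = z - ζ := by module
    rw [zero_smul, add_zero, e2] at this
    exact this
  exact h1.unique h5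

lemma tsupport_segmentAverage_subset {φ : E → ℝ} (hc : HasCompactSupport φ) (ζ : E) :
    tsupport (segmentAverage φ ζ) ⊆
      (fun p : ℝ × E => p.2 + p.1 • ζ) '' (Icc (0 : ℝ) 1 ×ˢ tsupport φ) ∧
    IsCompact ((fun p : ℝ × E => p.2 + p.1 • ζ) '' (Icc (0 : ℝ) 1 ×ˢ tsupport φ)) := by
  have hK : IsCompact ((fun p : ℝ × E => p.2 + p.1 • ζ) '' (Icc (0 : ℝ) 1 ×ˢ tsupport φ)) :=
    (isCompact_Icc.prod hc.isCompact).image (by fun_prop)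
  refine ⟨closure_minimal ?_ hK.isClosed, hK⟩
  intro z hz
  by_contra hn
  refine hz ?_
  rw [segmentAverage, intervalIntegral.integral_of_le zero_le_one]
  refine setIntegral_eq_zero_of_forall_eq_zero fun s hs => ?_
  refine image_eq_zero_of_notMem_tsupport fun hmem => hn ?_
  exact ⟨(s, z - s • ζ), ⟨⟨hs.1.le, hs.2⟩, hmem⟩, by simp⟩

/-- Jensen's inequality on the segment, then Fubini and the translation invariance of Haar measure.
-/
lemma integral_segmentAverage_sq_le {φ : E → ℝ} (hφ : ContDiff ℝ ∞ φ) (hc : HasCompactSupport φ)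
    (μ : Measure E) [μ.IsAddHaarMeasure] (ζ : E) :
    ∫ z, segmentAverage φ ζ z ^ 2 ∂μ ≤ ∫ z, φ z ^ 2 ∂μ := by
  have hcont := hφ.continuous
  obtain ⟨hK1, hK⟩ := tsupport_segmentAverage_subset hc ζ
  set K := (fun p : ℝ × E => p.2 + p.1 • ζ) '' (Icc (0 : ℝ) 1 ×ˢ tsupport φ) with hKdef
  have hle : ∀ z, segmentAverage φ ζ z ^ 2 ≤ ∫ s in Ioc (0 : ℝ) 1, φ (z - s • ζ) ^ 2 := by
    intro z
    have hm : MemLp (fun s : ℝ => φ (z - s • ζ)) 2 (volume.restrict (Ioc (0 : ℝ) 1)) := by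
      obtain ⟨C, hC⟩ := hcont.bounded_above_of_compact_support hc
      exact MemLp.of_bound (by fun_prop : Continuous _).aestronglyMeasurable C
        (Eventually.of_forall fun s => hC _)
    have := sq_integral_le_measureReal_mul hm
    rw [segmentAverage, intervalIntegral.integral_of_le zero_le_one]
    simpa using this
  have hint : Integrable (fun p : E × ℝ => φ (p.1 - p.2 • ζ) ^ 2)
      (μ.prod (volume.restrict (Ioc (0 : ℝ) 1))) := by
    have hKm : MeasurableSet (K ×ˢ (univ : Set ℝ)) := hK.measurableSet.prod MeasurableSet.univ
    have hfin : (μ.prod (volume.restrict (Ioc (0 : ℝ) 1))) (K ×ˢ univ) ≠ ⊤ := by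
      rw [Measure.prod_prod]
      exact ENNReal.mul_ne_top hK.measure_lt_top.ne (measure_ne_top _ _)
    obtain ⟨C, hC⟩ := hcont.bounded_above_of_compact_support hc
    have h1 : IntegrableOn (fun p : E × ℝ => φ (p.1 - p.2 • ζ) ^ 2) (K ×ˢ univ)
        (μ.prod (volume.restrict (Ioc (0 : ℝ) 1))) := by
      refine IntegrableOn.of_bound hfin.lt_top
        (by fun_prop : Continuous _).aestronglyMeasurable (C ^ 2) (Eventually.of_forall fun p => ?_)
      rw [norm_pow]
      exact pow_le_pow_left₀ (norm_nonneg _) (hC _) 2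
    refine h1.integrable_of_ae_notMem_eq_zero ?_
    have h2 : ∀ᵐ p : E × ℝ ∂(μ.prod (volume.restrict (Ioc (0 : ℝ) 1))), p.2 ∈ Ioc (0 : ℝ) 1 :=
      Measure.quasiMeasurePreserving_snd.ae (ae_restrict_mem measurableSet_Ioc)
    filter_upwards [h2] with p hp hpK
    have : φ (p.1 - p.2 • ζ) = 0 := image_eq_zero_of_notMem_tsupport fun hmem => hpK
      ⟨⟨(p.2, p.1 - p.2 • ζ), ⟨⟨hp.1.le, hp.2⟩, hmem⟩, by simp⟩, mem_univ _⟩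
    simp [this]
  calc ∫ z, segmentAverage φ ζ z ^ 2 ∂μ
      ≤ ∫ z, (∫ s in Ioc (0 : ℝ) 1, φ (z - s • ζ) ^ 2) ∂μ :=
        integral_mono_of_nonneg (Eventually.of_forall fun _ => sq_nonneg _)
          hint.integral_prod_left (Eventually.of_forall hle)
    _ = ∫ s in Ioc (0 : ℝ) 1, (∫ z, φ (z - s • ζ) ^ 2 ∂μ) := integral_integral_swap hint
    _ = ∫ s in Ioc (0 : ℝ) 1, (∫ z, φ z ^ 2 ∂μ) := by
        congr 1; ext s
        exact integral_sub_right_eq_self (fun z => φ z ^ 2) (s • ζ)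
    _ = ∫ z, φ z ^ 2 ∂μ := by simp

/-- Duality: the norm in `L²(O)` is determined by testing against smooth functions with compact
support in the open set `O`. -/
lemma integral_sq_le_of_forall_test (μ : Measure E) [μ.IsAddHaarMeasure] {O : Set E}
    (hO : IsOpen O) {F : E → ℝ} (hF : MemLp F 2 (μ.restrict O)) {κ : ℝ}
    (h : ∀ φ : E → ℝ, ContDiff ℝ ∞ φ → HasCompactSupport φ → tsupport φ ⊆ O →
      ∫ z in O, F z * φ z ∂μ ≤ κ * √(∫ z in O, φ z ^ 2 ∂μ)) :
    ∫ z in O, F z ^ 2 ∂μ ≤ κ ^ 2 := by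
  classical
  have hmem : ∀ φ : E → ℝ, ContDiff ℝ ∞ φ → HasCompactSupport φ → MemLp φ 2 (μ.restrict O) :=
    fun φ h1 h2 => (h1.continuous.memLp_of_hasCompactSupport h2).restrict O
  let S : Submodule ℝ (Lp ℝ 2 (μ.restrict O)) :=
    { carrier := {f | ∃ φ : E → ℝ, ContDiff ℝ ∞ φ ∧ HasCompactSupport φ ∧ tsupport φ ⊆ O ∧
        f =ᵐ[μ.restrict O] φ}
      add_mem' := by
        rintro f g ⟨φ, h1, h2, h3, h4⟩ ⟨ψ, k1, k2, k3, k4⟩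
        refine ⟨φ + ψ, h1.add k1, h2.add k2, (tsupport_add _ _).trans (union_subset h3 k3), ?_⟩
        exact (Lp.coeFn_add f g).trans (h4.add k4)
      zero_mem' := ⟨0, contDiff_const, HasCompactSupport.zero, by simp [tsupport], Lp.coeFn_zero _ _ _⟩
      smul_mem' := by
        rintro c f ⟨φ, h1, h2, h3, h4⟩
        refine ⟨c • φ, h1.const_smul c, h2.smul_left (f := fun _ => c),
          (closure_mono (Function.support_const_smul_subset c φ)).trans h3, ?_⟩
        exact (Lp.coeFn_smul c f).trans (h4.const_smul c) }
  -- By the fundamental lemma of the calculus of variations, an element orthogonal to all test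
  -- functions vanishes almost everywhere, so the test functions are dense.
  have hdense : S.topologicalClosure = ⊤ := by
    rw [Submodule.topologicalClosure_eq_top_iff, Submodule.eq_bot_iff]
    intro f hf
    have hf2 := Lp.memLp f
    have hloc : LocallyIntegrableOn f O μ := by
      have : LocallyIntegrable f (μ.restrict O) := hf2.locallyIntegrable one_le_two
      rw [locallyIntegrableOn_iff hO.isLocallyClosed]
      intro K hKO hK
      have h1 := this.integrableOn_isCompact hK
      rwa [IntegrableOn, Measure.restrict_restrict hK.measurableSet,
        inter_eq_self_of_subset_left hKO] at h1
    have h0 := hO.ae_eq_zero_of_integral_contDiff_smul_eq_zero hloc (fun φ h1 h2 h3 => by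
      have hm := hmem φ h1 h2
      have h4 := (Submodule.mem_orthogonal S f).1 hf (hm.toLp φ)
        ⟨φ, h1, h2, h3, hm.coeFn_toLp⟩
      rw [L2.inner_def] at h4
      have h5 : ∫ z in O, φ z • f z ∂μ = 0 := by
        rw [← h4]
        refine integral_congr_ae ?_
        filter_upwards [hm.coeFn_toLp] with z hz
        simp [hz, mul_comm]
      rw [← h5, setIntegral_eq_integral_of_forall_compl_eq_zero]
      intro z hz
      rw [image_eq_zero_of_notMem_tsupport (fun h => hz (h3 h)), zero_smul])
    rw [Lp.eq_zero_iff_ae_eq_zero]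
    exact (ae_restrict_iff' hO.measurableSet).2 h0
  set f : Lp ℝ 2 (μ.restrict O) := hF.toLp F with hf
  have hle : ∀ g ∈ S.topologicalClosure, inner ℝ f g ≤ κ * ‖g‖ := by
    intro g hg
    have hcl : IsClosed {g : Lp ℝ 2 (μ.restrict O) | inner ℝ f g ≤ κ * ‖g‖} :=
      isClosed_le (by fun_prop) (by fun_prop)
    refine closure_minimal (s := (S : Set (Lp ℝ 2 (μ.restrict O)))) ?_ hcl hg
    rintro g ⟨φ, h1, h2, h3, h4⟩
    have h5 := h φ h1 h2 h3
    have h6 : inner ℝ f g = ∫ z in O, F z * φ z ∂μ := by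
      rw [L2.inner_def]
      refine integral_congr_ae ?_
      filter_upwards [hF.coeFn_toLp, h4] with z hz hz'
      simp [hf, hz, hz', mul_comm]
    have h7 : ‖g‖ = √(∫ z in O, φ z ^ 2 ∂μ) := by
      rw [norm_eq_sqrt_real_inner, L2.inner_def]
      congr 1
      refine integral_congr_ae ?_
      filter_upwards [h4] with z hz'
      simp [hz', sq]
    show inner ℝ f g ≤ κ * ‖g‖
    rw [h6, h7]; exact h5
  have h1 := hle f (by rw [hdense]; trivial)
  have h2 : ∫ z in O, F z ^ 2 ∂μ = ‖f‖ ^ 2 := by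
    rw [← real_inner_self_eq_norm_sq, L2.inner_def]
    refine integral_congr_ae ?_
    filter_upwards [hF.coeFn_toLp] with z hz
    simp [hf, hz, sq]
  rw [h2]
  rw [real_inner_self_eq_norm_sq] at h1
  rcases (norm_nonneg f).eq_or_lt with h0 | h0
  · rw [← h0, zero_pow two_ne_zero]; exact sq_nonneg _
  · have : ‖f‖ ≤ κ := by nlinarith
    exact pow_le_pow_left₀ h0.le this 2

/-- Translations of a Sobolev function: `‖w(· + ζ) - w‖ ≤ ‖∂_ζ w‖` in `L²`, as long as the
segments of the translation stay in the domain. -/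
lemma integral_translate_sub_sq_le (μ : Measure E) [μ.IsAddHaarMeasure] {O G : Set E}
    (hO : IsOpen O) {ζ : E}
    (hseg : ∀ z ∈ O, ∀ s ∈ Icc (0 : ℝ) 1, z + s • ζ ∈ G) {w W : E → ℝ}
    (hw : MemLp w 2 μ) (hW : MemLp W 2 (μ.restrict G))
    (hweak : ∀ φ : E → ℝ, ContDiff ℝ ∞ φ → HasCompactSupport φ → tsupport φ ⊆ G →
      ∫ z in G, w z * fderiv ℝ φ z ζ ∂μ = -∫ z in G, W z * φ z ∂μ) :
    ∫ z in O, (w z - w (z + ζ)) ^ 2 ∂μ ≤ ∫ z in G, W z ^ 2 ∂μ := by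
  have hwt : MemLp (fun z => w (z + ζ)) 2 μ :=
    hw.comp_measurePreserving (measurePreserving_add_right μ ζ)
  have key := integral_sq_le_of_forall_test μ hO (F := fun z => w z - w (z + ζ))
    ((hw.sub hwt).restrict O) (κ := √(∫ z in G, W z ^ 2 ∂μ)) ?_
  · rwa [Real.sq_sqrt (integral_nonneg fun _ => sq_nonneg _)] at key
  intro φ h1 h2 h3
  have hφ : MemLp φ 2 μ := h1.continuous.memLp_of_hasCompactSupport h2
  -- The derivative of `Φ` along `ζ` is `φ - φ (· - ζ)`. Moving the translation onto `w` makes the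
  -- pairing of `w - w (· + ζ)` with `φ` equal to that of `w` with this derivative. The support of
  -- `Φ` lies in `G` by the hypothesis on segments, so the weak equation applies.
  set Φ := segmentAverage φ ζ with hΦ
  obtain ⟨hK1, hK⟩ := tsupport_segmentAverage_subset h2 ζ
  have hΦc : HasCompactSupport Φ := hK.of_isClosed_subset (isClosed_tsupport _) hK1
  have hΦd : ContDiff ℝ ∞ Φ := contDiff_segmentAverage h1 h2 ζ
  have hΦm : MemLp Φ 2 μ := hΦd.continuous.memLp_of_hasCompactSupport hΦc
  have hΦG : tsupport Φ ⊆ G := by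
    refine hK1.trans ?_
    rintro _ ⟨⟨s, z⟩, ⟨hs, hz⟩, rfl⟩
    exact hseg z (h3 hz) s hs
  have hφt : MemLp (fun z => φ (z - ζ)) 2 μ :=
    hφ.comp_measurePreserving (measurePreserving_sub_right μ ζ)
  have e1 : ∫ z in O, (w z - w (z + ζ)) * φ z ∂μ = ∫ z, (w z - w (z + ζ)) * φ z ∂μ := by
    refine setIntegral_eq_integral_of_forall_compl_eq_zero fun z hz => ?_
    rw [image_eq_zero_of_notMem_tsupport (fun h => hz (h3 h)), mul_zero]
  have e2 : ∫ z, (w z - w (z + ζ)) * φ z ∂μ = ∫ z, w z * fderiv ℝ Φ z ζ ∂μ := by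
    have e3 : ∫ z, w (z + ζ) * φ z ∂μ = ∫ z, w z * φ (z - ζ) ∂μ := by
      rw [← integral_add_right_eq_self (fun z => w z * φ (z - ζ)) ζ]
      simp
    simp only [hΦ, fderiv_segmentAverage h1 h2, sub_mul, mul_sub]
    have i1 : Integrable (fun z => w z * φ z) μ := hw.integrable_mul hφ
    have i2 : Integrable (fun z => w (z + ζ) * φ z) μ := hwt.integrable_mul hφ
    have i3 : Integrable (fun z => w z * φ (z - ζ)) μ := hw.integrable_mul hφt
    rw [integral_sub i1 i2, integral_sub i1 i3, e3]
  have e4 : ∫ z, w z * fderiv ℝ Φ z ζ ∂μ = ∫ z in G, w z * fderiv ℝ Φ z ζ ∂μ := by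
    refine (setIntegral_eq_integral_of_forall_compl_eq_zero fun z hz => ?_).symm
    have : fderiv ℝ Φ z = 0 := image_eq_zero_of_notMem_tsupport
      (fun h => hz (hΦG (tsupport_fderiv_subset ℝ h)))
    simp [this]
  rw [e1, e2, e4, hweak Φ hΦd hΦc hΦG]
  have e5 : -∫ z in G, W z * Φ z ∂μ = ∫ z in G, (-W z) * Φ z ∂μ := by
    rw [← integral_neg]; simp
  rw [e5]
  refine (integral_mul_le_sqrt_mul_sqrt hW.neg (hΦm.restrict G)).trans ?_
  simp only [Pi.neg_apply, neg_sq]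
  refine mul_le_mul_of_nonneg_left (Real.sqrt_le_sqrt ?_) (Real.sqrt_nonneg _)
  have e6 : ∫ z in O, φ z ^ 2 ∂μ = ∫ z, φ z ^ 2 ∂μ := by
    refine setIntegral_eq_integral_of_forall_compl_eq_zero fun z hz => ?_
    rw [image_eq_zero_of_notMem_tsupport (fun h => hz (h3 h))]; simp
  rw [e6]
  exact (setIntegral_le_integral hΦm.integrable_sq (Eventually.of_forall fun _ => sq_nonneg _)
    ).trans (integral_segmentAverage_sq_le h1 h2 μ ζ)

/-- Jensen's inequality in `ζ ∈ A` and Fubini reduce the deviation from the average to the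
individual translations. The average is left unnormalised, whence the factor `μ.real A`. -/
lemma integral_sub_average_sq_le (μ : Measure E) [μ.IsAddHaarMeasure] {O A : Set E}
    (hOfin : μ O ≠ ⊤) (hAfin : μ A ≠ ⊤) {w : E → ℝ}
    (hw : MemLp w 2 μ) (hws : StronglyMeasurable w) {κ : ℝ}
    (hA : MeasurableSet A)
    (h : ∀ ζ ∈ A, ∫ z in O, (w z - w (z + ζ)) ^ 2 ∂μ ≤ κ) :
    ∫ z in O, (μ.real A * w z - ∫ ζ in A, w (z + ζ) ∂μ) ^ 2 ∂μ ≤ μ.real A ^ 2 * κ := by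
  have : IsFiniteMeasure (μ.restrict O) := ⟨by simpa using hOfin.lt_top⟩
  have : IsFiniteMeasure (μ.restrict A) := ⟨by simpa using hAfin.lt_top⟩
  have hwt : ∀ z, MemLp (fun ζ => w (z + ζ)) 2 μ := fun z =>
    hw.comp_measurePreserving (measurePreserving_add_left μ z)
  have hwt' : ∀ z, MemLp (fun ζ => w (ζ + z)) 2 μ := fun z =>
    hw.comp_measurePreserving (measurePreserving_add_right μ z)
  have hle : ∀ z, (μ.real A * w z - ∫ ζ in A, w (z + ζ) ∂μ) ^ 2 ≤
      μ.real A * ∫ ζ in A, (w z - w (z + ζ)) ^ 2 ∂μ := by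
    intro z
    have h1 : MemLp (fun ζ => w z - w (z + ζ)) 2 (μ.restrict A) :=
      (memLp_const _).sub ((hwt z).restrict A)
    have h2 := sq_integral_le_measureReal_mul h1
    rw [integral_sub (integrable_const _) (((hwt z).restrict A).integrable one_le_two),
      integral_const, smul_eq_mul, measureReal_restrict_apply_univ] at h2
    exact h2
  have hint : Integrable (fun p : E × E => (w p.1 - w (p.1 + p.2)) ^ 2)
      ((μ.restrict O).prod (μ.restrict A)) := by
    have hm : StronglyMeasurable (fun p : E × E => w p.1 - w (p.1 + p.2)) :=
      (hws.comp_measurable measurable_fst).sub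
        (hws.comp_measurable (measurable_fst.add measurable_snd))
    have hs2 : Integrable (fun z => w z ^ 2) μ := hw.integrable_sq
    refine (integrable_prod_iff (hm.pow 2).aestronglyMeasurable).2 ⟨?_, ?_⟩
    · refine Eventually.of_forall fun z => ?_
      exact ((memLp_const (w z)).sub ((hwt z).restrict A)).integrable_sq
    · have hb : Integrable (fun z => 2 * μ.real A * w z ^ 2 + 2 * ∫ ζ, w ζ ^ 2 ∂μ)
          (μ.restrict O) := (hs2.restrict.const_mul _).add (integrable_const _)
      refine hb.mono' ?_ (Eventually.of_forall fun z => ?_)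
      · exact ((hm.pow 2).norm.integral_prod_right'
          (ν := μ.restrict A)).aestronglyMeasurable
      · have hn : ∀ ζ, ‖(w z - w (z + ζ)) ^ 2‖ = (w z - w (z + ζ)) ^ 2 := fun ζ =>
          Real.norm_of_nonneg (sq_nonneg _)
        simp only [Pi.pow_apply, hn]
        rw [Real.norm_of_nonneg (integral_nonneg fun _ => sq_nonneg _)]
        have i1 : Integrable (fun ζ => 2 * w (z + ζ) ^ 2) μ := (hwt z).integrable_sq.const_mul 2
        calc ∫ ζ in A, (w z - w (z + ζ)) ^ 2 ∂μ
            ≤ ∫ ζ in A, (2 * w z ^ 2 + 2 * w (z + ζ) ^ 2) ∂μ :=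
              integral_mono_of_nonneg (Eventually.of_forall fun _ => sq_nonneg _)
                ((integrable_const _).add i1.restrict)
                (Eventually.of_forall fun ζ => by
                  have := sq_nonneg (w z + w (z + ζ))
                  simp only; nlinarith)
          _ = 2 * μ.real A * w z ^ 2 + ∫ ζ in A, 2 * w (z + ζ) ^ 2 ∂μ := by
              rw [integral_add (integrable_const _) i1.restrict, integral_const, smul_eq_mul,
                measureReal_restrict_apply_univ]
              ring
          _ ≤ 2 * μ.real A * w z ^ 2 + ∫ ζ, 2 * w (z + ζ) ^ 2 ∂μ := by
              refine add_le_add le_rfl ?_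
              exact setIntegral_le_integral i1 (Eventually.of_forall fun _ => by positivity)
          _ = _ := by
              rw [integral_const_mul, integral_add_left_eq_self (fun ζ => w ζ ^ 2) z]
  calc ∫ z in O, (μ.real A * w z - ∫ ζ in A, w (z + ζ) ∂μ) ^ 2 ∂μ
      ≤ ∫ z in O, μ.real A * (∫ ζ in A, (w z - w (z + ζ)) ^ 2 ∂μ) ∂μ :=
        integral_mono_of_nonneg (Eventually.of_forall fun _ => sq_nonneg _)
          (hint.integral_prod_left.const_mul _) (Eventually.of_forall hle)
    _ = μ.real A * ∫ ζ in A, (∫ z in O, (w z - w (z + ζ)) ^ 2 ∂μ) ∂μ := by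
        rw [integral_const_mul, integral_integral_swap hint]
    _ ≤ μ.real A * ∫ ζ in A, κ ∂μ := by
        refine mul_le_mul_of_nonneg_left ?_ measureReal_nonneg
        exact setIntegral_mono_on hint.integral_prod_right (integrable_const _) hA h
    _ = μ.real A ^ 2 * κ := by
        rw [integral_const, smul_eq_mul, measureReal_restrict_apply_univ]; ring

/-- Bounded sequences in `L²` of a finite-dimensional space have weakly convergent
subsequences. -/
lemma exists_subseq_weakly_convergent (μ : Measure E) [μ.IsAddHaarMeasure] {w : ℕ → E → ℝ}
    (hw : ∀ k, MemLp (w k) 2 μ) {C : ℝ} (hC : ∀ k, ∫ z, w k z ^ 2 ∂μ ≤ C) :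
    ∃ φ : ℕ → ℕ, StrictMono φ ∧ ∀ f : E → ℝ, MemLp f 2 μ →
      ∃ c : ℝ, Tendsto (fun k => ∫ z, w (φ k) z * f z ∂μ) atTop (𝓝 c) := by
  have : Fact ((2 : ENNReal) ≠ ⊤) := ⟨by simp⟩
  let T : ℕ → WeakDual ℝ (Lp ℝ 2 μ) := fun k =>
    StrongDual.toWeakDual (innerSL ℝ ((hw k).toLp (w k)))
  have hT : ∀ k, T k ∈ WeakDual.toStrongDual ⁻¹' Metric.closedBall
      (0 : StrongDual ℝ (Lp ℝ 2 μ)) (√C) := by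
    intro k
    have h1 : ‖(hw k).toLp (w k)‖ ≤ √C := by
      rw [norm_eq_sqrt_real_inner, L2.inner_def]
      refine Real.sqrt_le_sqrt (le_trans (le_of_eq ?_) (hC k))
      refine integral_congr_ae ?_
      filter_upwards [(hw k).coeFn_toLp] with z hz
      simp [hz, sq]
    simpa [T] using h1
  -- Sequential Banach–Alaoglu in the dual of `L²`, with the functions seen as functionals through
  -- the inner product.
  obtain ⟨S, -, φ, hφ, hlim⟩ := WeakDual.isSeqCompact_closedBall ℝ (Lp ℝ 2 μ) 0 (√C) hT
  refine ⟨φ, hφ, fun f hf => ⟨S (hf.toLp f), ?_⟩⟩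
  have h1 := ((WeakDual.eval_continuous (hf.toLp f)).tendsto S).comp hlim
  refine h1.congr fun k => ?_
  simp only [Function.comp_apply, T]
  show inner ℝ ((hw (φ k)).toLp (w (φ k))) (hf.toLp f) = _
  rw [L2.inner_def]
  refine integral_congr_ae ?_
  filter_upwards [(hw (φ k)).coeFn_toLp, hf.coeFn_toLp] with z hz hz'
  simp [hz, hz', mul_comm]

/-- Averages of an `L²`-bounded sequence over translates of a bounded set converge in `L²` of
bounded sets, along a subsequence. -/
lemma exists_subseq_average_cauchy (μ : Measure E) [μ.IsAddHaarMeasure] {w : ℕ → E → ℝ}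
    (hw : ∀ k, MemLp (w k) 2 μ) (hws : ∀ k, StronglyMeasurable (w k))
    {C : ℝ} (hC : ∀ k, ∫ z, w k z ^ 2 ∂μ ≤ C) :
    ∃ φ : ℕ → ℕ, StrictMono φ ∧ ∀ O A : Set E, μ O ≠ ⊤ → μ A ≠ ⊤ → MeasurableSet A →
      ∀ ε > 0, ∃ N, ∀ k ≥ N, ∀ l ≥ N,
        ∫ z in O, ((∫ ζ in A, w (φ k) (z + ζ) ∂μ) - ∫ ζ in A, w (φ l) (z + ζ) ∂μ) ^ 2 ∂μ < ε := by
  obtain ⟨φ, hφ, hlim⟩ := exists_subseq_weakly_convergent μ hw hC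
  refine ⟨φ, hφ, fun O A hO hA hAm ε hε => ?_⟩
  have : IsFiniteMeasure (μ.restrict O) := ⟨by simpa using hO.lt_top⟩
  have : IsFiniteMeasure (μ.restrict A) := ⟨by simpa using hA.lt_top⟩
  set p : ℕ → E → ℝ := fun k z => ∫ ζ in A, w (φ k) (z + ζ) ∂μ with hp
  have hpm : ∀ k, StronglyMeasurable (p k) := fun k =>
    ((hws (φ k)).comp_measurable (measurable_fst.add measurable_snd)).integral_prod_right'
      (ν := μ.restrict A)
  have hwt : ∀ k z, MemLp (fun ζ => w k (z + ζ)) 2 μ := fun k z =>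
    (hw k).comp_measurePreserving (measurePreserving_add_left μ z)
  set B : ℝ := √(μ.real A * C) with hB
  have hpb : ∀ k z, ‖p k z‖ ≤ B := by
    intro k z
    have h1 := sq_integral_le_measureReal_mul ((hwt (φ k) z).restrict A)
    rw [measureReal_restrict_apply_univ] at h1
    rw [Real.norm_eq_abs]
    refine Real.abs_le_sqrt (h1.trans (mul_le_mul_of_nonneg_left ?_ measureReal_nonneg))
    refine (setIntegral_le_integral (hwt (φ k) z).integrable_sq
      (Eventually.of_forall fun _ => sq_nonneg _)).trans ?_
    rw [integral_add_left_eq_self (fun ζ => w (φ k) ζ ^ 2) z]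
    exact hC _
  -- The average at `z` is the pairing with the indicator function of `z + A`, so weak convergence
  -- gives pointwise convergence. Since the averages are uniformly bounded, dominated convergence
  -- then gives convergence in `L²(O)`.
  have hpt : ∀ z, ∃ c, Tendsto (fun k => p k z) atTop (𝓝 c) := by
    intro z
    have hm : MeasurableSet ((fun y => y - z) ⁻¹' A) := (measurable_id.sub_const z) hAm
    have hfin : μ ((fun y => y - z) ⁻¹' A) ≠ ⊤ := by
      have := (measurePreserving_sub_right μ z).measure_preimage hAm.nullMeasurableSet
      rw [this]; exact hA
    obtain ⟨c, hc⟩ := hlim (((fun y => y - z) ⁻¹' A).indicator fun _ => (1 : ℝ))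
      (memLp_indicator_const 2 hm 1 (Or.inr hfin))
    refine ⟨c, hc.congr fun k => ?_⟩
    rw [hp]
    simp only
    rw [← integral_indicator hAm,
      ← integral_add_left_eq_self (fun y => w (φ k) y * ((fun y => y - z) ⁻¹' A).indicator
        (fun _ => (1 : ℝ)) y) z]
    congr 1; ext ζ
    by_cases h : ζ ∈ A <;> simp [h, indicator]
  choose P hP using hpt
  have hPm : AEStronglyMeasurable P (μ.restrict O) :=
    aestronglyMeasurable_of_tendsto_ae atTop (fun k => (hpm k).aestronglyMeasurable)
      (Eventually.of_forall hP)
  have hPb : ∀ z, ‖P z‖ ≤ B := fun z => le_of_tendsto (hP z).norm (Eventually.of_forall fun k => hpb k z)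
  have hconv : Tendsto (fun k => ∫ z in O, (p k z - P z) ^ 2 ∂μ) atTop (𝓝 0) := by
    have h1 : Tendsto (fun k => ∫ z in O, (p k z - P z) ^ 2 ∂μ) atTop (𝓝 (∫ z in O, (0 : ℝ) ∂μ)) := by
      refine tendsto_integral_of_dominated_convergence (fun _ => (2 * B) ^ 2)
        (fun k => ((hpm k).aestronglyMeasurable.sub hPm).pow 2) (integrable_const _)
        (fun k => Eventually.of_forall fun z => ?_) (Eventually.of_forall fun z => ?_)
      · rw [norm_pow]
        refine pow_le_pow_left₀ (norm_nonneg _) ((norm_sub_le _ _).trans ?_) 2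
        linarith [hpb k z, hPb z]
      · simpa using ((hP z).sub_const (P z)).pow 2
    simpa using h1
  obtain ⟨N, hN⟩ := (hconv.eventually (gt_mem_nhds (show 0 < ε / 4 by positivity))
    ).exists_forall_of_atTop
  refine ⟨N, fun k hk l hl => ?_⟩
  have hml : ∀ k, MemLp (fun z => p k z - P z) 2 (μ.restrict O) := fun k =>
    MemLp.of_bound ((hpm k).aestronglyMeasurable.sub hPm) (2 * B)
      (Eventually.of_forall fun z => (norm_sub_le _ _).trans (by linarith [hpb k z, hPb z]))
  calc ∫ z in O, (p k z - p l z) ^ 2 ∂μ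
      ≤ ∫ z in O, (2 * (p k z - P z) ^ 2 + 2 * (p l z - P z) ^ 2) ∂μ :=
        integral_mono_of_nonneg (Eventually.of_forall fun _ => sq_nonneg _)
          (((hml k).integrable_sq.const_mul 2).add ((hml l).integrable_sq.const_mul 2))
          (Eventually.of_forall fun z => by
            have := sq_nonneg (p k z - P z + (p l z - P z))
            simp only; nlinarith)
    _ = 2 * ∫ z in O, (p k z - P z) ^ 2 ∂μ + 2 * ∫ z in O, (p l z - P z) ^ 2 ∂μ := by
        rw [integral_add ((hml k).integrable_sq.const_mul 2) ((hml l).integrable_sq.const_mul 2),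
          integral_const_mul, integral_const_mul]
    _ < ε := by linarith [hN k hk, hN l hl]

/-- Local Rellich compactness: near a point at which the open set `D` contains a cone of directions,
bounded sequences in `H¹` have subsequences that converge in `L²`. -/
theorem exists_subseq_cauchy_of_cone (μ : Measure E) [μ.IsAddHaarMeasure] {D : Set E}
    (hD : IsOpen D) {z₀ ζ₀ : E} {r η ρ R : ℝ} (hr : 0 < r) (hη : 0 < η) (hρ : 0 < ρ) (hR : 0 < R)
    (hcone : ∀ a ∈ D ∩ Metric.ball z₀ r, ∀ h ∈ Ioo 0 η, ∀ ζ ∈ Metric.ball ζ₀ ρ, a + h • ζ ∈ D) :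
    ∃ r' > 0, r' < R ∧ ∀ (w : ℕ → E → ℝ) (W : ℕ → E → E → ℝ) (C : ℝ),
      (∀ k, MemLp (w k) 2 (μ.restrict (D ∩ Metric.ball z₀ R))) →
      (∀ k, ∫ z in D ∩ Metric.ball z₀ R, w k z ^ 2 ∂μ ≤ C) →
      (∀ k v, MemLp (W k v) 2 (μ.restrict (D ∩ Metric.ball z₀ R))) →
      (∀ k v, ∫ z in D ∩ Metric.ball z₀ R, W k v z ^ 2 ∂μ ≤ C * ‖v‖ ^ 2) →
      (∀ k v (φ : E → ℝ), ContDiff ℝ ∞ φ → HasCompactSupport φ →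
        tsupport φ ⊆ D ∩ Metric.ball z₀ R →
        ∫ z in D ∩ Metric.ball z₀ R, w k z * fderiv ℝ φ z v ∂μ =
          -∫ z in D ∩ Metric.ball z₀ R, W k v z * φ z ∂μ) →
      ∃ φ : ℕ → ℕ, StrictMono φ ∧ ∀ ε > 0, ∃ N, ∀ k ≥ N, ∀ l ≥ N,
        ∫ z in D ∩ Metric.ball z₀ r', (w (φ k) z - w (φ l) z) ^ 2 ∂μ < ε := by
  -- The bound by `r` makes the cone condition available on the small ball; the bound by `R / 2`
  -- leaves room for translations of length up to `R / 2` inside the ball of radius `R`.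
  refine ⟨min r (R / 2), by positivity, (min_le_right _ _).trans_lt (by linarith), ?_⟩
  set r' := min r (R / 2) with hr'
  intro w W C hw hwC hW hWC hweak
  set G := D ∩ Metric.ball z₀ R with hG
  set O := D ∩ Metric.ball z₀ r' with hO
  have hGo : IsOpen G := hD.inter Metric.isOpen_ball
  have hOo : IsOpen O := hD.inter Metric.isOpen_ball
  have hOfin : μ O ≠ ⊤ := ((measure_mono inter_subset_right).trans_lt measure_ball_lt_top).ne
  have hOG : O ⊆ G := fun z hz => ⟨hz.1, Metric.ball_subset_ball
    ((min_le_right _ _).trans (by linarith)) hz.2⟩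
  -- strongly measurable representatives on the whole space
  have hind : ∀ k, MemLp (G.indicator (w k)) 2 μ := fun k =>
    (memLp_indicator_iff_restrict hGo.measurableSet).2 (hw k)
  set u : ℕ → E → ℝ := fun k => (hind k).1.mk _ with hu
  have hus : ∀ k, StronglyMeasurable (u k) := fun k => (hind k).1.stronglyMeasurable_mk
  have hueq : ∀ k, G.indicator (w k) =ᵐ[μ] u k := fun k => (hind k).1.ae_eq_mk
  have hum : ∀ k, MemLp (u k) 2 μ := fun k => (hind k).ae_eq (hueq k)
  have huG : ∀ k, ∀ᵐ z ∂(μ.restrict G), w k z = u k z := fun k => by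
    filter_upwards [ae_restrict_of_ae (hueq k), ae_restrict_mem hGo.measurableSet] with z h1 h2
    rw [← h1, indicator_of_mem h2]
  have huC : ∀ k, ∫ z, u k z ^ 2 ∂μ ≤ C := fun k => by
    refine le_trans (le_of_eq ?_) (hwC k)
    rw [← integral_indicator hGo.measurableSet]
    refine integral_congr_ae ?_
    filter_upwards [hueq k] with z hz
    rw [← hz]
    by_cases h : z ∈ G <;> simp [h]
  have hC0 : 0 ≤ C := le_trans (integral_nonneg fun _ => sq_nonneg _) (huC 0)
  obtain ⟨φ, hφ, hcau⟩ := exists_subseq_average_cauchy μ hum hus huC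
  refine ⟨φ, hφ, fun ε hε => ?_⟩
  set M := ‖ζ₀‖ + ρ with hM
  have hM0 : 0 < M := by positivity
  -- The step `h` is small enough for the cone condition, for the translates to stay in the larger
  -- ball, and for the squared norm of a difference under a translation in `A`, at most `h² C M²`,
  -- to be below `ε / 12`.
  obtain ⟨h, hh0, hh1, hh2, hh3⟩ : ∃ h : ℝ, 0 < h ∧ h < η ∧ h * M ≤ R / 2 ∧
      h ^ 2 * (C * M ^ 2) ≤ ε / 12 := by
    have c1 : ∀ᶠ h : ℝ in 𝓝[>] 0, h < η :=
      (eventually_lt_nhds hη).filter_mono nhdsWithin_le_nhds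
    have c2 : ∀ᶠ h : ℝ in 𝓝[>] 0, h * M < R / 2 := by
      have : Tendsto (fun h : ℝ => h * M) (𝓝[>] 0) (𝓝 (0 * M)) :=
        ((continuous_id.mul continuous_const).tendsto 0).mono_left nhdsWithin_le_nhds
      exact this.eventually (gt_mem_nhds (by rw [zero_mul]; positivity))
    have c3 : ∀ᶠ h : ℝ in 𝓝[>] 0, h ^ 2 * (C * M ^ 2) < ε / 12 := by
      have : Tendsto (fun h : ℝ => h ^ 2 * (C * M ^ 2)) (𝓝[>] 0) (𝓝 (0 ^ 2 * (C * M ^ 2))) :=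
        (((continuous_id.pow 2).mul continuous_const).tendsto 0).mono_left nhdsWithin_le_nhds
      exact this.eventually (gt_mem_nhds (by simp; positivity))
    obtain ⟨h, h1, h2, h3, h4⟩ := ((eventually_mem_nhdsWithin (a := (0 : ℝ)) (s := Ioi 0)).and (c1.and (c2.and c3))).exists
    exact ⟨h, h1, h2, h3.le, h4.le⟩
  set A := Metric.ball (h • ζ₀) (h * ρ) with hA
  have hAm : MeasurableSet A := Metric.isOpen_ball.measurableSet
  have hAfin : μ A ≠ ⊤ := measure_ball_lt_top.ne
  have hApos : 0 < μ.real A :=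
    ENNReal.toReal_pos (Metric.measure_ball_pos μ _ (by positivity)).ne' hAfin
  have hAdir : ∀ ζ ∈ A, ∃ ξ ∈ Metric.ball ζ₀ ρ, ζ = h • ξ := by
    intro ζ hζ
    refine ⟨h⁻¹ • ζ, ?_, by rw [smul_smul, mul_inv_cancel₀ hh0.ne', one_smul]⟩
    rw [hA, mem_ball_iff_norm] at hζ
    rw [mem_ball_iff_norm]
    have : h⁻¹ • ζ - ζ₀ = h⁻¹ • (ζ - h • ζ₀) := by
      rw [smul_sub, smul_smul, inv_mul_cancel₀ hh0.ne', one_smul]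
    rw [this, norm_smul, norm_inv, Real.norm_of_nonneg hh0.le, inv_mul_lt_iff₀ hh0]
    exact hζ
  have hAnorm : ∀ ζ ∈ A, ‖ζ‖ ≤ h * M := by
    intro ζ hζ
    obtain ⟨ξ, hξ, rfl⟩ := hAdir ζ hζ
    rw [norm_smul, Real.norm_of_nonneg hh0.le]
    refine mul_le_mul_of_nonneg_left ?_ hh0.le
    rw [mem_ball_iff_norm] at hξ
    linarith [norm_sub_norm_le ξ ζ₀]
  have hseg : ∀ ζ ∈ A, ∀ z ∈ O, ∀ s ∈ Icc (0 : ℝ) 1, z + s • ζ ∈ G := by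
    intro ζ hζ z hz s hs
    obtain ⟨ξ, hξ, hζe⟩ := hAdir ζ hζ
    refine ⟨?_, ?_⟩
    · rcases hs.1.eq_or_lt with h0 | h0
      · rw [← h0, zero_smul, add_zero]; exact hz.1
      · rw [hζe, smul_smul]
        refine hcone z ⟨hz.1, Metric.ball_subset_ball (min_le_left _ _) hz.2⟩ _
          ⟨by positivity, ?_⟩ ξ hξ
        nlinarith [hs.2]
    · have h1 := hAnorm ζ hζ
      have h2 := hz.2
      rw [mem_ball_iff_norm] at h2 ⊢
      have h3 : ‖z + s • ζ - z₀‖ ≤ ‖z - z₀‖ + ‖s • ζ‖ := by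
        rw [add_sub_right_comm]; exact norm_add_le _ _
      rw [norm_smul, Real.norm_of_nonneg hs.1] at h3
      have h4 : s * ‖ζ‖ ≤ ‖ζ‖ := by nlinarith [hs.2, norm_nonneg ζ]
      have h5 : r' ≤ R / 2 := min_le_right _ _
      linarith
  have hap : ∀ k, ∫ z in O, (μ.real A * u k z - ∫ ζ in A, u k (z + ζ) ∂μ) ^ 2 ∂μ ≤
      μ.real A ^ 2 * (ε / 12) := by
    intro k
    refine integral_sub_average_sq_le μ hOfin hAfin (hum k) (hus k) hAm fun ζ hζ => ?_
    refine (integral_translate_sub_sq_le μ hOo (hseg ζ hζ) (hum k) (hW k ζ) ?_).trans ?_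
    · intro φ h1 h2 h3
      rw [← hweak k ζ φ h1 h2 h3]
      refine integral_congr_ae ?_
      filter_upwards [huG k] with z hz
      rw [hz]
    · refine (hWC k ζ).trans (le_trans ?_ hh3)
      have := hAnorm ζ hζ
      calc C * ‖ζ‖ ^ 2 ≤ C * (h * M) ^ 2 := by gcongr
        _ = _ := by ring
  obtain ⟨N, hN⟩ := hcau O A hOfin hAfin hAm (μ.real A ^ 2 * (ε / 12)) (by positivity)
  refine ⟨N, fun k hk l hl => ?_⟩
  have hkl := hN k hk l hl
  set p : ℕ → E → ℝ := fun k z => ∫ ζ in A, u k (z + ζ) ∂μ with hp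
  have : IsFiniteMeasure (μ.restrict O) := ⟨by simpa using hOfin.lt_top⟩
  have hpm : ∀ k, MemLp (p k) 2 (μ.restrict O) := fun k => by
    have : IsFiniteMeasure (μ.restrict A) := ⟨by simpa using hAfin.lt_top⟩
    have hwt : ∀ z, MemLp (fun ζ => u k (z + ζ)) 2 μ := fun z =>
      (hum k).comp_measurePreserving (measurePreserving_add_left μ z)
    refine MemLp.of_bound (((hus k).comp_measurable (measurable_fst.add measurable_snd)
      ).integral_prod_right' (ν := μ.restrict A)).aestronglyMeasurable (√(μ.real A * C))
      (Eventually.of_forall fun z => ?_)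
    have h1 := sq_integral_le_measureReal_mul ((hwt z).restrict A)
    rw [measureReal_restrict_apply_univ] at h1
    rw [Real.norm_eq_abs]
    refine Real.abs_le_sqrt (h1.trans (mul_le_mul_of_nonneg_left ?_ measureReal_nonneg))
    refine (setIntegral_le_integral (hwt z).integrable_sq
      (Eventually.of_forall fun _ => sq_nonneg _)).trans ?_
    rw [integral_add_left_eq_self (fun ζ => u k ζ ^ 2) z]
    exact huC _
  have hm1 : ∀ k, MemLp (fun z => μ.real A * u k z - p k z) 2 (μ.restrict O) := fun k =>
    (((hum k).restrict O).const_mul _).sub (hpm k)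
  have hm2 : MemLp (fun z => p (φ k) z - p (φ l) z) 2 (μ.restrict O) := (hpm _).sub (hpm _)
  have i1 := (hm1 (φ k)).integrable_sq.const_mul 3
  have i2 := (hm1 (φ l)).integrable_sq.const_mul 3
  have i3 := hm2.integrable_sq.const_mul 3
  -- The difference is split into two deviations from averages and one difference of averages. Each
  -- contributes at most `3 * (ε / 12)`, up to the factor `μ.real A ^ 2`, for a total of `3 / 4` of
  -- the target.
  have hmain : μ.real A ^ 2 * ∫ z in O, (w (φ k) z - w (φ l) z) ^ 2 ∂μ < μ.real A ^ 2 * ε := by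
    calc μ.real A ^ 2 * ∫ z in O, (w (φ k) z - w (φ l) z) ^ 2 ∂μ
        = ∫ z in O, μ.real A ^ 2 * (u (φ k) z - u (φ l) z) ^ 2 ∂μ := by
          rw [integral_const_mul]
          congr 1
          refine integral_congr_ae ?_
          filter_upwards [ae_restrict_of_ae_restrict_of_subset hOG (huG (φ k)),
            ae_restrict_of_ae_restrict_of_subset hOG (huG (φ l))] with z h1 h2
          rw [h1, h2]
      _ ≤ ∫ z in O, (3 * (μ.real A * u (φ k) z - p (φ k) z) ^ 2 +
            3 * (μ.real A * u (φ l) z - p (φ l) z) ^ 2 + 3 * (p (φ k) z - p (φ l) z) ^ 2) ∂μ := by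
          refine integral_mono_of_nonneg (Eventually.of_forall fun _ => by positivity)
            ((i1.add i2).add i3) (Eventually.of_forall fun z => ?_)
          simp only
          set x := μ.real A * u (φ k) z - p (φ k) z with hx
          set y := μ.real A * u (φ l) z - p (φ l) z with hy
          set t := p (φ k) z - p (φ l) z with ht
          have : μ.real A ^ 2 * (u (φ k) z - u (φ l) z) ^ 2 = (x - y + t) ^ 2 := by
            rw [hx, hy, ht]; ring
          rw [this]
          nlinarith [sq_nonneg (x + y), sq_nonneg (x - t), sq_nonneg (y + t)]
      _ = 3 * ∫ z in O, (μ.real A * u (φ k) z - p (φ k) z) ^ 2 ∂μ +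
            3 * ∫ z in O, (μ.real A * u (φ l) z - p (φ l) z) ^ 2 ∂μ +
            3 * ∫ z in O, (p (φ k) z - p (φ l) z) ^ 2 ∂μ := by
          rw [integral_add (by exact i1.add i2) i3, integral_add i1 i2, integral_const_mul,
            integral_const_mul, integral_const_mul]
      _ < μ.real A ^ 2 * ε := by
          have h1 := hap (φ k)
          have h2 := hap (φ l)
          have h3 : 0 < μ.real A ^ 2 * ε := by positivity
          linarith
  exact lt_of_mul_lt_mul_left hmain (by positivity)

end EuclideanRellich

/-! ### The cone condition -/

section Cone

variable {E : Type*} [NormedAddCommGroup E] [NormedSpace ℝ E]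

/-- Near `z₀`, the set `D` is mapped to itself by the small translations in a cone with axis `ζ₀`. -/
def HasConeAt (D : Set E) (z₀ ζ₀ : E) : Prop :=
  ∃ r η ρ : ℝ, 0 < r ∧ 0 < η ∧ 0 < ρ ∧
    ∀ a ∈ D ∩ Metric.ball z₀ r, ∀ h ∈ Ioo 0 η, ∀ ζ ∈ Metric.ball ζ₀ ρ, a + h • ζ ∈ D

/-- With axis `0` the cone of directions is a full ball about the origin. Interior points are
therefore covered by the same condition as boundary points. -/
lemma IsOpen.hasConeAt_zero {D : Set E} (hD : IsOpen D) {z₀ : E} (hz : z₀ ∈ D) :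
    HasConeAt D z₀ 0 := by
  obtain ⟨δ, hδ, hball⟩ := Metric.isOpen_iff.1 hD z₀ hz
  refine ⟨δ / 2, 1, δ / 2, by positivity, one_pos, by positivity, fun a ha h hh ζ hζ => hball ?_⟩
  have h1 := ha.2
  rw [mem_ball_iff_norm] at h1 hζ ⊢
  rw [sub_zero] at hζ
  rw [add_sub_right_comm]
  refine (norm_add_le _ _).trans_lt ?_
  rw [norm_smul, Real.norm_of_nonneg hh.1.le]
  have : h * ‖ζ‖ ≤ ‖ζ‖ := by nlinarith [hh.2, norm_nonneg ζ]
  linarith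

/-- The axis is `c • e` with `c = L + 2`. A displacement `h • (c • e + ξ)` with `‖ξ‖ < 1` raises the
height by at least `h * (c - 1) = h * (L + 1)`, while `γ`, which ignores the component along `e`,
rises by at most `L * h`. -/
lemma hasConeAt_of_isLipschitzEpigraphNear {n : ℕ} {D : Set (EuclideanSpace ℝ (Fin n))}
    {z₀ : EuclideanSpace ℝ (Fin n)} (h : NeumannDirichlet.IsLipschitzEpigraphNear D z₀) :
    ∃ ζ₀, HasConeAt D z₀ ζ₀ := by
  obtain ⟨e, γ, L, he, hL, hinv, hev⟩ := h
  obtain ⟨δ, hδ, hball⟩ := Metric.eventually_nhds_iff_ball.1 hev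
  set c : ℝ := L + 2 with hc
  have hc0 : 0 < c := by positivity
  refine ⟨c • e, δ / 2, δ / (2 * (c + 1)), 1, by positivity, by positivity, one_pos, ?_⟩
  rintro a ⟨haD, ha⟩ h ⟨hh0, hh1⟩ ζ hζ
  rw [mem_ball_iff_norm] at ha hζ
  set ξ := ζ - c • e with hξ
  have hζe : ζ = c • e + ξ := by rw [hξ]; abel
  have hζn : ‖ζ‖ ≤ c + 1 := by
    rw [hζe]
    refine (norm_add_le _ _).trans ?_
    rw [norm_smul, he, mul_one, Real.norm_of_nonneg hc0.le]
    linarith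
  have hab : a ∈ Metric.ball z₀ δ := by rw [mem_ball_iff_norm]; linarith
  have hb : a + h • ζ ∈ Metric.ball z₀ δ := by
    rw [mem_ball_iff_norm, add_sub_right_comm]
    refine (norm_add_le _ _).trans_lt ?_
    rw [norm_smul, Real.norm_of_nonneg hh0.le]
    rw [lt_div_iff₀ (by positivity)] at hh1
    nlinarith [mul_le_mul_of_nonneg_left hζn hh0.le]
  rw [hball _ hb]
  have h1 := (hball _ hab).1 haD
  have h2 : γ (a + h • ζ) = γ (a + h • ξ) := by
    have : a + h • ζ = (a + h • ξ) + (h * c) • e := by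
      rw [hζe]; module
    rw [this, hinv]
  have h3 : γ (a + h • ξ) ≤ γ a + L * h := by
    have := hL.dist_le_mul (a + h • ξ) a
    rw [Real.dist_eq, dist_eq_norm, add_sub_cancel_left, norm_smul, Real.norm_of_nonneg hh0.le] at this
    have h4 := le_abs_self (γ (a + h • ξ) - γ a)
    have h5 : (L : ℝ) * (h * ‖ξ‖) ≤ L * h := by
      refine mul_le_mul_of_nonneg_left ?_ L.2
      nlinarith
    linarith
  have h4 : inner ℝ e (a + h • ζ) = inner ℝ e a + h * c + h * inner ℝ e ξ := by
    rw [hζe, inner_add_right, inner_smul_right, inner_add_right, inner_smul_right,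
      real_inner_self_eq_norm_sq, he]
    ring
  have h5 : -1 ≤ inner ℝ e ξ := by
    have := abs_real_inner_le_norm e ξ
    rw [he, one_mul] at this
    have := abs_le.1 (this.trans hζ.le)
    exact this.1
  rw [h2, h4]
  have h6 : h * (-1) ≤ h * inner ℝ e ξ := mul_le_mul_of_nonneg_left h5 hh0.le
  nlinarith

/-- The cone condition is preserved by changes of coordinates that are strictly differentiable at
the point, within a closed convex set. -/
lemma HasConeAt.of_map {S D D' : Set E} (hS : IsClosed S)
    (hD' : IsOpen D') (hD'S : D' ⊆ S) {y₀ ζ₀ : E} {σ : E → E} {T : E →L[ℝ] E}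
    (hσ : ∀ ε > 0, ∃ t ∈ 𝓝[S] y₀, ∀ x ∈ t, ∀ y ∈ t, ‖σ x - σ y - T (x - y)‖ ≤ ε * ‖x - y‖)
    (hσc : ContinuousWithinAt σ S y₀)
    (hmem : ∀ᶠ y in 𝓝[S] y₀, y ∈ D' ↔ σ y ∈ D)
    (hD : HasConeAt D (σ y₀) (T ζ₀)) : HasConeAt D' y₀ ζ₀ := by
  obtain ⟨r, η, ρ, hr, hη, hρ, hcone⟩ := hD
  obtain ⟨ρ', hρ', hρ'2⟩ : ∃ ρ' > 0, ‖T‖ * ρ' ≤ ρ / 4 := by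
    refine ⟨ρ / (4 * (‖T‖ + 1)), by positivity, ?_⟩
    rw [mul_div_assoc', div_le_div_iff₀ (by positivity) (by norm_num)]
    nlinarith [norm_nonneg T]
  set M := ‖ζ₀‖ + ρ' with hM
  have hM0 : 0 < M := by positivity
  -- For directions of norm at most `M` the linearisation error is then at most `ρ / 4` per unit
  -- step. With the variation `‖T‖ * ρ' ≤ ρ / 4` of `T ζ`, the image direction stays within `ρ / 2`
  -- of `T ζ₀`.
  obtain ⟨t, ht, hest⟩ := hσ (ρ / (4 * M)) (by positivity)
  have hev : ∀ᶠ y in 𝓝[S] y₀, y ∈ t ∧ (y ∈ D' ↔ σ y ∈ D) ∧ σ y ∈ Metric.ball (σ y₀) r :=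
    (eventually_mem_set.2 ht).and (hmem.and (hσc.eventually (Metric.ball_mem_nhds _ hr)))
  rw [eventually_nhdsWithin_iff, Metric.eventually_nhds_iff_ball] at hev
  obtain ⟨δ, hδ, hball⟩ := hev
  refine ⟨δ / 2, min η (δ / (2 * M)), ρ', by positivity, by positivity, hρ', ?_⟩
  rintro a ⟨haD, ha⟩ h₀ ⟨hh0, hh1⟩ ζ hζ
  have hζn : ‖ζ‖ ≤ M := by
    rw [mem_ball_iff_norm] at hζ
    linarith [norm_sub_norm_le ζ ζ₀]
  have haS := hD'S haD
  obtain ⟨hat, -, har⟩ := hball a (Metric.ball_subset_ball (by linarith) ha) haS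
  have hamem : σ a ∈ D := (hball a (Metric.ball_subset_ball (by linarith) ha) haS).2.1.1 haD
  have hin : ∀ h ∈ Icc 0 h₀, a + h • ζ ∈ S → a + h • ζ ∈ D' := by
    intro h hh hmS
    rcases hh.1.eq_or_lt with h0 | h0
    · rw [← h0, zero_smul, add_zero]; exact haD
    have hq : a + h • ζ ∈ Metric.ball y₀ δ := by
      rw [mem_ball_iff_norm] at ha ⊢
      rw [add_sub_right_comm]
      refine (norm_add_le _ _).trans_lt ?_
      rw [norm_smul, Real.norm_of_nonneg h0.le]
      have h1 := hh1.trans_le (min_le_right _ _)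
      rw [lt_div_iff₀ (by positivity)] at h1
      nlinarith [mul_le_mul_of_nonneg_left hζn h0.le, mul_le_mul_of_nonneg_right hh.2 hM0.le]
    obtain ⟨hqt, hqD, -⟩ := hball _ hq hmS
    rw [hqD]
    have h1 := hest _ hqt _ hat
    rw [add_sub_cancel_left, map_smul, norm_smul, Real.norm_of_nonneg h0.le] at h1
    set ζ' := h⁻¹ • (σ (a + h • ζ) - σ a) with hζ'
    have h2 : σ (a + h • ζ) = σ a + h • ζ' := by
      rw [hζ', smul_smul, mul_inv_cancel₀ h0.ne', one_smul]; abel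
    rw [h2]
    refine hcone _ ⟨hamem, har⟩ h ⟨h0, (hh.2.trans_lt hh1).trans_le (min_le_left _ _)⟩ _ ?_
    have h3 : ‖ζ' - T ζ‖ ≤ ρ / 4 := by
      have h4 : h • (ζ' - T ζ) = σ (a + h • ζ) - σ a - h • T ζ := by
        rw [h2, smul_sub]; abel
      rw [← h4, norm_smul, Real.norm_of_nonneg h0.le] at h1
      have h5 : ρ / (4 * M) * (h * ‖ζ‖) ≤ ρ / (4 * M) * (h * M) := by gcongr
      have h6 : ρ / (4 * M) * (h * M) = h * (ρ / 4) := by field_simp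
      exact le_of_mul_le_mul_left (h1.trans (h5.trans h6.le)) h0
    have h7 : ‖T ζ - T ζ₀‖ ≤ ρ / 4 := by
      rw [← map_sub]
      refine (T.le_opNorm _).trans (le_trans ?_ hρ'2)
      rw [mem_ball_iff_norm] at hζ
      gcongr
    rw [mem_ball_iff_norm]
    have h8 : ζ' - T ζ₀ = (ζ' - T ζ) + (T ζ - T ζ₀) := by abel
    rw [h8]
    refine (norm_add_le _ _).trans_lt ?_
    linarith
  -- The map `σ` is controlled only on `S`, and the translated point might leave `S`. This is
  -- excluded by connectedness: the segment starts in the open set `D'`, and a point of it in the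
  -- closure of `D'` lies in the closed set `S`, hence in `D'` by `hin`.
  have hseg : (fun h : ℝ => a + h • ζ) '' Icc 0 h₀ ⊆ D' := by
    refine IsPreconnected.subset_of_closure_inter_subset ?_ hD' ?_ ?_
    · exact isPreconnected_Icc.image _ (by fun_prop)
    · exact ⟨a, ⟨0, ⟨le_rfl, hh0.le⟩, by simp⟩, haD⟩
    · rintro _ ⟨hcl, h, hh, rfl⟩
      exact hin h hh (closure_minimal hD'S hS hcl)
  exact hseg ⟨h₀, ⟨hh0.le, le_rfl⟩, rfl⟩

-- The cone condition passes to the limit: a point of `closure D \ D` enters `D` under every small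
-- translation along the axis. So no two such points differ by a small positive multiple of the
-- axis, and infinitely many bounded translates of this set are disjoint, which forces it to be
-- null.
open scoped Pointwise in
lemma HasConeAt.exists_ball_frontier_null [FiniteDimensional ℝ E] [MeasurableSpace E]
    [BorelSpace E] (μ : Measure E) [μ.IsAddHaarMeasure] {D : Set E} (hD : IsOpen D) {z₀ ζ₀ : E}
    (h : HasConeAt D z₀ ζ₀) : ∃ r > 0, μ ((closure D \ D) ∩ Metric.ball z₀ r) = 0 := by
  obtain ⟨r, η, ρ, hr, hη, hρ, hcone⟩ := h
  refine ⟨r, hr, ?_⟩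
  set F := (closure D \ D) ∩ Metric.ball z₀ r with hF
  have hstep : ∀ a ∈ F, ∀ h ∈ Ioo 0 η, a + h • ζ₀ ∈ D := by
    rintro a ⟨⟨ha, -⟩, har⟩ h hh
    have hn : Metric.ball a (h * ρ) ∩ Metric.ball z₀ r ∈ 𝓝 a :=
      inter_mem (Metric.ball_mem_nhds _ (mul_pos hh.1 hρ)) (Metric.isOpen_ball.mem_nhds har)
    obtain ⟨b, ⟨hb1, hb2⟩, hbD⟩ := mem_closure_iff_nhds.1 ha _ hn
    have h1 := hcone b ⟨hbD, hb2⟩ h hh (ζ₀ + h⁻¹ • (a - b)) (by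
      rw [mem_ball_iff_norm, add_sub_cancel_left, norm_smul, norm_inv,
        Real.norm_of_nonneg hh.1.le, inv_mul_lt_iff₀ hh.1]
      rw [mem_ball_iff_norm'] at hb1
      exact hb1)
    rwa [smul_add, smul_smul, mul_inv_cancel₀ hh.1.ne', one_smul,
      show b + (h • ζ₀ + (a - b)) = a + h • ζ₀ by abel] at h1
  have hFm : MeasurableSet F :=
    (isClosed_closure.measurableSet.diff hD.measurableSet).inter Metric.isOpen_ball.measurableSet
  set u : ℕ → E := fun k => (η / (k + 2)) • ζ₀ with hu
  refine Measure.addHaar_eq_zero_of_disjoint_translates μ u ?_ ?_ hFm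
  · rw [isBounded_iff_forall_norm_le]
    refine ⟨η * ‖ζ₀‖, ?_⟩
    rintro _ ⟨k, rfl⟩
    rw [hu, norm_smul, Real.norm_of_nonneg (by positivity)]
    refine mul_le_mul_of_nonneg_right ?_ (norm_nonneg _)
    exact div_le_self hη.le (by linarith [(k.cast_nonneg : (0 : ℝ) ≤ k)])
  · have hlt : ∀ k l : ℕ, k < l → Disjoint (({u k} : Set E) + F) (({u l} : Set E) + F) := by
      intro k l hkl
      rw [Set.disjoint_left]
      rintro x ⟨_, rfl, a, ha, rfl⟩ ⟨_, rfl, b, hb, hab⟩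
      refine hb.1.2 ?_
      have hkl' : (k : ℝ) < l := by exact_mod_cast hkl
      have hk0 : (0 : ℝ) ≤ k := k.cast_nonneg
      have h1 : b = a + (η / (k + 2) - η / (l + 2)) • ζ₀ := by
        have : b = u k + a - u l := by
          rw [eq_sub_iff_add_eq, add_comm]; exact hab
        rw [this, hu]; module
      rw [h1]
      refine hstep a ha _ ⟨?_, ?_⟩
      · exact sub_pos.2 (div_lt_div_of_pos_left hη (by positivity) (by linarith))
      · have h2 : η / (k + 2) ≤ η := div_le_self hη.le (by linarith)
        have h3 : 0 < η / (l + 2) := by positivity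
        linarith
    intro k l hkl
    rcases lt_or_gt_of_ne hkl with h | h
    · exact hlt k l h
    · exact (hlt l k h).symm

/-- The derivative of `σ - T` within the convex set is continuous and vanishes at the point, so the
mean value inequality makes `σ - T` Lipschitz with constant `ε` nearby. This is strict
differentiability up to the boundary of a half-space. -/
lemma exists_strict_estimate_of_contDiffWithinAt {S : Set E} (hSconv : Convex ℝ S)
    (hSu : UniqueDiffOn ℝ S) {σ : E → E} {y₀ : E} (hy₀ : y₀ ∈ S)
    (hσ : ContDiffWithinAt ℝ ∞ σ S y₀) {ε : ℝ} (hε : 0 < ε) :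
    ∃ t ∈ 𝓝[S] y₀, ∀ x ∈ t, ∀ y ∈ t,
      ‖σ x - σ y - fderivWithin ℝ σ S y₀ (x - y)‖ ≤ ε * ‖x - y‖ := by
  set T := fderivWithin ℝ σ S y₀ with hT
  have h1 : ContDiffWithinAt ℝ 1 σ S y₀ := hσ.of_le (by exact_mod_cast le_top)
  have hd : ∀ᶠ y in 𝓝[S] y₀, HasFDerivWithinAt (fun y => σ y - T y)
      (fderivWithin ℝ σ S y - T) S y := by
    have := h1.eventually (by simp)
    rw [insert_eq_of_mem hy₀] at this
    filter_upwards [this] with y hy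
    exact ((hy.differentiableWithinAt one_ne_zero).hasFDerivWithinAt).sub T.hasFDerivWithinAt
  have hc : ContinuousWithinAt (fun y => fderivWithin ℝ σ S y - T) S y₀ :=
    ((hσ.fderivWithin_right (m := 0) hSu (by simp) hy₀).continuousWithinAt).sub
      continuousWithinAt_const
  obtain ⟨t, ht, hlip⟩ := hSconv.exists_nhdsWithin_lipschitzOnWith_of_hasFDerivWithinAt_of_nnnorm_lt
    hd hc ⟨ε, hε.le⟩ (by rw [sub_self, nnnorm_zero]; exact hε)
  refine ⟨t, ht, fun x hx y hy => ?_⟩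
  have := hlip.dist_le_mul x hx y hy
  rw [dist_eq_norm, dist_eq_norm] at this
  rw [map_sub]
  rwa [show σ x - T x - (σ y - T y) = σ x - σ y - (T x - T y) by abel] at this

end Cone

/-! ### The cone condition in the charts of the manifold -/

namespace NeumannDirichlet

section

variable {n : ℕ} [NeZero n] {M : Type*} [TopologicalSpace M]
  [ChartedSpace (EuclideanHalfSpace n) M] [IsManifold (𝓡∂ n) ∞ M]

lemma isOpen_interior_manifold : IsOpen ((𝓡∂ n).interior M) :=
  ModelWithCorners.isOpen_interior (n := ∞) (by simp)

lemma mem_interior_iff_of_mem_target {x : M} {y : EuclideanSpace ℝ (Fin n)}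
    (hy : y ∈ (extChartAt (𝓡∂ n) x).target) :
    (extChartAt (𝓡∂ n) x).symm y ∈ (𝓡∂ n).interior M ↔
      y ∈ interior (extChartAt (𝓡∂ n) x).target := by
  have h := ModelWithCorners.isInteriorPoint_iff_of_mem_atlas (I := 𝓡∂ n) (n := ∞) (by simp)
    (chart_mem_atlas (EuclideanHalfSpace n) x) (x := (extChartAt (𝓡∂ n) x).symm y)
    (by simpa using (extChartAt (𝓡∂ n) x).map_target hy)
  have h2 : (extChartAt (𝓡∂ n) x) ((extChartAt (𝓡∂ n) x).symm y) = y :=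
    (extChartAt (𝓡∂ n) x).right_inv hy
  rw [← extChartAt, h2] at h
  exact h

/-- Chart targets are open only in the half-space; removing the boundary of the manifold makes the
set open in the full Euclidean space. -/
lemma isOpen_chartDomain (x : M) {U : Set M} (hU : IsOpen U) : IsOpen (chartDomain n x U) := by
  rw [isOpen_iff_mem_nhds]
  rintro y ⟨hy, hyU⟩
  refine inter_mem (mem_interior_iff_mem_nhds.1 ((mem_interior_iff_of_mem_target hy).1 hyU.2)) ?_
  exact (continuousAt_extChartAt_symm'' hy).preimage_mem_nhds
    ((hU.inter isOpen_interior_manifold).mem_nhds hyU)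

/-- A set with Lipschitz boundary satisfies the cone condition in the coordinates at each point of
its closure. -/
lemma HasLipschitzBoundary.exists_hasConeAt {U : Set M} (hU : IsOpen U)
    (hlip : HasLipschitzBoundary n U) {p : M} (hp : p ∈ closure (U ∩ (𝓡∂ n).interior M)) :
    ∃ ζ₀, HasConeAt (chartDomain n p U) (extChartAt (𝓡∂ n) p p) ζ₀ := by
  by_cases hpU : p ∈ U ∩ (𝓡∂ n).interior M
  · refine ⟨0, (isOpen_chartDomain p hU).hasConeAt_zero ⟨mem_extChartAt_target p, ?_⟩⟩
    rwa [mem_preimage, extChartAt_to_inv]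
  have hpf : p ∈ frontier (U ∩ (𝓡∂ n).interior M) := by
    rw [(hU.inter isOpen_interior_manifold).frontier_eq]; exact ⟨hp, hpU⟩
  obtain ⟨φ, hφ, hpφ, hepi⟩ := hlip p hpf
  obtain ⟨e', hcone⟩ := hasConeAt_of_isLipschitzEpigraphNear hepi
  set I := 𝓡∂ n with hI
  set ψ := chartAt (EuclideanHalfSpace n) p with hψ
  have hψm : ψ ∈ IsManifold.maximalAtlas I ∞ M := IsManifold.chart_mem_maximalAtlas p
  have hpψ : p ∈ ψ.source := mem_chart_source _ p
  set S := range I with hSdef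
  set y₀ := ψ.extend I p with hy₀
  set z₀ := φ.extend I p with hz₀
  -- The Lipschitz graph is given in some chart `φ` of the maximal atlas, but Sobolev functions are
  -- described in the preferred chart `ψ` at `p`. The cone is carried over by the transition map,
  -- which is smooth only within the half-space `S`.
  set σ := φ.extend I ∘ (ψ.extend I).symm with hσ
  set τ := ψ.extend I ∘ (φ.extend I).symm with hτ
  have hSu : UniqueDiffOn ℝ S := I.uniqueDiffOn
  have hy₀S : y₀ ∈ S := mem_range_self _
  have hz₀S : z₀ ∈ S := mem_range_self _
  have hsymm : (ψ.extend I).symm y₀ = p := ψ.extend_left_inv hpψ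
  have hsymm' : (φ.extend I).symm z₀ = p := φ.extend_left_inv hpφ
  have hσy : σ y₀ = z₀ := by rw [hσ, Function.comp_apply, hsymm]
  have hτz : τ z₀ = y₀ := by rw [hτ, Function.comp_apply, hsymm']
  have hσd : ContDiffWithinAt ℝ ∞ σ S y₀ := by
    refine ModelWithCorners.contDiffWithinAt_extendCoordChange hψm hφ ?_
    exact ⟨(ψ.extend I).map_source (by rwa [ψ.extend_source]), by
      show (ψ.extend I).symm y₀ ∈ (φ.extend I).source
      rw [hsymm, φ.extend_source]; exact hpφ⟩
  have hτd : ContDiffWithinAt ℝ ∞ τ S z₀ := by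
    refine ModelWithCorners.contDiffWithinAt_extendCoordChange hφ hψm ?_
    exact ⟨(φ.extend I).map_source (by rwa [φ.extend_source]), by
      show (φ.extend I).symm z₀ ∈ (ψ.extend I).source
      rw [hsymm', ψ.extend_source]; exact hpψ⟩
  set T := fderivWithin ℝ σ S y₀ with hT
  set T' := fderivWithin ℝ τ S z₀ with hT'
  -- The derivatives of the two transition maps compose to the identity, since derivatives within
  -- `S` are unique. Thus `T' e'` is an axis that `T` sends to the axis `e'` found in the chart `φ`.
  have hTT : ∀ v, T (T' v) = v := by
    have h1 : HasFDerivWithinAt (σ ∘ τ) (T ∘L T') S z₀ := by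
      have h2 : HasFDerivWithinAt σ T S (τ z₀) := by
        rw [hτz]; exact (hσd.differentiableWithinAt (by simp)).hasFDerivWithinAt
      exact h2.comp z₀ (hτd.differentiableWithinAt (by simp)).hasFDerivWithinAt
        (fun _ _ => mem_range_self _)
    have h3 : HasFDerivWithinAt (σ ∘ τ) (ContinuousLinearMap.id ℝ _) S z₀ := by
      refine (hasFDerivWithinAt_id z₀ S).congr_of_eventuallyEq ?_ ?_
      · have h4 : ∀ᶠ z in 𝓝[S] z₀, z ∈ (φ.extend I).target :=
          φ.extend_target_mem_nhdsWithin hpφ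
        have h5 : ∀ᶠ z in 𝓝[S] z₀, (φ.extend I).symm z ∈ ψ.source := by
          refine ((φ.continuousAt_extend_symm hpφ).eventually_mem ?_).filter_mono nhdsWithin_le_nhds
          rw [← hz₀, hsymm']
          exact ψ.open_source.mem_nhds hpψ
        filter_upwards [h4, h5] with z hz hz'
        simp only [hσ, hτ, Function.comp_apply, id_eq]
        rw [ψ.extend_left_inv hz', (φ.extend I).right_inv hz]
      · simp only [Function.comp_apply, hτz, hσy, id_eq]
    have h6 := (hSu z₀ hz₀S).eq h1 h3
    intro v
    exact congrArg (fun A : EuclideanSpace ℝ (Fin n) →L[ℝ] EuclideanSpace ℝ (Fin n) => A v) h6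
  refine ⟨T' e', HasConeAt.of_map (S := S) (σ := σ) (T := T) I.isClosed_range
    (isOpen_chartDomain p hU) ?_ ?_ hσd.continuousWithinAt ?_ ?_
    (D := φ.extend I '' (U ∩ I.interior M ∩ φ.source))⟩
  · exact fun y hy => ψ.extend_target_subset_range hy.1
  · exact fun ε hε => exists_strict_estimate_of_contDiffWithinAt I.convex_range hSu hy₀S hσd hε
  · have h4 : ∀ᶠ y in 𝓝[S] y₀, y ∈ (ψ.extend I).target :=
      ψ.extend_target_mem_nhdsWithin hpψ
    have h5 : ∀ᶠ y in 𝓝[S] y₀, (ψ.extend I).symm y ∈ φ.source := by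
      refine ((ψ.continuousAt_extend_symm hpψ).eventually_mem ?_).filter_mono nhdsWithin_le_nhds
      rw [← hy₀, hsymm]
      exact φ.open_source.mem_nhds hpφ
    filter_upwards [h4, h5] with y hy hy'
    constructor
    · intro h
      exact ⟨_, ⟨h.2, hy'⟩, rfl⟩
    · rintro ⟨q, ⟨hq, hqφ⟩, hqe⟩
      have h6 : q = (ψ.extend I).symm y :=
        (φ.extend I).injOn (by rwa [φ.extend_source]) (by rwa [φ.extend_source]) hqe
      refine ⟨hy, ?_⟩
      show (ψ.extend I).symm y ∈ U ∩ I.interior M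
      rw [← h6]; exact hq
  · have e1 : σ (extChartAt I p p) = z₀ := hσy
    rw [e1, hTT]; exact hcone

end

end NeumannDirichlet

/-! ### The Riemannian volume in coordinates -/

namespace NeumannDirichlet

section

variable {n : ℕ} [NeZero n] {M : Type*} [TopologicalSpace M]
  [ChartedSpace (EuclideanHalfSpace n) M] [IsManifold (𝓡∂ n) ∞ M]

lemma coordVector_eq_sum (x y : M) (v : EuclideanSpace ℝ (Fin n)) :
    coordVector x y v = ∑ i, v i • coordVector x y (EuclideanSpace.single i (1 : ℝ)) := by
  have h : v = ∑ i, v i • EuclideanSpace.single i (1 : ℝ) := by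
    ext j
    simp [Pi.single_apply]
  conv_lhs => rw [h]
  unfold coordVector
  rw [map_sum]
  simp only [map_smul]

lemma coordVector_eq_zero_iff {x y : M} (hy : y ∈ (chartAt (EuclideanHalfSpace n) x).source)
    {v : EuclideanSpace ℝ (Fin n)} : coordVector x y v = 0 ↔ v = 0 := by
  constructor
  · intro h
    have hb : y ∈ (trivializationAt (EuclideanSpace ℝ (Fin n))
        (TangentSpace (𝓡∂ n) : M → Type _) x).baseSet := by
      rw [TangentBundle.trivializationAt_baseSet]; exact hy
    rw [← Trivialization.continuousLinearMapAt_symmL (R := ℝ) _ hb v]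
    show (trivializationAt (EuclideanSpace ℝ (Fin n))
        (TangentSpace (𝓡∂ n) : M → Type _) x).continuousLinearMapAt ℝ y (coordVector x y v) = 0
    rw [h, map_zero]
  · rintro rfl
    exact map_zero _

lemma exists_coordVector_eq {x y : M} (hy : y ∈ (chartAt (EuclideanHalfSpace n) x).source)
    (X : TangentSpace (𝓡∂ n) y) : ∃ v, coordVector x y v = X := by
  have hb : y ∈ (trivializationAt (EuclideanSpace ℝ (Fin n))
      (TangentSpace (𝓡∂ n) : M → Type _) x).baseSet := by
    rw [TangentBundle.trivializationAt_baseSet]; exact hy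
  exact ⟨_, Trivialization.symmL_continuousLinearMapAt (R := ℝ) _ hb X⟩

lemma coordVector_eq_tangentCoordChange {x y : M}
    (hy : y ∈ (chartAt (EuclideanHalfSpace n) x).source) (v : EuclideanSpace ℝ (Fin n)) :
    coordVector x y v = tangentCoordChange (𝓡∂ n) x y y v := by
  rw [coordVector, TangentBundle.symmL_trivializationAt_eq_core hy]
  rfl

lemma coordVector_change {x x' y : M} (hy : y ∈ (chartAt (EuclideanHalfSpace n) x).source)
    (hy' : y ∈ (chartAt (EuclideanHalfSpace n) x').source) (v : EuclideanSpace ℝ (Fin n)) :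
    coordVector x' y v = coordVector x y (tangentCoordChange (𝓡∂ n) x' x y v) := by
  rw [coordVector_eq_tangentCoordChange hy, coordVector_eq_tangentCoordChange hy']
  exact (tangentCoordChange_comp (I := 𝓡∂ n) (E := EuclideanSpace ℝ (Fin n)) (M := M) (w := x')
    (x := x) (y := y) (z := y) (v := v) (by simp [hy, hy'])).symm

variable (g : Metric n M)

lemma inner_coordVector_eq (x y : M) (v w : EuclideanSpace ℝ (Fin n)) :
    g.inner y (coordVector x y v) (coordVector x y w) =
      ∑ i, ∑ j, v i * w j * gram g x y i j := by
  rw [coordVector_eq_sum x y v, coordVector_eq_sum x y w]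
  simp only [map_sum, map_smul, sum_apply, smul_apply,
    smul_eq_mul, gram, Matrix.of_apply, Finset.mul_sum, mul_assoc]
  rw [Finset.sum_comm]
  refine Finset.sum_congr rfl fun i _ => Finset.sum_congr rfl fun j _ => by ring

lemma gram_posDef {x y : M} (hy : y ∈ (chartAt (EuclideanHalfSpace n) x).source) :
    (gram g x y).PosDef := by
  refine Matrix.PosDef.of_dotProduct_mulVec_pos ?_ fun v hv => ?_
  · ext i j
    simp only [gram, Matrix.conjTranspose_apply, Matrix.of_apply, star_trivial]
    exact g.symm _ _ _
  · have h := inner_coordVector_eq g x y (WithLp.toLp 2 v) (WithLp.toLp 2 v)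
    have h2 : 0 < g.inner y (coordVector x y (WithLp.toLp 2 v))
        (coordVector x y (WithLp.toLp 2 v)) := by
      refine g.pos _ _ fun h0 => hv ?_
      rw [coordVector_eq_zero_iff hy] at h0
      simpa using congrArg WithLp.ofLp h0
    rw [h] at h2
    simp only [dotProduct, Matrix.mulVec, star_trivial, Finset.mul_sum]
    refine h2.trans_le (le_of_eq ?_)
    exact Finset.sum_congr rfl fun i _ => Finset.sum_congr rfl fun j _ => by
      simp only []; ring

/-- The Gram matrices are congruent through the Jacobian `J` of the transition map, so their
determinants differ by the factor `(det J) ^ 2`. Its square root is the factor in the change of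
variables formula. -/
lemma gram_change {x x' y : M} (hy : y ∈ (chartAt (EuclideanHalfSpace n) x).source)
    (hy' : y ∈ (chartAt (EuclideanHalfSpace n) x').source) :
    √(gram g x' y).det =
      |(tangentCoordChange (𝓡∂ n) x' x y).det| * √(gram g x y).det := by
  set b := (EuclideanSpace.basisFun (Fin n) ℝ).toBasis with hb
  set J := LinearMap.toMatrix b b (tangentCoordChange (𝓡∂ n) x' x y).toLinearMap with hJ
  have hJe : ∀ i j, J i j = tangentCoordChange (𝓡∂ n) x' x y (EuclideanSpace.single j 1) i := by
    intro i j
    simp [hJ, hb, LinearMap.toMatrix_apply]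
  have h1 : gram g x' y = J.transpose * gram g x y * J := by
    ext i j
    have h2 : gram g x' y i j = g.inner y (coordVector x' y (EuclideanSpace.single i 1))
        (coordVector x' y (EuclideanSpace.single j 1)) := rfl
    rw [h2, coordVector_change hy hy', coordVector_change hy hy', inner_coordVector_eq]
    simp only [Matrix.mul_apply, Matrix.transpose_apply, hJe, Finset.sum_mul]
    rw [Finset.sum_comm]
    refine Finset.sum_congr rfl fun k _ => Finset.sum_congr rfl fun l _ => by ring
  have h3 : J.det = (tangentCoordChange (𝓡∂ n) x' x y).det := by
    rw [hJ, LinearMap.det_toMatrix]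
  rw [h1, Matrix.det_mul, Matrix.det_mul, Matrix.det_transpose, h3,
    show ∀ a c : ℝ, a * c * a = a ^ 2 * c by intros; ring, Real.sqrt_mul (sq_nonneg _),
    Real.sqrt_sq_eq_abs]

lemma continuousOn_inner_coordVector (x : M) (v w : EuclideanSpace ℝ (Fin n)) :
    ContinuousOn (fun y => g.inner y (coordVector x y v) (coordVector x y w))
      (chartAt (EuclideanHalfSpace n) x).source := by
  let _ : RiemannianBundle (fun y : M => TangentSpace (𝓡∂ n) y) := ⟨g.toRiemannianMetric⟩
  have : IsContinuousRiemannianBundle (EuclideanSpace ℝ (Fin n))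
      (fun y : M => TangentSpace (𝓡∂ n) y) :=
    ⟨⟨g.inner, g.contMDiff.continuous, fun b v w => rfl⟩⟩
  have hsec : ∀ u : EuclideanSpace ℝ (Fin n), ContinuousOn
      (fun y : M => (⟨y, coordVector x y u⟩ :
        TotalSpace (EuclideanSpace ℝ (Fin n)) (fun y : M => TangentSpace (𝓡∂ n) y)))
      (chartAt (EuclideanHalfSpace n) x).source := by
    intro u
    have h1 := (trivializationAt (EuclideanSpace ℝ (Fin n))
      (TangentSpace (𝓡∂ n) : M → Type _) x).continuousOn_symm
    have h2 : ContinuousOn (fun y : M => (y, u)) (chartAt (EuclideanHalfSpace n) x).source :=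
      by fun_prop
    refine (h1.comp h2 (fun y hy => ⟨?_, mem_univ _⟩)).congr fun y hy => ?_
    · rw [TangentBundle.trivializationAt_baseSet]; exact hy
    · have hb : y ∈ (trivializationAt (EuclideanSpace ℝ (Fin n))
          (TangentSpace (𝓡∂ n) : M → Type _) x).baseSet := by
        rw [TangentBundle.trivializationAt_baseSet]; exact hy
      exact congrArg (TotalSpace.mk y) (Trivialization.symmL_apply (R := ℝ) _ hb u)
  have h3 := (hsec v).inner_bundle (hsec w)
  exact h3

lemma continuousOn_gram (x : M) : ContinuousOn (fun y => gram g x y)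
    (chartAt (EuclideanHalfSpace n) x).source := by
  refine continuousOn_pi.2 fun i => continuousOn_pi.2 fun j => ?_
  exact continuousOn_inner_coordVector g x _ _

/-- The density `√(det g_{ij})` of the volume in the coordinates of the chart at `x`. -/
noncomputable def density (x : M) (z : EuclideanSpace ℝ (Fin n)) : ℝ :=
  √(gram g x ((extChartAt (𝓡∂ n) x).symm z)).det

lemma mapsTo_symm_source (x : M) : MapsTo (extChartAt (𝓡∂ n) x).symm (extChartAt (𝓡∂ n) x).target
    (chartAt (EuclideanHalfSpace n) x).source := fun z hz => by
  simpa using (extChartAt (𝓡∂ n) x).map_target hz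

lemma continuousOn_density (x : M) :
    ContinuousOn (density g x) (extChartAt (𝓡∂ n) x).target := by
  have h1 : ContinuousOn (fun z => gram g x ((extChartAt (𝓡∂ n) x).symm z))
      (extChartAt (𝓡∂ n) x).target :=
    (continuousOn_gram g x).comp (continuousOn_extChartAt_symm x) (mapsTo_symm_source x)
  have h2 : Continuous fun A : Matrix (Fin n) (Fin n) ℝ => √A.det :=
    Real.continuous_sqrt.comp (Continuous.matrix_det continuous_id)
  exact h2.comp_continuousOn h1

lemma density_pos {x : M} {z : EuclideanSpace ℝ (Fin n)}
    (hz : z ∈ (extChartAt (𝓡∂ n) x).target) : 0 < density g x z :=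
  Real.sqrt_pos.2 (gram_posDef g (mapsTo_symm_source x hz)).det_pos

lemma measurableSet_target (x : M) : MeasurableSet (extChartAt (𝓡∂ n) x).target := by
  rw [extChartAt, OpenPartialHomeomorph.extend_target]
  exact ((chartAt _ x).open_target.preimage (𝓡∂ n).continuous_symm).measurableSet.inter
    (𝓡∂ n).isClosed_range.measurableSet

variable [MeasurableSpace M] [BorelSpace M]

lemma measurableSet_target_inter_preimage (x : M) {A : Set M} (hA : MeasurableSet A) :
    MeasurableSet ((extChartAt (𝓡∂ n) x).target ∩ (extChartAt (𝓡∂ n) x).symm ⁻¹' A) := by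
  have h1 : Measurable ((extChartAt (𝓡∂ n) x).target.domRestrict (extChartAt (𝓡∂ n) x).symm) :=
    (continuousOn_iff_continuous_domRestrict.1 (continuousOn_extChartAt_symm x)).measurable
  have h2 := (MeasurableEmbedding.subtype_coe (measurableSet_target x)).measurableSet_image.2
    (h1 hA)
  convert h2 using 1
  ext z
  exact ⟨fun h => ⟨⟨z, h.1⟩, h.2, rfl⟩, by rintro ⟨w, hw, rfl⟩; exact ⟨w.2, hw⟩⟩

lemma aemeasurable_symm (x : M) : AEMeasurable (extChartAt (𝓡∂ n) x).symm
    (volume.restrict (extChartAt (𝓡∂ n) x).target) :=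
  (continuousOn_extChartAt_symm x).aemeasurable (measurableSet_target x)

lemma aemeasurable_density (x : M) : AEMeasurable (fun z => ENNReal.ofReal (density g x z))
    (volume.restrict (extChartAt (𝓡∂ n) x).target) :=
  ((continuousOn_density g x).aemeasurable (measurableSet_target x)).ennreal_ofReal

lemma chartVolume_eq (x : M) : chartVolume g x =
    ((volume.restrict (extChartAt (𝓡∂ n) x).target).withDensity
      fun z => ENNReal.ofReal (density g x z)).map (extChartAt (𝓡∂ n) x).symm := rfl

lemma chartVolume_apply (x : M) {A : Set M} (hA : MeasurableSet A) :
    chartVolume g x A = ∫⁻ z in (extChartAt (𝓡∂ n) x).target ∩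
      (extChartAt (𝓡∂ n) x).symm ⁻¹' A, ENNReal.ofReal (density g x z) := by
  rw [chartVolume_eq, Measure.map_apply_of_aemeasurable
    ((aemeasurable_symm x).mono_ac (withDensity_absolutelyContinuous _ _)) hA,
    withDensity_apply', Measure.restrict_restrict' (measurableSet_target x), inter_comm]

/-- Change of variables gives equality on the part of `A` that lies in both charts. The chart at
`x'` may miss part of `A`, so only an inequality survives. -/
lemma chartVolume_le_of_subset (x x' : M) {A : Set M} (hA : MeasurableSet A)
    (hAx : A ⊆ (chartAt (EuclideanHalfSpace n) x).source) :
    chartVolume g x' A ≤ chartVolume g x A := by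
  rw [chartVolume_apply g x' hA, chartVolume_apply g x hA]
  set e := extChartAt (𝓡∂ n) x with he
  set e' := extChartAt (𝓡∂ n) x' with he'
  set S := e'.target ∩ e'.symm ⁻¹' A with hS
  have hsrc : ∀ z ∈ S, e'.symm z ∈ e'.source ∩ e.source := fun z hz =>
    ⟨e'.map_target hz.1, by rw [he, extChartAt_source]; exact hAx hz.2⟩
  have hder : ∀ z ∈ S, HasFDerivWithinAt (e ∘ e'.symm)
      (tangentCoordChange (𝓡∂ n) x' x (e'.symm z)) S z := by
    intro z hz
    have h1 := hasFDerivWithinAt_tangentCoordChange (I := 𝓡∂ n) (hsrc z hz)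
    rw [← he', e'.right_inv hz.1] at h1
    exact h1.mono fun w hw => extChartAt_target_subset_range x' hw.1
  have hinj : InjOn (e ∘ e'.symm) S := by
    intro z hz w hw h
    have h1 := e.injOn (hsrc z hz).2 (hsrc w hw).2 h
    exact e'.symm.injOn (by simpa using hz.1) (by simpa using hw.1) h1
  have hSm : MeasurableSet S := measurableSet_target_inter_preimage x' hA
  have hcov := lintegral_image_eq_lintegral_abs_det_fderiv_mul volume hSm hder hinj
    (fun z => ENNReal.ofReal (density g x z))
  have himg : (e ∘ e'.symm) '' S ⊆ e.target ∩ e.symm ⁻¹' A := by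
    rintro _ ⟨z, hz, rfl⟩
    refine ⟨e.map_source (hsrc z hz).2, ?_⟩
    show e.symm (e (e'.symm z)) ∈ A
    rw [e.left_inv (hsrc z hz).2]; exact hz.2
  refine le_trans (le_of_eq ?_) (lintegral_mono_set himg)
  rw [hcov]
  refine setLIntegral_congr_fun hSm fun z hz => ?_
  simp only [Function.comp_apply]
  rw [← ENNReal.ofReal_mul (abs_nonneg _)]
  congr 1
  simp only [density, ← he, ← he']
  rw [e.left_inv (hsrc z hz).2]
  have h1 := hsrc z hz
  rw [he, he', extChartAt_source, extChartAt_source] at h1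
  exact gram_change g h1.2 h1.1

/-- On the domain of a chart, the Riemannian volume is the measure of that chart. -/
lemma vol_apply_of_subset (x : M) {A : Set M} (hA : MeasurableSet A)
    (hAx : A ⊆ (chartAt (EuclideanHalfSpace n) x).source) :
    vol g A = chartVolume g x A := by
  set s := (chartAt (EuclideanHalfSpace n) x).source with hs
  have hsm : MeasurableSet s := (chartAt _ x).open_source.measurableSet
  refine le_antisymm ?_ (le_iSup (chartVolume g) x A)
  -- The supremum is taken in the lattice of measures, so it is bounded by exhibiting one measure
  -- above all the chart measures: the measure of the chart at `x`, plus `vol g` itself outside the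
  -- domain of this chart.
  have h1 : vol g ≤ chartVolume g x + (vol g).restrict sᶜ := by
    refine iSup_le fun x' => Measure.le_iff.2 fun B hB => ?_
    rw [Measure.add_apply, Measure.restrict_apply hB, ← measure_inter_add_sdiff B hsm]
    refine add_le_add ?_ ?_
    · exact (chartVolume_le_of_subset g x x' (hB.inter hsm) inter_subset_right).trans
        (measure_mono inter_subset_left)
    · rw [sdiff_eq]
      exact le_iSup (chartVolume g) x' _
  refine (h1 A).trans (le_of_eq ?_)
  rw [Measure.add_apply, Measure.restrict_apply hA, ← sdiff_eq, sdiff_eq_empty.2 hAx, measure_empty,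
    add_zero]

lemma vol_apply (x : M) {A : Set M} (hA : MeasurableSet A)
    (hAx : A ⊆ (chartAt (EuclideanHalfSpace n) x).source) :
    vol g A = ∫⁻ z in (extChartAt (𝓡∂ n) x).target ∩
      (extChartAt (𝓡∂ n) x).symm ⁻¹' A, ENNReal.ofReal (density g x z) := by
  rw [vol_apply_of_subset g x hA hAx, chartVolume_apply g x hA]

/-- A set is null for the Riemannian volume if and only if it is null in coordinates. -/
lemma vol_eq_zero_iff (x : M) {A : Set M} (hA : MeasurableSet A)
    (hAx : A ⊆ (chartAt (EuclideanHalfSpace n) x).source) :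
    vol g A = 0 ↔
      volume ((extChartAt (𝓡∂ n) x).target ∩ (extChartAt (𝓡∂ n) x).symm ⁻¹' A) = 0 := by
  rw [vol_apply g x hA hAx, lintegral_eq_zero_iff' (((aemeasurable_density g x).mono_measure (Measure.restrict_mono inter_subset_left le_rfl)))]
  have hm := measurableSet_target_inter_preimage (n := n) x hA
  constructor
  · intro h
    rw [← Measure.restrict_apply_self, ← nonpos_iff_eq_zero]
    have h2 : ∀ᵐ z ∂(volume.restrict ((extChartAt (𝓡∂ n) x).target ∩
        (extChartAt (𝓡∂ n) x).symm ⁻¹' A)), False := by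
      filter_upwards [h, ae_restrict_mem hm] with z hz hz'
      have := density_pos g hz'.1
      simp only [Pi.zero_apply, ENNReal.ofReal_eq_zero] at hz
      linarith
    rw [ae_iff] at h2
    simp only [not_false_eq_true, ofPred_true] at h2
    exact (measure_mono (subset_univ _)).trans h2.le
  · intro h
    rw [Measure.restrict_eq_zero.2 h]
    rfl

lemma measurableSet_image_symm (x : M) {S : Set (EuclideanSpace ℝ (Fin n))} (hS : MeasurableSet S)
    (hSt : S ⊆ (extChartAt (𝓡∂ n) x).target) :
    MeasurableSet ((extChartAt (𝓡∂ n) x).symm '' S) := by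
  have hsm : MeasurableSet (extChartAt (𝓡∂ n) x).source :=
    (isOpen_extChartAt_source x).measurableSet
  have h1 : Measurable ((extChartAt (𝓡∂ n) x).source.domRestrict (extChartAt (𝓡∂ n) x)) :=
    (continuousOn_iff_continuous_domRestrict.1 (continuousOn_extChartAt x)).measurable
  have h2 := (MeasurableEmbedding.subtype_coe hsm).measurableSet_image.2 (h1 hS)
  convert h2 using 1
  rw [(extChartAt (𝓡∂ n) x).symm_image_eq_source_inter_preimage hSt]
  ext z
  exact ⟨fun h => ⟨⟨z, h.1⟩, h.2, rfl⟩, by rintro ⟨w, hw, rfl⟩; exact ⟨w.2, hw⟩⟩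

lemma preimage_image_symm (x : M) {S : Set (EuclideanSpace ℝ (Fin n))}
    (hSt : S ⊆ (extChartAt (𝓡∂ n) x).target) (B : Set M) :
    (extChartAt (𝓡∂ n) x).target ∩ (extChartAt (𝓡∂ n) x).symm ⁻¹'
      ((extChartAt (𝓡∂ n) x).symm '' S ∩ B) = (extChartAt (𝓡∂ n) x).symm ⁻¹' B ∩ S := by
  ext z
  constructor
  · rintro ⟨hz, ⟨w, hw, hwz⟩, hzB⟩
    have : w = z := (extChartAt (𝓡∂ n) x).symm.injOn (by simpa using hSt hw) (by simpa using hz) hwz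
    exact ⟨hzB, this ▸ hw⟩
  · rintro ⟨hzB, hzS⟩
    exact ⟨hSt hzS, ⟨z, hzS, rfl⟩, hzB⟩

lemma image_symm_subset_source (x : M) {S : Set (EuclideanSpace ℝ (Fin n))}
    (hSt : S ⊆ (extChartAt (𝓡∂ n) x).target) :
    (extChartAt (𝓡∂ n) x).symm '' S ⊆ (chartAt (EuclideanHalfSpace n) x).source := by
  rintro _ ⟨z, hz, rfl⟩
  exact mapsTo_symm_source x (hSt hz)

/-- On compact subsets of the range of a chart, Lebesgue measure is bounded by the volume. -/
lemma exists_map_restrict_le (x : M) {K : Set (EuclideanSpace ℝ (Fin n))} (hK : IsCompact K)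
    (hKt : K ⊆ (extChartAt (𝓡∂ n) x).target) :
    ∃ c : NNReal, 0 < c ∧ ∀ S ⊆ K, MeasurableSet S →
      (volume.restrict S).map (extChartAt (𝓡∂ n) x).symm ≤
        c • (vol g).restrict ((extChartAt (𝓡∂ n) x).symm '' S) ∧
      (vol g).restrict ((extChartAt (𝓡∂ n) x).symm '' S) ≤
        c • (volume.restrict S).map (extChartAt (𝓡∂ n) x).symm := by
  have hcont : ContinuousOn (density g x) K := (continuousOn_density g x).mono hKt
  have hpos : ∀ z ∈ K, 0 < density g x z := fun z hz => density_pos g (hKt hz)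
  obtain ⟨C, hC⟩ := hK.exists_bound_of_continuousOn hcont
  obtain ⟨C', hC'⟩ := hK.exists_bound_of_continuousOn (hcont.inv₀ fun z hz => (hpos z hz).ne')
  -- A common bound for the density and its inverse on `K`; one constant thus serves both
  -- comparisons.
  set c : NNReal := Real.toNNReal (max 1 (max C C')) with hc
  have hc1 : (1 : ℝ) ≤ c := by rw [hc, Real.coe_toNNReal']; simp
  have hcC : C ≤ c := by rw [hc, Real.coe_toNNReal']; simp
  have hcC' : C' ≤ c := by rw [hc, Real.coe_toNNReal']; simp
  have hb1 : ∀ z ∈ K, density g x z ≤ c := fun z hz =>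
    ((le_abs_self _).trans (hC z hz)).trans hcC
  have hb2 : ∀ z ∈ K, 1 ≤ c * density g x z := fun z hz => by
    have h1 := ((le_abs_self _).trans (hC' z hz)).trans hcC'
    have h2 := hpos z hz
    calc (1 : ℝ) = (density g x z)⁻¹ * density g x z := (inv_mul_cancel₀ h2.ne').symm
      _ ≤ c * density g x z := mul_le_mul_of_nonneg_right h1 h2.le
  refine ⟨c, by exact_mod_cast (zero_lt_one.trans_le hc1), fun S hSK hS => ?_⟩
  have hSt := hSK.trans hKt
  have hae : AEMeasurable (extChartAt (𝓡∂ n) x).symm (volume.restrict S) :=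
    (aemeasurable_symm x).mono_measure (Measure.restrict_mono hSt le_rfl)
  have him := measurableSet_image_symm x hS hSt
  have hvol : ∀ B, MeasurableSet B → (vol g).restrict ((extChartAt (𝓡∂ n) x).symm '' S) B =
      ∫⁻ z in (extChartAt (𝓡∂ n) x).symm ⁻¹' B ∩ S, ENNReal.ofReal (density g x z) := by
    intro B hB
    rw [Measure.restrict_apply hB, inter_comm, vol_apply g x (him.inter hB)
      (inter_subset_left.trans (image_symm_subset_source x hSt)), preimage_image_symm x hSt]
  have hmB : ∀ B, MeasurableSet B → MeasurableSet ((extChartAt (𝓡∂ n) x).symm ⁻¹' B ∩ S) := by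
    intro B hB
    have := (measurableSet_target_inter_preimage x hB).inter hS
    convert this using 1
    ext z
    exact ⟨fun h => ⟨⟨hSt h.2, h.1⟩, h.2⟩, fun h => ⟨h.1.2, h.2⟩⟩
  constructor
  · refine Measure.le_iff.2 fun B hB => ?_
    rw [Measure.map_apply_of_aemeasurable hae hB, Measure.restrict_apply' hS, Measure.smul_apply,
      hvol B hB, ENNReal.smul_def, smul_eq_mul, ← setLIntegral_one,
      ← lintegral_const_mul' _ _ (by simp)]
    refine setLIntegral_mono' (hmB B hB) fun z hz => ?_
    have := hb2 z (hSK hz.2)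
    rw [← ENNReal.ofReal_coe_nnreal, ← ENNReal.ofReal_mul (by positivity), ← ENNReal.ofReal_one]
    exact ENNReal.ofReal_le_ofReal this
  · refine Measure.le_iff.2 fun B hB => ?_
    rw [hvol B hB, Measure.smul_apply, Measure.map_apply_of_aemeasurable hae hB,
      Measure.restrict_apply' hS, ENNReal.smul_def, smul_eq_mul, ← setLIntegral_const]
    refine setLIntegral_mono' (hmB B hB) fun z hz => ?_
    rw [← ENNReal.ofReal_coe_nnreal]
    exact ENNReal.ofReal_le_ofReal (hb1 z (hSK hz.2))

lemma exists_closedBall_inter_range_subset (x : M) : ∃ R > 0,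
    Metric.closedBall (extChartAt (𝓡∂ n) x x) R ∩ range (𝓡∂ n) ⊆ (extChartAt (𝓡∂ n) x).target ∧
    IsCompact (Metric.closedBall (extChartAt (𝓡∂ n) x x) R ∩ range (𝓡∂ n)) := by
  obtain ⟨R, hR, h⟩ := Metric.mem_nhdsWithin_iff.1 (extChartAt_target_mem_nhdsWithin (I := 𝓡∂ n) x)
  refine ⟨R / 2, by positivity, ?_, (isCompact_closedBall _ _).inter_right
    (𝓡∂ n).isClosed_range⟩
  exact (inter_subset_inter_left _ (Metric.closedBall_subset_ball (by linarith))).trans h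

/-- The part of the chart at `p` that corresponds to a ball in coordinates. -/
def coordBall (n : ℕ) [NeZero n] {M : Type*} [TopologicalSpace M]
    [ChartedSpace (EuclideanHalfSpace n) M] (p : M) (r : ℝ) : Set M :=
  (extChartAt (𝓡∂ n) p).source ∩ (extChartAt (𝓡∂ n) p) ⁻¹' Metric.ball (extChartAt (𝓡∂ n) p p) r

lemma isOpen_coordBall (p : M) (r : ℝ) : IsOpen (coordBall n p r) :=
  (continuousOn_extChartAt p).isOpen_inter_preimage (isOpen_extChartAt_source p) Metric.isOpen_ball

lemma mem_coordBall (p : M) {r : ℝ} (hr : 0 < r) : p ∈ coordBall n p r :=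
  ⟨mem_extChartAt_source p, Metric.mem_ball_self hr⟩

lemma symm_mem_coordBall {p : M} {r : ℝ} {z : EuclideanSpace ℝ (Fin n)}
    (hz : z ∈ (extChartAt (𝓡∂ n) p).target) :
    (extChartAt (𝓡∂ n) p).symm z ∈ coordBall n p r ↔
      z ∈ Metric.ball (extChartAt (𝓡∂ n) p p) r := by
  simp only [coordBall, mem_inter_iff, mem_preimage, (extChartAt (𝓡∂ n) p).right_inv hz,
    (extChartAt (𝓡∂ n) p).map_target hz, true_and]

lemma coordBall_eq_image (p : M) (r : ℝ) : coordBall n p r = (extChartAt (𝓡∂ n) p).symm ''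
    ((extChartAt (𝓡∂ n) p).target ∩ Metric.ball (extChartAt (𝓡∂ n) p p) r) := by
  ext y
  constructor
  · rintro ⟨h1, h2⟩
    exact ⟨_, ⟨(extChartAt (𝓡∂ n) p).map_source h1, h2⟩, (extChartAt (𝓡∂ n) p).left_inv h1⟩
  · rintro ⟨z, ⟨h1, h2⟩, rfl⟩
    exact (symm_mem_coordBall h1).2 h2

lemma isFiniteMeasure_vol [CompactSpace M] : IsFiniteMeasure (vol g) := by
  have : IsLocallyFiniteMeasure (vol g) := by
    refine ⟨fun p => ?_⟩
    obtain ⟨R, hR, hKt, hK⟩ := exists_closedBall_inter_range_subset (n := n) p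
    obtain ⟨c, -, hc⟩ := exists_map_restrict_le g p hK hKt
    set S := (extChartAt (𝓡∂ n) p).target ∩ Metric.ball (extChartAt (𝓡∂ n) p p) R with hS
    have hSm : MeasurableSet S := (measurableSet_target p).inter Metric.isOpen_ball.measurableSet
    have hSK : S ⊆ Metric.closedBall (extChartAt (𝓡∂ n) p p) R ∩ range (𝓡∂ n) := fun z hz =>
      ⟨Metric.ball_subset_closedBall hz.2, extChartAt_target_subset_range p hz.1⟩
    refine ⟨coordBall n p R, (isOpen_coordBall p R).mem_nhds (mem_coordBall p hR), ?_⟩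
    rw [coordBall_eq_image, ← Measure.restrict_apply_univ]
    refine ((hc S hSK hSm).2 univ).trans_lt ?_
    rw [Measure.smul_apply, Measure.map_apply_of_aemeasurable
      ((aemeasurable_symm p).mono_measure (Measure.restrict_mono inter_subset_left le_rfl))
      MeasurableSet.univ, preimage_univ, Measure.restrict_apply_univ, ENNReal.smul_def, smul_eq_mul]
    exact ENNReal.mul_lt_top (by simp)
      ((measure_mono inter_subset_right).trans_lt measure_ball_lt_top)
  exact ⟨isCompact_univ.measure_lt_top⟩

/-- The manifold is second countable, so nullity is a local property and may be tested in the
coordinates at each point. -/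
lemma vol_eq_zero_of_chart [CompactSpace M] {A : Set M} (hA : MeasurableSet A)
    (h : ∀ p ∈ A, ∃ r > 0, volume ((extChartAt (𝓡∂ n) p).target ∩
      (extChartAt (𝓡∂ n) p).symm ⁻¹' A ∩ Metric.ball (extChartAt (𝓡∂ n) p p) r) = 0) :
    vol g A = 0 := by
  have : SecondCountableTopology (EuclideanHalfSpace n) :=
    (𝓡∂ n).isClosedEmbedding.isEmbedding.secondCountableTopology
  have : SecondCountableTopology M :=
    ChartedSpace.secondCountable_of_sigmaCompact (EuclideanHalfSpace n) M
  refine measure_null_of_locally_null A fun p hp => ?_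
  obtain ⟨r, hr, h0⟩ := h p hp
  refine ⟨A ∩ coordBall n p r, inter_mem self_mem_nhdsWithin
    (mem_nhdsWithin_of_mem_nhds ((isOpen_coordBall p r).mem_nhds (mem_coordBall p hr))), ?_⟩
  rw [vol_eq_zero_iff g p (hA.inter (isOpen_coordBall p r).measurableSet)
    (fun y hy => by simpa using hy.2.1)]
  refine measure_mono_null ?_ h0
  rintro z ⟨hz, hzA, hzB⟩
  exact ⟨⟨hz, hzA⟩, (symm_mem_coordBall hz).1 hzB⟩

/-- In coordinates the boundary lies in the frontier of the half-space, and the frontier of a convex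
set is null. -/
lemma vol_boundary [CompactSpace M] : vol g ((𝓡∂ n).boundary M) = 0 := by
  have hm : MeasurableSet ((𝓡∂ n).boundary M) :=
    (ModelWithCorners.isClosed_boundary (n := ∞) (by simp)).measurableSet
  refine vol_eq_zero_of_chart g hm fun p _ => ⟨1, one_pos, ?_⟩
  refine measure_mono_null (t := frontier (range (𝓡∂ n))) ?_ ((𝓡∂ n).convex_range.addHaar_frontier _)
  rintro z ⟨⟨hz, hzb⟩, -⟩
  rw [mem_preimage, ← ModelWithCorners.compl_interior, mem_compl_iff,
    mem_interior_iff_of_mem_target hz] at hzb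
  rw [(𝓡∂ n).isClosed_range.frontier_eq]
  refine ⟨extChartAt_target_subset_range p hz, fun hi => hzb ?_⟩
  rw [mem_interior_iff_mem_nhds]
  have h1 := extChartAt_target_mem_nhdsWithin_of_mem hz
  rwa [nhdsWithin_eq_nhds.2 (mem_interior_iff_mem_nhds.1 hi)] at h1

end

end NeumannDirichlet

/-! ### Square integrable functions and vector fields -/

namespace NeumannDirichlet

section

variable {n : ℕ} [NeZero n] {M : Type*} [TopologicalSpace M]
  [ChartedSpace (EuclideanHalfSpace n) M] [IsManifold (𝓡∂ n) ∞ M]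

lemma chartDomain_mono (x : M) {U V : Set M} (h : U ⊆ V) :
    chartDomain n x U ⊆ chartDomain n x V :=
  inter_subset_inter_right _ (preimage_mono (inter_subset_inter_left _ h))

variable (g : Metric n M)

lemma inner_self_nonneg (y : M) (X : TangentSpace (𝓡∂ n) y) : 0 ≤ g.inner y X X := by
  by_cases h : X = 0
  · rw [h, map_zero]
  · exact (g.pos y X h).le

lemma inner_sq_le (y : M) (X Y : TangentSpace (𝓡∂ n) y) :
    g.inner y X Y ^ 2 ≤ g.inner y X X * g.inner y Y Y := by
  have h : ∀ t : ℝ, 0 ≤ g.inner y Y Y * (t * t) + (2 * g.inner y X Y) * t + g.inner y X X :=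
      fun t => by
    have := inner_self_nonneg g y (X + t • Y)
    simp only [map_add, map_smul, add_apply, smul_apply, smul_eq_mul, g.symm y Y X] at this
    linarith
  have := discrim_le_zero h
  rw [discrim] at this
  nlinarith

lemma abs_inner_le (y : M) (X Y : TangentSpace (𝓡∂ n) y) :
    |g.inner y X Y| ≤ g.inner y X X + g.inner y Y Y := by
  have h1 := inner_self_nonneg g y (X + Y)
  have h2 := inner_self_nonneg g y (X - Y)
  have h3 := inner_self_nonneg g y X
  have h4 := inner_self_nonneg g y Y
  simp only [map_add, map_sub, add_apply, sub_apply, g.symm y Y X] at h1 h2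
  rw [abs_le]
  constructor <;> linarith

/-- The measurability of a vector field is expressed through its pairings with coordinate fields.
The inverse Gram matrix recovers the inner product from these pairings, with continuous
coefficients. -/
lemma inner_eq_sum_inv_gram {x y : M} (hy : y ∈ (chartAt (EuclideanHalfSpace n) x).source)
    (X Y : TangentSpace (𝓡∂ n) y) :
    g.inner y X Y = ∑ i, ∑ j, (gram g x y)⁻¹ i j *
      (g.inner y X (coordVector x y (EuclideanSpace.single i 1)) *
        g.inner y Y (coordVector x y (EuclideanSpace.single j 1))) := by
  obtain ⟨ξ, rfl⟩ := exists_coordVector_eq hy X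
  obtain ⟨η, rfl⟩ := exists_coordVector_eq hy Y
  set G := gram g x y with hG
  have hpd := gram_posDef g hy
  have hsymm : G.transpose = G := by
    have := hpd.isHermitian
    rwa [Matrix.IsHermitian, Matrix.conjTranspose_eq_transpose_of_trivial] at this
  have hp : ∀ (ξ : EuclideanSpace ℝ (Fin n)) i,
      g.inner y (coordVector x y ξ) (coordVector x y (EuclideanSpace.single i 1)) =
      (G.mulVec ξ.ofLp) i := by
    intro ξ i
    rw [g.symm, inner_coordVector_eq, Matrix.mulVec, dotProduct]
    rw [Finset.sum_eq_single i]
    · refine Finset.sum_congr rfl fun j _ => ?_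
      simp [hG, mul_comm]
    · intro b _ hb
      simp [hb]
    · simp
  have hinv : G⁻¹ * G = 1 := Matrix.nonsing_inv_mul _ (isUnit_iff_ne_zero.2 hpd.det_pos.ne')
  have h1 : ∑ i, ∑ j, G⁻¹ i j * ((G.mulVec ξ.ofLp) i * (G.mulVec η.ofLp) j) =
      (G.mulVec ξ.ofLp) ⬝ᵥ (G⁻¹.mulVec (G.mulVec η.ofLp)) := by
    show _ = ∑ i, (G.mulVec ξ.ofLp) i * (∑ j, G⁻¹ i j * (G.mulVec η.ofLp) j)
    refine Finset.sum_congr rfl fun i _ => ?_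
    rw [Finset.mul_sum]
    exact Finset.sum_congr rfl fun j _ => by ring
  simp only [hp]
  rw [h1, Matrix.mulVec_mulVec, hinv, Matrix.one_mulVec, inner_coordVector_eq]
  simp only [dotProduct, Matrix.mulVec, Finset.sum_mul]
  rw [Finset.sum_comm]
  refine Finset.sum_congr rfl fun i _ => Finset.sum_congr rfl fun j _ => ?_
  have : G j i = G i j := congrFun (congrFun hsymm i) j
  rw [← hG, this]; ring

lemma continuousOn_inv_gram (x : M) (i j : Fin n) :
    ContinuousOn (fun z => (gram g x ((extChartAt (𝓡∂ n) x).symm z))⁻¹ i j)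
      (extChartAt (𝓡∂ n) x).target := by
  have h1 : ContinuousOn (fun z => gram g x ((extChartAt (𝓡∂ n) x).symm z))
      (extChartAt (𝓡∂ n) x).target :=
    (continuousOn_gram g x).comp (continuousOn_extChartAt_symm x) (mapsTo_symm_source x)
  have h2 : ContinuousOn (fun z => (gram g x ((extChartAt (𝓡∂ n) x).symm z)).det⁻¹)
      (extChartAt (𝓡∂ n) x).target :=
    (Continuous.matrix_det continuous_id).comp_continuousOn h1 |>.inv₀
      fun z hz => (gram_posDef g (mapsTo_symm_source x hz)).det_pos.ne'
  have h3 : Continuous fun A : Matrix (Fin n) (Fin n) ℝ => A.adjugate i j :=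
    (Continuous.matrix_adjugate continuous_id).matrix_elem i j
  refine (h2.mul (h3.comp_continuousOn h1)).congr fun z hz => ?_
  simp [Matrix.inv_def]

lemma exists_inner_coordVector_le (x : M) {K : Set (EuclideanSpace ℝ (Fin n))} (hK : IsCompact K)
    (hKt : K ⊆ (extChartAt (𝓡∂ n) x).target) : ∃ C : ℝ, 0 < C ∧ ∀ z ∈ K, ∀ v,
      g.inner ((extChartAt (𝓡∂ n) x).symm z) (coordVector x ((extChartAt (𝓡∂ n) x).symm z) v)
        (coordVector x ((extChartAt (𝓡∂ n) x).symm z) v) ≤ C * ‖v‖ ^ 2 := by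
  have hcont : ∀ i j, ContinuousOn (fun z => gram g x ((extChartAt (𝓡∂ n) x).symm z) i j) K :=
    fun i j => ((continuousOn_inner_coordVector g x _ _).comp (continuousOn_extChartAt_symm x)
      (mapsTo_symm_source x)).mono hKt
  choose B hB using fun i j => hK.exists_bound_of_continuousOn (hcont i j)
  refine ⟨∑ i, ∑ j, |B i j| + 1, by positivity, fun z hz v => ?_⟩
  rw [inner_coordVector_eq]
  have h1 : ∀ i j, v i * v j * gram g x ((extChartAt (𝓡∂ n) x).symm z) i j ≤
      |B i j| * ‖v‖ ^ 2 := by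
    intro i j
    have hi := PiLp.norm_apply_le v i
    have hj := PiLp.norm_apply_le v j
    calc v i * v j * gram g x ((extChartAt (𝓡∂ n) x).symm z) i j
        ≤ ‖v i * v j * gram g x ((extChartAt (𝓡∂ n) x).symm z) i j‖ := le_abs_self _
      _ = ‖v i‖ * ‖v j‖ * ‖gram g x ((extChartAt (𝓡∂ n) x).symm z) i j‖ := by
          rw [norm_mul, norm_mul]
      _ ≤ ‖v‖ * ‖v‖ * |B i j| := by
          gcongr
          exact (hB i j z hz).trans (le_abs_self _)
      _ = _ := by ring
  calc ∑ i, ∑ j, v i * v j * gram g x ((extChartAt (𝓡∂ n) x).symm z) i j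
      ≤ ∑ i, ∑ j, |B i j| * ‖v‖ ^ 2 :=
        Finset.sum_le_sum fun i _ => Finset.sum_le_sum fun j _ => h1 i j
    _ = (∑ i, ∑ j, |B i j|) * ‖v‖ ^ 2 := by simp only [Finset.sum_mul]
    _ ≤ _ := by nlinarith [sq_nonneg ‖v‖]

/-- By compactness of the unit sphere, the metric at a single point controls the model norm of the
tangent space, which is complete. The constant depends on the point, which suffices for pointwise
limits of vector fields. -/
lemma exists_norm_sq_le (y : M) : ∃ A : ℝ, 0 < A ∧ ∀ X : EuclideanSpace ℝ (Fin n),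
    ‖X‖ ^ 2 ≤ A * g.inner y (X : TangentSpace (𝓡∂ n) y) (X : TangentSpace (𝓡∂ n) y) := by
  set q : EuclideanSpace ℝ (Fin n) → ℝ := fun X =>
    g.inner y (X : TangentSpace (𝓡∂ n) y) (X : TangentSpace (𝓡∂ n) y) with hq
  have hqc : Continuous q := by
    let B : EuclideanSpace ℝ (Fin n) →L[ℝ] EuclideanSpace ℝ (Fin n) →L[ℝ] ℝ := g.inner y
    exact (B.continuous.clm_apply continuous_id : Continuous fun X => B X X)
  have hqs : ∀ (c : ℝ) X, q (c • X) = c ^ 2 * q X := by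
    intro c X
    have h1 : ∀ Y : TangentSpace (𝓡∂ n) y,
        g.inner y (c • Y) (c • Y) = c ^ 2 * g.inner y Y Y := by
      intro Y
      simp only [map_smul, smul_apply, smul_eq_mul]; ring
    exact h1 X
  by_cases hne : (Metric.sphere (0 : EuclideanSpace ℝ (Fin n)) 1).Nonempty
  · obtain ⟨e, he, hmin⟩ := (isCompact_sphere (0 : EuclideanSpace ℝ (Fin n)) 1).exists_isMinOn hne
      hqc.continuousOn
    have he0 : e ≠ 0 := fun h => by simp [h] at he
    have hpos : 0 < q e := g.pos y e he0
    refine ⟨(q e)⁻¹, by positivity, fun X => ?_⟩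
    show ‖X‖ ^ 2 ≤ (q e)⁻¹ * q X
    rcases eq_or_ne X 0 with rfl | hX
    · rw [norm_zero, zero_pow two_ne_zero]
      exact mul_nonneg (by positivity) (inner_self_nonneg g y _)
    · have hXn : 0 < ‖X‖ := norm_pos_iff.2 hX
      have h1 : q e ≤ q (‖X‖⁻¹ • X) := hmin (by simp [norm_smul, hXn.ne'])
      rw [hqs] at h1
      rw [inv_mul_eq_div, le_div_iff₀ hpos]
      calc ‖X‖ ^ 2 * q e ≤ ‖X‖ ^ 2 * (‖X‖⁻¹ ^ 2 * q X) := by gcongr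
        _ = q X := by field_simp
  · refine ⟨1, one_pos, fun X => ?_⟩
    rcases eq_or_ne X 0 with rfl | hX
    · rw [norm_zero, zero_pow two_ne_zero]
      exact mul_nonneg zero_le_one (inner_self_nonneg g y _)
    · exact absurd ⟨‖X‖⁻¹ • X, by simp [norm_smul, hX]⟩ hne

variable [MeasurableSpace M] [BorelSpace M]

lemma measurableSet_chartDomain (x : M) {U : Set M} (hU : IsOpen U) :
    MeasurableSet (chartDomain n x U) := (isOpen_chartDomain x hU).measurableSet

/-- Properties that hold almost everywhere for the volume hold almost everywhere in coordinates. -/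
lemma ae_chartDomain_of_ae {U : Set M} (hU : IsOpen U) {P : M → Prop}
    (h : ∀ᵐ y ∂(vol g).restrict U, P y) (x : M) :
    ∀ᵐ z ∂volume.restrict (chartDomain n x U), P ((extChartAt (𝓡∂ n) x).symm z) := by
  rw [ae_restrict_iff' hU.measurableSet, ae_iff] at h
  rw [ae_restrict_iff' (measurableSet_chartDomain x hU), ae_iff]
  set N := toMeasurable (vol g) {a | ¬(a ∈ U → P a)} with hN
  have hN0 : vol g N = 0 := by rw [hN, measure_toMeasurable]; exact h
  have hNm : MeasurableSet N := measurableSet_toMeasurable _ _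
  have hs := (chartAt (EuclideanHalfSpace n) x).open_source.measurableSet
  have h1 := (vol_eq_zero_iff g x (hNm.inter hs) inter_subset_right).1
    (measure_mono_null inter_subset_left hN0)
  refine measure_mono_null ?_ h1
  intro z hz
  simp only [Classical.not_imp, mem_ofPred_eq] at hz
  exact ⟨hz.1.1, subset_toMeasurable _ _ (by
    simp only [Classical.not_imp, mem_ofPred_eq]
    exact ⟨hz.1.2.1, hz.2⟩), mapsTo_symm_source x hz.1.1⟩

variable (n M) in
lemma exists_finset_cover [CompactSpace M] :
    ∃ T : Finset M, ∀ y : M, ∃ x ∈ T, y ∈ (chartAt (EuclideanHalfSpace n) x).source := by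
  obtain ⟨T, hT⟩ := isCompact_univ.elim_finite_subcover
    (fun x : M => (chartAt (EuclideanHalfSpace n) x).source)
    (fun x => (chartAt (EuclideanHalfSpace n) x).open_source)
    (fun x _ => mem_iUnion.2 ⟨x, mem_chart_source _ x⟩)
  refine ⟨T, fun y => ?_⟩
  simpa using hT (mem_univ y)

/-- Properties that hold almost everywhere in coordinates hold almost everywhere for the volume. -/
lemma ae_of_ae_chartDomain [CompactSpace M] {U : Set M} (hU : IsOpen U) {P : M → Prop}
    (h : ∀ x, ∀ᵐ z ∂volume.restrict (chartDomain n x U), P ((extChartAt (𝓡∂ n) x).symm z)) :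
    ∀ᵐ y ∂(vol g).restrict U, P y := by
  rw [ae_restrict_iff' hU.measurableSet, ae_iff]
  obtain ⟨T, hT⟩ := exists_finset_cover n M
  have h1 : ∀ x, ∃ B, B ⊆ chartDomain n x U ∧ MeasurableSet B ∧ volume B = 0 ∧
      ∀ z ∈ chartDomain n x U, ¬ P ((extChartAt (𝓡∂ n) x).symm z) → z ∈ B := by
    intro x
    have h2 := h x
    rw [ae_restrict_iff' (measurableSet_chartDomain x hU), ae_iff] at h2
    refine ⟨toMeasurable volume _ ∩ chartDomain n x U, inter_subset_right,
      (measurableSet_toMeasurable _ _).inter (measurableSet_chartDomain x hU),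
      measure_mono_null inter_subset_left ((measure_toMeasurable _).trans h2), ?_⟩
    intro z hz hP
    refine ⟨subset_toMeasurable _ _ ?_, hz⟩
    simp only [Classical.not_imp, mem_ofPred_eq]
    exact ⟨hz, hP⟩
  choose B hB1 hB2 hB3 hB4 using h1
  -- The exceptional set lies in the boundary and the images of the coordinate null sets of a finite
  -- atlas.
  refine measure_mono_null (t := (𝓡∂ n).boundary M ∪
    ⋃ x ∈ T, (extChartAt (𝓡∂ n) x).symm '' B x) ?_ ?_
  · intro y hy
    simp only [Classical.not_imp, mem_ofPred_eq] at hy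
    by_cases hyb : y ∈ (𝓡∂ n).boundary M
    · exact Or.inl hyb
    · right
      obtain ⟨x, hx, hyx⟩ := hT y
      rw [← extChartAt_source (𝓡∂ n)] at hyx
      have hz := (extChartAt (𝓡∂ n) x).left_inv hyx
      refine mem_iUnion₂.2 ⟨x, hx, extChartAt (𝓡∂ n) x y, hB4 x _ ⟨?_, ?_⟩ ?_, hz⟩
      · exact (extChartAt (𝓡∂ n) x).map_source hyx
      · rw [mem_preimage, hz, ← ModelWithCorners.compl_boundary]; exact ⟨hy.1, hyb⟩
      · rw [hz]; exact hy.2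
  · refine measure_union_null (vol_boundary g)
      ((measure_biUnion_null_iff T.countable_toSet).2 fun x _ => ?_)
    have hBt : B x ⊆ (extChartAt (𝓡∂ n) x).target := (hB1 x).trans inter_subset_left
    rw [vol_eq_zero_iff g x (measurableSet_image_symm x (hB2 x) hBt)
      (image_symm_subset_source x hBt)]
    have := preimage_image_symm x hBt univ
    rw [inter_univ, preimage_univ, univ_inter] at this
    rw [this]; exact hB3 x

/-- A finite atlas covers `U`; on each chart a measurable representative in coordinates is composed
with the chart. It agrees with `F` off the boundary and the image of a coordinate null set. -/
lemma aestronglyMeasurable_of_chartDomain [CompactSpace M] {U : Set M} (hU : IsOpen U)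
    {F : M → ℝ} (h : ∀ x, AEStronglyMeasurable (fun z => F ((extChartAt (𝓡∂ n) x).symm z))
      (volume.restrict (chartDomain n x U))) :
    AEStronglyMeasurable F ((vol g).restrict U) := by
  obtain ⟨T, hT⟩ := exists_finset_cover n M
  have hcov : U = ⋃ x : T, U ∩ (chartAt (EuclideanHalfSpace n) (x : M)).source := by
    ext y
    simp only [mem_iUnion, mem_inter_iff]
    exact ⟨fun hy => by obtain ⟨x, hx, hyx⟩ := hT y; exact ⟨⟨x, hx⟩, hy, hyx⟩,
      fun ⟨_, hy, _⟩ => hy⟩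
  rw [hcov]
  refine AEStronglyMeasurable.iUnion fun x => ?_
  set s := (chartAt (EuclideanHalfSpace n) (x : M)).source with hs
  have hso : IsOpen s := (chartAt _ _).open_source
  set φ := (h x).mk _ with hφ
  have hmeas : AEMeasurable (extChartAt (𝓡∂ n) (x : M)) ((vol g).restrict (U ∩ s)) := by
    have h1 : ContinuousOn (extChartAt (𝓡∂ n) (x : M)) (U ∩ s) :=
      (continuousOn_extChartAt (x : M)).mono fun y hy => by
        rw [extChartAt_source]; exact hy.2
    exact h1.aemeasurable (hU.inter hso).measurableSet
  have h2 : AEStronglyMeasurable (fun y => φ (extChartAt (𝓡∂ n) (x : M) y))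
      ((vol g).restrict (U ∩ s)) :=
    ((h x).stronglyMeasurable_mk.aestronglyMeasurable).comp_aemeasurable hmeas
  refine h2.congr ?_
  set B := toMeasurable volume {z | ¬ (z ∈ chartDomain n (x : M) U →
    F ((extChartAt (𝓡∂ n) (x : M)).symm z) = φ z)} ∩ chartDomain n (x : M) U with hB
  have hBt : B ⊆ (extChartAt (𝓡∂ n) (x : M)).target :=
    inter_subset_right.trans inter_subset_left
  have hBm : MeasurableSet B :=
    (measurableSet_toMeasurable _ _).inter (measurableSet_chartDomain _ hU)
  have hB0 : volume B = 0 := by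
    have h3 := (h x).ae_eq_mk
    rw [EventuallyEq, ae_restrict_iff' (measurableSet_chartDomain _ hU), ae_iff] at h3
    exact measure_mono_null inter_subset_left ((measure_toMeasurable _).trans h3)
  have hnull : vol g ((𝓡∂ n).boundary M ∪ (extChartAt (𝓡∂ n) (x : M)).symm '' B) = 0 := by
    refine measure_union_null (vol_boundary g) ?_
    rw [vol_eq_zero_iff g (x : M) (measurableSet_image_symm _ hBm hBt)
      (image_symm_subset_source _ hBt)]
    have := preimage_image_symm (x : M) hBt univ
    rw [inter_univ, preimage_univ, univ_inter] at this
    rw [this]; exact hB0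
  have hae : ∀ᵐ y ∂(vol g), y ∉ (𝓡∂ n).boundary M ∪ (extChartAt (𝓡∂ n) (x : M)).symm '' B :=
    measure_eq_zero_iff_ae_notMem.1 hnull
  filter_upwards [ae_restrict_of_ae hae, ae_restrict_mem (hU.inter hso).measurableSet] with y hy hyU
  have hys : y ∈ (extChartAt (𝓡∂ n) (x : M)).source := by rw [extChartAt_source]; exact hyU.2
  have hz := (extChartAt (𝓡∂ n) (x : M)).left_inv hys
  by_contra hne
  refine hy (Or.inr ⟨extChartAt (𝓡∂ n) (x : M) y, ?_, hz⟩)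
  have hmem : extChartAt (𝓡∂ n) (x : M) y ∈ chartDomain n (x : M) U := by
    refine ⟨(extChartAt (𝓡∂ n) (x : M)).map_source hys, ?_⟩
    rw [mem_preimage, hz, ← ModelWithCorners.compl_boundary]
    exact ⟨hyU.1, fun h => hy (Or.inl h)⟩
  refine ⟨subset_toMeasurable _ _ ?_, hmem⟩
  simp only [Classical.not_imp, mem_ofPred_eq]
  refine ⟨hmem, fun heq => hne ?_⟩
  rw [← heq, hz]

/-- Square integrable pairs of a function and a vector field on `U`. -/
structure IsL2Pair (U : Set M) (u : M → ℝ) (X : ∀ y : M, TangentSpace (𝓡∂ n) y) : Prop where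
  memLp : MemLp u 2 ((vol g).restrict U)
  aestronglyMeasurable : ∀ (x : M) (v : EuclideanSpace ℝ (Fin n)),
    AEStronglyMeasurable (chartPairing g X x v) (volume.restrict (chartDomain n x U))
  integrable : Integrable (fun y => g.inner y (X y) (X y)) ((vol g).restrict U)

variable {g}

lemma IsH1.isL2Pair {U : Set M} {u : M → ℝ} {X : ∀ y : M, TangentSpace (𝓡∂ n) y}
    (h : IsH1 g U u X) : IsL2Pair g U u X := ⟨h.memLp, h.aestronglyMeasurable, h.integrable⟩

lemma aestronglyMeasurable_inner [CompactSpace M] {U : Set M} (hU : IsOpen U)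
    {X Y : ∀ y : M, TangentSpace (𝓡∂ n) y}
    (hX : ∀ (x : M) (v : EuclideanSpace ℝ (Fin n)),
      AEStronglyMeasurable (chartPairing g X x v) (volume.restrict (chartDomain n x U)))
    (hY : ∀ (x : M) (v : EuclideanSpace ℝ (Fin n)),
      AEStronglyMeasurable (chartPairing g Y x v) (volume.restrict (chartDomain n x U))) :
    AEStronglyMeasurable (fun y => g.inner y (X y) (Y y)) ((vol g).restrict U) := by
  refine aestronglyMeasurable_of_chartDomain g hU fun x => ?_
  have h1 : AEStronglyMeasurable (fun z => ∑ i, ∑ j,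
      (gram g x ((extChartAt (𝓡∂ n) x).symm z))⁻¹ i j *
        (chartPairing g X x (EuclideanSpace.single i 1) z *
          chartPairing g Y x (EuclideanSpace.single j 1) z))
      (volume.restrict (chartDomain n x U)) := by
    refine Finset.aestronglyMeasurable_fun_sum _ fun i _ =>
      Finset.aestronglyMeasurable_fun_sum _ fun j _ => ?_
    refine AEStronglyMeasurable.mul ?_ ((hX x _).mul (hY x _))
    exact ((continuousOn_inv_gram g x i j).mono inter_subset_left).aestronglyMeasurable
      (measurableSet_chartDomain x hU)
  refine h1.congr ?_
  filter_upwards [ae_restrict_mem (measurableSet_chartDomain x hU)] with z hz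
  exact (inner_eq_sum_inv_gram g (mapsTo_symm_source x hz.1) _ _).symm

lemma IsL2Pair.integrable_inner [CompactSpace M] {U : Set M} (hU : IsOpen U) {u v : M → ℝ}
    {X Y : ∀ y : M, TangentSpace (𝓡∂ n) y} (h : IsL2Pair g U u X) (k : IsL2Pair g U v Y) :
    Integrable (fun y => g.inner y (X y) (Y y)) ((vol g).restrict U) :=
  (h.integrable.add k.integrable).mono' (aestronglyMeasurable_inner hU h.2 k.2)
    (Eventually.of_forall fun y => abs_inner_le g y _ _)

lemma IsL2Pair.integrable_mul {U : Set M} {u v : M → ℝ}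
    {X Y : ∀ y : M, TangentSpace (𝓡∂ n) y} (h : IsL2Pair g U u X) (k : IsL2Pair g U v Y) :
    Integrable (fun y => u y * v y) ((vol g).restrict U) := h.memLp.integrable_mul k.memLp

lemma chartPairing_add (X Y : ∀ y : M, TangentSpace (𝓡∂ n) y) (x : M)
    (v : EuclideanSpace ℝ (Fin n)) :
    chartPairing g (X + Y) x v = chartPairing g X x v + chartPairing g Y x v := by
  ext z
  simp only [chartPairing, Pi.add_apply, map_add, add_apply]

lemma chartPairing_smul (c : ℝ) (X : ∀ y : M, TangentSpace (𝓡∂ n) y) (x : M)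
    (v : EuclideanSpace ℝ (Fin n)) :
    chartPairing g (c • X) x v = c • chartPairing g X x v := by
  ext z
  simp only [chartPairing, Pi.smul_apply, map_smul, smul_apply]

variable (g) in
/-- The space of square integrable pairs on `U`. -/
def l2Pairs [CompactSpace M] {U : Set M} (hU : IsOpen U) :
    Submodule ℝ ((M → ℝ) × (∀ y : M, TangentSpace (𝓡∂ n) y)) where
  carrier := {p | IsL2Pair g U p.1 p.2}
  add_mem' := by
    rintro p q hp hq
    refine ⟨hp.memLp.add hq.memLp, fun x v => ?_, ?_⟩
    · rw [Prod.snd_add, chartPairing_add]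
      exact (hp.2 x v).add (hq.2 x v)
    · refine ((hp.integrable.add hq.integrable).add
        ((hp.integrable_inner hU hq).const_mul 2)).congr (Eventually.of_forall fun y => ?_)
      simp only [Prod.snd_add, Pi.add_apply, map_add, add_apply, g.symm y (q.2 y) (p.2 y)]
      ring
  zero_mem' := by
    refine ⟨MemLp.zero, fun x v => ?_, ?_⟩
    · have : chartPairing g (0 : ∀ y : M, TangentSpace (𝓡∂ n) y) x v = 0 := by
        rw [← zero_smul ℝ (0 : ∀ y : M, TangentSpace (𝓡∂ n) y), chartPairing_smul, zero_smul]
      rw [Prod.snd_zero, this]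
      exact aestronglyMeasurable_const
    · simp
  smul_mem' := by
    rintro c p hp
    refine ⟨hp.memLp.const_smul c, fun x v => ?_, ?_⟩
    · rw [Prod.smul_snd, chartPairing_smul]
      exact (hp.2 x v).const_smul c
    · refine (hp.integrable.const_mul (c ^ 2)).congr (Eventually.of_forall fun y => ?_)
      simp only [Prod.smul_snd, Pi.smul_apply, map_smul, smul_apply, smul_eq_mul]
      ring

/-- On compact subsets of a chart, the coordinate expressions of a square integrable pair are
square integrable. -/
lemma exists_coord_bound (x : M) {K : Set (EuclideanSpace ℝ (Fin n))} (hK : IsCompact K)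
    (hKt : K ⊆ (extChartAt (𝓡∂ n) x).target) {U : Set M} :
    ∃ C : ℝ, 0 < C ∧ ∀ S ⊆ K ∩ chartDomain n x U, MeasurableSet S → ∀ u X, IsL2Pair g U u X →
      MemLp (fun z => u ((extChartAt (𝓡∂ n) x).symm z)) 2 (volume.restrict S) ∧
      ∫ z in S, u ((extChartAt (𝓡∂ n) x).symm z) ^ 2 ≤ C * ∫ y in U, u y ^ 2 ∂(vol g) ∧
      ∀ v, MemLp (chartPairing g X x v) 2 (volume.restrict S) ∧
        ∫ z in S, chartPairing g X x v z ^ 2 ≤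
          C * ‖v‖ ^ 2 * ∫ y in U, g.inner y (X y) (X y) ∂(vol g) := by
  obtain ⟨c, hc0, hc⟩ := exists_map_restrict_le g x hK hKt
  obtain ⟨B, hB0, hB⟩ := exists_inner_coordVector_le g x hK hKt
  refine ⟨c * (1 + B), by positivity, fun S hS hSm u X h => ?_⟩
  have hSK : S ⊆ K := hS.trans inter_subset_left
  have hSD : S ⊆ chartDomain n x U := hS.trans inter_subset_right
  have hae : AEMeasurable (extChartAt (𝓡∂ n) x).symm (volume.restrict S) :=
    (aemeasurable_symm x).mono_measure (Measure.restrict_mono (hSK.trans hKt) le_rfl)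
  have hle : (volume.restrict S).map (extChartAt (𝓡∂ n) x).symm ≤ c • (vol g).restrict U := by
    refine (hc S hSK hSm).1.trans ?_
    gcongr
    rintro _ ⟨z, hz, rfl⟩
    exact (hSD hz).2.1
  have hint : ∀ F : M → ℝ, (∀ y, 0 ≤ F y) → Integrable F ((vol g).restrict U) →
      Integrable (fun z => F ((extChartAt (𝓡∂ n) x).symm z)) (volume.restrict S) ∧
      ∫ z in S, F ((extChartAt (𝓡∂ n) x).symm z) ≤ c * ∫ y in U, F y ∂(vol g) := by
    intro F hF0 hF
    have h1 : Integrable F (c • (vol g).restrict U) := hF.smul_measure_nnreal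
    have h2 : Integrable F ((volume.restrict S).map (extChartAt (𝓡∂ n) x).symm) :=
      h1.mono_measure hle
    refine ⟨h2.comp_aemeasurable hae, ?_⟩
    rw [← integral_map hae h2.aestronglyMeasurable]
    refine (integral_mono_measure hle (Eventually.of_forall hF0) h1).trans (le_of_eq ?_)
    rw [integral_smul_nnreal_measure]; rfl
  have hu := hint (fun y => u y ^ 2) (fun _ => sq_nonneg _) h.memLp.integrable_sq
  have hX := hint _ (fun y => inner_self_nonneg g y (X y)) h.integrable
  have hUi : 0 ≤ ∫ y in U, u y ^ 2 ∂(vol g) := integral_nonneg fun _ => sq_nonneg _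
  have hXi : 0 ≤ ∫ y in U, g.inner y (X y) (X y) ∂(vol g) :=
    integral_nonneg fun y => inner_self_nonneg g y (X y)
  have hum : AEStronglyMeasurable (fun z => u ((extChartAt (𝓡∂ n) x).symm z))
      (volume.restrict S) := by
    have h1 : AEStronglyMeasurable u ((volume.restrict S).map (extChartAt (𝓡∂ n) x).symm) := by
      refine AEStronglyMeasurable.mono_ac ?_ h.memLp.1
      exact (Measure.absolutelyContinuous_of_le hle).trans (Measure.smul_absolutelyContinuous)
    exact h1.comp_aemeasurable hae
  refine ⟨(memLp_two_iff_integrable_sq hum).2 hu.1, hu.2.trans ?_, fun v => ?_⟩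
  · refine mul_le_mul_of_nonneg_right ?_ hUi
    nlinarith [c.2, mul_nonneg c.2 hB0.le]
  · have hpm : AEStronglyMeasurable (chartPairing g X x v) (volume.restrict S) :=
      (h.2 x v).mono_measure (Measure.restrict_mono hSD le_rfl)
    have hpw : ∀ z ∈ S, chartPairing g X x v z ^ 2 ≤ (B * ‖v‖ ^ 2) *
        g.inner ((extChartAt (𝓡∂ n) x).symm z) (X ((extChartAt (𝓡∂ n) x).symm z))
          (X ((extChartAt (𝓡∂ n) x).symm z)) := by
      intro z hz
      refine (inner_sq_le g _ _ _).trans ?_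
      rw [mul_comm]
      exact mul_le_mul_of_nonneg_right (hB z (hSK hz) v) (inner_self_nonneg g _ _)
    have hpw' : ∀ᵐ z ∂(volume.restrict S), chartPairing g X x v z ^ 2 ≤ (B * ‖v‖ ^ 2) *
        g.inner ((extChartAt (𝓡∂ n) x).symm z) (X ((extChartAt (𝓡∂ n) x).symm z))
          (X ((extChartAt (𝓡∂ n) x).symm z)) := by
      filter_upwards [ae_restrict_mem hSm] with z hz using hpw z hz
    have hi : Integrable (fun z => chartPairing g X x v z ^ 2) (volume.restrict S) := by
      refine (hX.1.const_mul (B * ‖v‖ ^ 2)).mono' (hpm.pow 2) ?_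
      filter_upwards [hpw'] with z hz
      rw [Real.norm_of_nonneg (sq_nonneg _)]; exact hz
    refine ⟨(memLp_two_iff_integrable_sq hpm).2 hi, ?_⟩
    refine (integral_mono_ae hi (hX.1.const_mul _) hpw').trans ?_
    rw [integral_const_mul]
    refine (mul_le_mul_of_nonneg_left hX.2 (by positivity)).trans ?_
    have h1 : B * ‖v‖ ^ 2 * (c * ∫ y in U, g.inner y (X y) (X y) ∂(vol g)) =
        (c * B) * ‖v‖ ^ 2 * ∫ y in U, g.inner y (X y) (X y) ∂(vol g) := by ring
    rw [h1]
    gcongr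
    linarith

end

end NeumannDirichlet

/-! ### Cauchy–Schwarz, fast convergence and Fatou's lemma -/

section IntegralLemmas

variable {α : Type*} [MeasurableSpace α] {ν : Measure α}

lemma sq_integral_mul_le {f g : α → ℝ} (hf : MemLp f 2 ν) (hg : MemLp g 2 ν) :
    (∫ x, f x * g x ∂ν) ^ 2 ≤ (∫ x, f x ^ 2 ∂ν) * ∫ x, g x ^ 2 ∂ν := by
  have h1 := integral_mul_le_sqrt_mul_sqrt hf hg
  have h2 := integral_mul_le_sqrt_mul_sqrt hf.neg hg
  simp only [Pi.neg_apply, neg_mul, integral_neg, neg_sq] at h2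
  have h3 : |∫ x, f x * g x ∂ν| ≤ √(∫ x, f x ^ 2 ∂ν) * √(∫ x, g x ^ 2 ∂ν) :=
    abs_le.2 ⟨by linarith, h1⟩
  calc (∫ x, f x * g x ∂ν) ^ 2 = |∫ x, f x * g x ∂ν| ^ 2 := (sq_abs _).symm
    _ ≤ (√(∫ x, f x ^ 2 ∂ν) * √(∫ x, g x ^ 2 ∂ν)) ^ 2 := by gcongr
    _ = _ := by
      rw [mul_pow, Real.sq_sqrt (integral_nonneg fun _ => sq_nonneg _),
        Real.sq_sqrt (integral_nonneg fun _ => sq_nonneg _)]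

/-- A sequence of nonnegative functions with rapidly decreasing integrals decreases
geometrically almost everywhere. -/
lemma ae_le_geometric_of_integral_le {F : ℕ → α → ℝ} (hF0 : ∀ k x, 0 ≤ F k x)
    (hF : ∀ k, Integrable (F k) ν) (h : ∀ k, ∫ x, F k x ∂ν ≤ (1 / 8) ^ k) :
    ∀ᵐ x ∂ν, ∃ C : ℝ, 0 ≤ C ∧ ∀ k, F k x ≤ C * (1 / 4) ^ k := by
  have hm : ∀ k, AEMeasurable (fun x => ENNReal.ofReal (4 ^ k * F k x)) ν := fun k =>
    ((hF k).1.aemeasurable.const_mul _).ennreal_ofReal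
  -- With weights `4 ^ k` the integrals are still bounded by `(1 / 2) ^ k`, hence summable. The
  -- weighted series is thus finite almost everywhere, and its sum serves as the constant `C`.
  have hsum : ∫⁻ x, ∑' k, ENNReal.ofReal (4 ^ k * F k x) ∂ν ≠ ⊤ := by
    rw [lintegral_tsum hm]
    have h1 : ∀ k, ∫⁻ x, ENNReal.ofReal (4 ^ k * F k x) ∂ν ≤ ENNReal.ofReal ((1 / 2) ^ k) := by
      intro k
      rw [← ofReal_integral_eq_lintegral_ofReal ((hF k).const_mul _)
        (Eventually.of_forall fun x => mul_nonneg (by positivity) (hF0 k x)), integral_const_mul]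
      refine ENNReal.ofReal_le_ofReal ((mul_le_mul_of_nonneg_left (h k) (by positivity)).trans ?_)
      rw [← mul_pow]; norm_num
    refine ne_top_of_le_ne_top ?_ (ENNReal.tsum_le_tsum h1)
    rw [← ENNReal.ofReal_tsum_of_nonneg (fun k => by positivity) summable_geometric_two]
    exact ENNReal.ofReal_ne_top
  filter_upwards [ae_lt_top' (AEMeasurable.tsum hm) hsum] with x hx
  refine ⟨(∑' k, ENNReal.ofReal (4 ^ k * F k x)).toReal, ENNReal.toReal_nonneg, fun k => ?_⟩
  have h1 : ENNReal.ofReal (4 ^ k * F k x) ≤ ∑' k, ENNReal.ofReal (4 ^ k * F k x) :=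
    ENNReal.le_tsum k
  have h2 := ENNReal.toReal_mono hx.ne h1
  rw [ENNReal.toReal_ofReal (mul_nonneg (by positivity) (hF0 k x))] at h2
  rw [one_div, inv_pow, ← div_eq_mul_inv, le_div_iff₀ (by positivity)]
  linarith

/-- Fatou's lemma for nonnegative real functions. -/
lemma integrable_and_integral_le_of_tendsto {F : ℕ → α → ℝ} {f : α → ℝ} {C : ℝ}
    (hF0 : ∀ k x, 0 ≤ F k x) (hF : ∀ k, Integrable (F k) ν)
    (hC : ∀ᶠ k in atTop, ∫ x, F k x ∂ν ≤ C)
    (hlim : ∀ᵐ x ∂ν, Tendsto (fun k => F k x) atTop (𝓝 (f x))) :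
    Integrable f ν ∧ ∫ x, f x ∂ν ≤ C := by
  have hfm : AEStronglyMeasurable f ν := aestronglyMeasurable_of_tendsto_ae atTop
    (fun k => (hF k).1) hlim
  have hf0 : 0 ≤ᵐ[ν] f := by
    filter_upwards [hlim] with x hx using ge_of_tendsto' hx fun k => hF0 k x
  have h1 : ∫⁻ x, ENNReal.ofReal (f x) ∂ν ≤ ENNReal.ofReal C := by
    calc ∫⁻ x, ENNReal.ofReal (f x) ∂ν
        = ∫⁻ x, liminf (fun k => ENNReal.ofReal (F k x)) atTop ∂ν := by
          refine lintegral_congr_ae ?_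
          filter_upwards [hlim] with x hx
          exact ((ENNReal.continuous_ofReal.tendsto _).comp hx).liminf_eq.symm
      _ ≤ liminf (fun k => ∫⁻ x, ENNReal.ofReal (F k x) ∂ν) atTop :=
          lintegral_liminf_le' fun k => (hF k).1.aemeasurable.ennreal_ofReal
      _ ≤ liminf (fun _ : ℕ => ENNReal.ofReal C) atTop := by
          refine liminf_le_liminf ?_
          filter_upwards [hC] with k hk
          rw [← ofReal_integral_eq_lintegral_ofReal (hF k) (Eventually.of_forall (hF0 k))]
          exact ENNReal.ofReal_le_ofReal hk
      _ = _ := liminf_const _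
  have hC0 : 0 ≤ C := by
    obtain ⟨k, hk⟩ := hC.exists
    exact (integral_nonneg (hF0 k)).trans hk
  have hfi : Integrable f ν := by
    refine ⟨hfm, ?_⟩
    rw [hasFiniteIntegral_iff_ofReal hf0]
    exact h1.trans_lt ENNReal.ofReal_lt_top
  refine ⟨hfi, ?_⟩
  rw [← ofReal_integral_eq_lintegral_ofReal hfi hf0] at h1
  exact (ENNReal.ofReal_le_ofReal_iff hC0).1 h1

end IntegralLemmas

/-! ### The energy and mass forms, and completeness -/

namespace NeumannDirichlet

section

variable {n : ℕ} [NeZero n] {M : Type*} [TopologicalSpace M]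
  [ChartedSpace (EuclideanHalfSpace n) M] [IsManifold (𝓡∂ n) ∞ M]
  [MeasurableSpace M] [BorelSpace M] [CompactSpace M]

variable (g : Metric n M) {U : Set M} (hU : IsOpen U)

lemma abs_le_geometric_of_sq_le {C t : ℝ} {k : ℕ} (hC : 0 ≤ C) (ht : t ^ 2 ≤ C * (1 / 4) ^ k) :
    |t| ≤ √C * (1 / 2) ^ k := by
  refine abs_le_of_sq_le_sq ?_ (by positivity)
  rw [mul_pow, Real.sq_sqrt hC, ← pow_mul, mul_comm k 2, pow_mul]
  norm_num at ht ⊢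
  exact ht

lemma continuous_inner_sub (y : M) (A : TangentSpace (𝓡∂ n) y) :
    Continuous fun Z : TangentSpace (𝓡∂ n) y => g.inner y (A - Z) (A - Z) := by
  let B : EuclideanSpace ℝ (Fin n) →L[ℝ] EuclideanSpace ℝ (Fin n) →L[ℝ] ℝ := g.inner y
  let A' : EuclideanSpace ℝ (Fin n) := A
  have h : Continuous fun Z : EuclideanSpace ℝ (Fin n) => A' - Z := by fun_prop
  exact ((B.continuous.comp h).clm_apply h : Continuous fun Z => B (A' - Z) (A' - Z))

lemma continuous_inner_right (y : M) (A : TangentSpace (𝓡∂ n) y) :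
    Continuous fun Z : TangentSpace (𝓡∂ n) y => g.inner y Z A := by
  let B : EuclideanSpace ℝ (Fin n) →L[ℝ] EuclideanSpace ℝ (Fin n) →L[ℝ] ℝ := g.inner y
  let A' : EuclideanSpace ℝ (Fin n) := A
  exact (B.continuous.clm_apply continuous_const : Continuous fun Z => B Z A')

/-- The geometric bound is a premise inside the existential, so that a limit vector can be chosen at
every point and defines a vector field on all of `M`; the bound itself holds only almost everywhere.
-/
lemma exists_tangent_limit {y : M} (X : ℕ → TangentSpace (𝓡∂ n) y) :
    ∃ L : TangentSpace (𝓡∂ n) y,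
      (∃ C : ℝ, 0 ≤ C ∧ ∀ k, g.inner y (X k - X (k + 1)) (X k - X (k + 1)) ≤ C * (1 / 4) ^ k) →
      Tendsto X atTop (𝓝 L) := by
  by_cases h : ∃ C : ℝ, 0 ≤ C ∧
      ∀ k, g.inner y (X k - X (k + 1)) (X k - X (k + 1)) ≤ C * (1 / 4) ^ k
  · obtain ⟨C, hC, hXC⟩ := h
    obtain ⟨A, hA, hAX⟩ := exists_norm_sq_le g y
    let Z : ℕ → EuclideanSpace ℝ (Fin n) := X
    have hZ : CauchySeq Z := by
      refine cauchySeq_of_le_geometric (1 / 2) (√(A * C)) (by norm_num) fun k => ?_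
      rw [dist_eq_norm, ← abs_norm]
      refine abs_le_geometric_of_sq_le (by positivity) ((hAX _).trans ?_)
      rw [mul_assoc]
      exact mul_le_mul_of_nonneg_left (hXC k) hA.le
    obtain ⟨L, hL⟩ := cauchySeq_tendsto_of_complete hZ
    exact ⟨L, fun _ => hL⟩
  · exact ⟨0, fun h' => absurd h' h⟩

/-- The Dirichlet form `∫_U g(X, Y)` on square integrable pairs. -/
noncomputable def energyForm : l2Pairs g hU →ₗ[ℝ] l2Pairs g hU →ₗ[ℝ] ℝ :=
  LinearMap.mk₂ ℝ (fun p q => ∫ y in U, g.inner y (p.1.2 y) (q.1.2 y) ∂(vol g))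
    (fun p p' q => by
      rw [← integral_add (p.2.integrable_inner hU q.2) (p'.2.integrable_inner hU q.2)]
      refine integral_congr_ae (Eventually.of_forall fun y => ?_)
      simp only [Submodule.coe_add, Prod.snd_add, Pi.add_apply, map_add, add_apply])
    (fun c p q => by
      rw [smul_eq_mul, ← integral_const_mul]
      refine integral_congr_ae (Eventually.of_forall fun y => ?_)
      simp only [Submodule.coe_smul, Prod.smul_snd, Pi.smul_apply, map_smul, smul_apply,
        smul_eq_mul])
    (fun p q q' => by
      rw [← integral_add (p.2.integrable_inner hU q.2) (p.2.integrable_inner hU q'.2)]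
      refine integral_congr_ae (Eventually.of_forall fun y => ?_)
      simp only [Submodule.coe_add, Prod.snd_add, Pi.add_apply, map_add])
    (fun c p q => by
      rw [smul_eq_mul, ← integral_const_mul]
      refine integral_congr_ae (Eventually.of_forall fun y => ?_)
      simp only [Submodule.coe_smul, Prod.smul_snd, Pi.smul_apply, map_smul, smul_eq_mul])

/-- The `L²(U)` inner product on square integrable pairs. -/
noncomputable def massForm : l2Pairs g hU →ₗ[ℝ] l2Pairs g hU →ₗ[ℝ] ℝ :=
  LinearMap.mk₂ ℝ (fun p q => ∫ y in U, p.1.1 y * q.1.1 y ∂(vol g))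
    (fun p p' q => by
      rw [← integral_add (p.2.integrable_mul q.2) (p'.2.integrable_mul q.2)]
      refine integral_congr_ae (Eventually.of_forall fun y => ?_)
      simp only [Submodule.coe_add, Prod.fst_add, Pi.add_apply, add_mul])
    (fun c p q => by
      rw [smul_eq_mul, ← integral_const_mul]
      refine integral_congr_ae (Eventually.of_forall fun y => ?_)
      simp only [Submodule.coe_smul, Prod.smul_fst, Pi.smul_apply, smul_eq_mul, mul_assoc])
    (fun p q q' => by
      rw [← integral_add (p.2.integrable_mul q.2) (p.2.integrable_mul q'.2)]
      refine integral_congr_ae (Eventually.of_forall fun y => ?_)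
      simp only [Submodule.coe_add, Prod.fst_add, Pi.add_apply, mul_add])
    (fun c p q => by
      rw [smul_eq_mul, ← integral_const_mul]
      refine integral_congr_ae (Eventually.of_forall fun y => ?_)
      simp only [Submodule.coe_smul, Prod.smul_fst, Pi.smul_apply, smul_eq_mul]
      ring)

variable {g hU}

lemma energyForm_apply (p q : l2Pairs g hU) :
    energyForm g hU p q = ∫ y in U, g.inner y (p.1.2 y) (q.1.2 y) ∂(vol g) := rfl

lemma massForm_apply (p q : l2Pairs g hU) :
    massForm g hU p q = ∫ y in U, p.1.1 y * q.1.1 y ∂(vol g) := rfl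

lemma massForm_self (p : l2Pairs g hU) :
    massForm g hU p p = ∫ y in U, p.1.1 y ^ 2 ∂(vol g) := by
  simp only [massForm_apply, sq]

lemma energyForm_symm (p q : l2Pairs g hU) : energyForm g hU p q = energyForm g hU q p := by
  simp only [energyForm_apply, g.symm _ (p.1.2 _)]

lemma massForm_symm (p q : l2Pairs g hU) : massForm g hU p q = massForm g hU q p := by
  simp only [massForm_apply, mul_comm]

lemma energyForm_nonneg (p : l2Pairs g hU) : 0 ≤ energyForm g hU p p :=
  integral_nonneg fun y => inner_self_nonneg g y _

lemma massForm_nonneg (p : l2Pairs g hU) : 0 ≤ massForm g hU p p := by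
  rw [massForm_self]; exact integral_nonneg fun y => sq_nonneg _

/-- The space of square integrable pairs is complete. -/
theorem exists_tendsto_of_cauchy (v : ℕ → l2Pairs g hU)
    (hv : ∀ ε > 0, ∃ N, ∀ k ≥ N, ∀ l ≥ N, energyForm g hU (v k - v l) (v k - v l) +
      massForm g hU (v k - v l) (v k - v l) < ε) :
    ∃ u : l2Pairs g hU, Tendsto (fun k => energyForm g hU (v k - u) (v k - u) +
      massForm g hU (v k - u) (v k - u)) atTop (𝓝 0) := by
  -- Riesz–Fischer: along a subsequence the squared norms of the increments are below `(1 / 8) ^ k`,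
  -- so that both the functions and the vector fields converge pointwise almost everywhere.
  obtain ⟨φ, hφ, hφ8⟩ := extraction_forall_of_eventually'
    (P := fun k m => ∀ l ≥ m, energyForm g hU (v m - v l) (v m - v l) +
      massForm g hU (v m - v l) (v m - v l) < (1 / 8) ^ k) (fun k => by
      obtain ⟨N, hN⟩ := hv ((1 / 8) ^ k) (by positivity)
      exact ⟨N, fun m hm l hl => hN m hm l (hm.trans hl)⟩)
  set F : ℕ → M → ℝ := fun k y =>
    g.inner y ((v (φ k) - v (φ (k + 1))).1.2 y) ((v (φ k) - v (φ (k + 1))).1.2 y) +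
      (v (φ k) - v (φ (k + 1))).1.1 y ^ 2 with hF
  have hFi : ∀ k, Integrable (F k) ((vol g).restrict U) := fun k =>
    (v (φ k) - v (φ (k + 1))).2.integrable.add (v (φ k) - v (φ (k + 1))).2.memLp.integrable_sq
  have hF0 : ∀ k y, 0 ≤ F k y := fun k y =>
    add_nonneg (inner_self_nonneg g y _) (sq_nonneg _)
  have hFle : ∀ k, ∫ y in U, F k y ∂(vol g) ≤ (1 / 8) ^ k := by
    intro k
    refine le_trans (le_of_eq ?_) (hφ8 k (φ (k + 1)) (hφ.monotone (Nat.le_succ k))).le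
    rw [massForm_self]
    exact integral_add (v (φ k) - v (φ (k + 1))).2.integrable
      (v (φ k) - v (φ (k + 1))).2.memLp.integrable_sq
  have hgeo := ae_le_geometric_of_integral_le hF0 hFi hFle
  have hulim : ∀ y, ∃ L : ℝ, CauchySeq (fun k => (v (φ k)).1.1 y) →
      Tendsto (fun k => (v (φ k)).1.1 y) atTop (𝓝 L) := by
    intro y
    by_cases h : CauchySeq (fun k => (v (φ k)).1.1 y)
    · obtain ⟨L, hL⟩ := cauchySeq_tendsto_of_complete h
      exact ⟨L, fun _ => hL⟩
    · exact ⟨0, fun h' => absurd h' h⟩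
  have hXlim := fun y => exists_tangent_limit g (fun k => (v (φ k)).1.2 y)
  choose u hu using hulim
  choose X hX using hXlim
  have hae : ∀ᵐ y ∂(vol g).restrict U, Tendsto (fun k => (v (φ k)).1.1 y) atTop (𝓝 (u y)) ∧
      Tendsto (fun k => (v (φ k)).1.2 y) atTop (𝓝 (X y)) := by
    filter_upwards [hgeo] with y hy
    obtain ⟨C, hC, hyC⟩ := hy
    constructor
    · refine hu y (cauchySeq_of_le_geometric (1 / 2) (√C) (by norm_num) fun k => ?_)
      rw [Real.dist_eq]
      refine abs_le_geometric_of_sq_le hC (le_trans ?_ (hyC k))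
      exact le_add_of_nonneg_left (inner_self_nonneg g y _)
    · exact hX y ⟨C, hC, fun k => le_trans (le_add_of_nonneg_right (sq_nonneg _)) (hyC k)⟩
  have hXB : ∀ k, ∀ᵐ y ∂(vol g).restrict U,
      Tendsto (fun l => (v k - v (φ l)).1.1 y ^ 2) atTop (𝓝 (((v k).1.1 y - u y) ^ 2)) ∧
      Tendsto (fun l => g.inner y ((v k - v (φ l)).1.2 y) ((v k - v (φ l)).1.2 y)) atTop
        (𝓝 (g.inner y ((v k).1.2 y - X y) ((v k).1.2 y - X y))) := by
    intro k
    filter_upwards [hae] with y hy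
    exact ⟨(tendsto_const_nhds.sub hy.1).pow 2,
      ((continuous_inner_sub g y ((v k).1.2 y)).tendsto (X y)).comp hy.2⟩
  -- Fatou's lemma applied to the differences with the `k`-th term: the Cauchy bound passes to the
  -- pointwise limit, and the difference is square integrable.
  have hfatou : ∀ k C, (∀ᶠ l in atTop, energyForm g hU (v k - v l) (v k - v l) +
      massForm g hU (v k - v l) (v k - v l) ≤ C) →
      Integrable (fun y => ((v k).1.1 y - u y) ^ 2) ((vol g).restrict U) ∧
      Integrable (fun y => g.inner y ((v k).1.2 y - X y) ((v k).1.2 y - X y))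
        ((vol g).restrict U) ∧
      ∫ y in U, (g.inner y ((v k).1.2 y - X y) ((v k).1.2 y - X y) +
        ((v k).1.1 y - u y) ^ 2) ∂(vol g) ≤ C := by
    intro k C hC
    have hC' := hφ.tendsto_atTop.eventually hC
    refine ⟨(integrable_and_integral_le_of_tendsto (C := C) (fun l y => sq_nonneg _)
      (fun l => (v k - v (φ l)).2.memLp.integrable_sq) ?_ ((hXB k).mono fun y hy => hy.1)).1,
      (integrable_and_integral_le_of_tendsto (C := C) (fun l y => inner_self_nonneg g y _)
      (fun l => (v k - v (φ l)).2.integrable) ?_ ((hXB k).mono fun y hy => hy.2)).1,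
      (integrable_and_integral_le_of_tendsto (C := C)
        (fun l y => add_nonneg (inner_self_nonneg g y _) (sq_nonneg _))
        (fun l => (v k - v (φ l)).2.integrable.add (v k - v (φ l)).2.memLp.integrable_sq) ?_
        ((hXB k).mono fun y hy => hy.2.add hy.1)).2⟩
    · filter_upwards [hC'] with l hl
      rw [← massForm_self]
      exact le_trans (le_add_of_nonneg_left (energyForm_nonneg _)) hl
    · filter_upwards [hC'] with l hl
      exact le_trans (le_add_of_nonneg_right (massForm_nonneg _)) hl
    · filter_upwards [hC'] with l hl
      refine le_trans (le_of_eq ?_) hl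
      rw [massForm_self]
      exact integral_add (v k - v (φ l)).2.integrable (v k - v (φ l)).2.memLp.integrable_sq
  have hum : AEStronglyMeasurable u ((vol g).restrict U) :=
    aestronglyMeasurable_of_tendsto_ae atTop (fun k => (v (φ k)).2.memLp.1)
      (hae.mono fun y hy => hy.1)
  have hXm : ∀ x w, AEStronglyMeasurable (chartPairing g X x w)
      (volume.restrict (chartDomain n x U)) := by
    intro x w
    refine aestronglyMeasurable_of_tendsto_ae atTop (fun k => (v (φ k)).2.2 x w) ?_
    filter_upwards [ae_chartDomain_of_ae g hU hae x] with z hz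
    exact ((continuous_inner_right g _ _).tendsto _).comp hz.2
  obtain ⟨N, hN⟩ := hv 1 one_pos
  obtain ⟨hN1, hN2, -⟩ := hfatou N 1 ((eventually_ge_atTop N).mono fun l hl =>
    (hN N le_rfl l hl).le)
  have hpair : IsL2Pair g U (fun y => (v N).1.1 y - u y) (fun y => (v N).1.2 y - X y) := by
    refine ⟨(memLp_two_iff_integrable_sq ((v N).2.memLp.1.sub hum)).2 hN1, fun x w => ?_, hN2⟩
    refine (((v N).2.2 x w).sub (hXm x w)).congr (Eventually.of_forall fun z => ?_)
    simp only [chartPairing, Pi.sub_apply, map_sub, sub_apply]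
  -- Fatou's lemma shows that the difference of one term and the limit is a square integrable pair.
  -- The limit is written as `v N - d` so as to lie in the space.
  set d : l2Pairs g hU := ⟨(fun y => (v N).1.1 y - u y, fun y => (v N).1.2 y - X y), hpair⟩ with hd
  have hd1 : ∀ y, (v N - d).1.1 y = u y := fun y => sub_sub_cancel _ _
  have hd2 : ∀ y, (v N - d).1.2 y = X y := fun y => sub_sub_cancel _ _
  refine ⟨v N - d, ?_⟩
  rw [Metric.tendsto_atTop]
  intro ε hε
  obtain ⟨N', hN'⟩ := hv (ε / 2) (half_pos hε)
  refine ⟨N', fun k hk => ?_⟩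
  obtain ⟨-, -, h3⟩ := hfatou k (ε / 2) ((eventually_ge_atTop N').mono fun l hl =>
    (hN' k hk l hl).le)
  have h0 := add_nonneg (energyForm_nonneg (v k - (v N - d))) (massForm_nonneg (v k - (v N - d)))
  rw [Real.dist_eq, sub_zero, abs_of_nonneg h0]
  refine lt_of_le_of_lt (le_trans (le_of_eq ?_) h3) (half_lt_self hε)
  rw [massForm_self, energyForm_apply, ← integral_add (v k - (v N - d)).2.integrable
    (v k - (v N - d)).2.memLp.integrable_sq]
  refine integral_congr_ae (Eventually.of_forall fun y => ?_)
  simp only [← hd1, ← hd2]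
  rfl

end

end NeumannDirichlet

/-! ### The Sobolev spaces as subspaces of pairs -/

namespace NeumannDirichlet

section

variable {n : ℕ} [NeZero n] {M : Type*} [TopologicalSpace M]
  [ChartedSpace (EuclideanHalfSpace n) M] [IsManifold (𝓡∂ n) ∞ M]
  [MeasurableSpace M] [BorelSpace M] [CompactSpace M]

variable {g : Metric n M} {U : Set M} {hU : IsOpen U}

variable (hU) in
/-- Integrability and continuity of the pairing of a square integrable pair with a
test function. -/
lemma exists_weak_bound (g : Metric n M) (x : M) (v : EuclideanSpace ℝ (Fin n))
    {ψ : EuclideanSpace ℝ (Fin n) → ℝ} (hψ : ContDiff ℝ ∞ ψ) (hc : HasCompactSupport ψ)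
    (hs : tsupport ψ ⊆ chartDomain n x U) :
    ∃ C : ℝ, 0 < C ∧ ∀ p : l2Pairs g hU,
      Integrable (fun z => p.1.1 ((extChartAt (𝓡∂ n) x).symm z) * fderiv ℝ ψ z v)
        (volume.restrict (chartDomain n x U)) ∧
      Integrable (fun z => chartPairing g p.1.2 x v z * ψ z)
        (volume.restrict (chartDomain n x U)) ∧
      ((∫ z in chartDomain n x U, p.1.1 ((extChartAt (𝓡∂ n) x).symm z) * fderiv ℝ ψ z v) +
        ∫ z in chartDomain n x U, chartPairing g p.1.2 x v z * ψ z) ^ 2 ≤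
        C * (energyForm g hU p p + massForm g hU p p) := by
  set K := tsupport ψ with hK
  have hKc : IsCompact K := hc
  obtain ⟨C, hC0, hC⟩ := exists_coord_bound (g := g) x hKc (hs.trans inter_subset_left) (U := U)
  have hKm : MeasurableSet K := (isClosed_tsupport ψ).measurableSet
  have hd : Continuous (fun z => fderiv ℝ ψ z v) :=
    (hψ.continuous_fderiv (by simp)).clm_apply continuous_const
  have hds : HasCompactSupport (fun z => fderiv ℝ ψ z v) := hc.fderiv_apply ℝ v
  have hd2 : MemLp (fun z => fderiv ℝ ψ z v) 2 (volume.restrict K) :=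
    (hd.memLp_of_hasCompactSupport hds).restrict K
  have hψ2 : MemLp ψ 2 (volume.restrict K) :=
    (hψ.continuous.memLp_of_hasCompactSupport hc).restrict K
  have hd0 : ∀ z, z ∉ K → fderiv ℝ ψ z v = 0 := by
    intro z hz
    rw [fderiv_of_notMem_tsupport ℝ hz, zero_apply]
  have hψ0 : ∀ z, z ∉ K → ψ z = 0 := fun z hz => image_eq_zero_of_notMem_tsupport hz
  set A := ∫ z in K, (fderiv ℝ ψ z v) ^ 2 with hA
  set B := ∫ z in K, ψ z ^ 2 with hB
  have hA0 : 0 ≤ A := integral_nonneg fun _ => sq_nonneg _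
  have hB0 : 0 ≤ B := integral_nonneg fun _ => sq_nonneg _
  refine ⟨2 * C * A + 2 * C * ‖v‖ ^ 2 * B + 1, by positivity, fun p => ?_⟩
  obtain ⟨h1, h2, h3⟩ := hC K (subset_inter subset_rfl hs) hKm _ _ p.2
  obtain ⟨h4, h5⟩ := h3 v
  have hi1 : IntegrableOn (fun z => p.1.1 ((extChartAt (𝓡∂ n) x).symm z) * fderiv ℝ ψ z v) K :=
    h1.integrable_mul hd2
  have hi2 : IntegrableOn (fun z => chartPairing g p.1.2 x v z * ψ z) K := h4.integrable_mul hψ2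
  have hg1 : ∀ z, z ∉ K → p.1.1 ((extChartAt (𝓡∂ n) x).symm z) * fderiv ℝ ψ z v = 0 :=
    fun z hz => by rw [hd0 z hz, mul_zero]
  have hg2 : ∀ z, z ∉ K → chartPairing g p.1.2 x v z * ψ z = 0 :=
    fun z hz => by rw [hψ0 z hz, mul_zero]
  refine ⟨(hi1.integrable_of_forall_notMem_eq_zero hg1).integrableOn,
    (hi2.integrable_of_forall_notMem_eq_zero hg2).integrableOn, ?_⟩
  rw [setIntegral_eq_of_subset_of_forall_sdiff_eq_zero
      (isOpen_chartDomain x hU).measurableSet hs (fun z hz => hg1 z hz.2),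
    setIntegral_eq_of_subset_of_forall_sdiff_eq_zero
      (isOpen_chartDomain x hU).measurableSet hs (fun z hz => hg2 z hz.2)]
  have e1 := (sq_integral_mul_le h1 hd2).trans (mul_le_mul_of_nonneg_right h2 hA0)
  have e2 := (sq_integral_mul_le h4 hψ2).trans (mul_le_mul_of_nonneg_right h5 hB0)
  have hE := energyForm_nonneg p
  have hM := massForm_nonneg p
  rw [massForm_self] at hM ⊢
  rw [energyForm_apply] at hE ⊢
  set I := ∫ z in K, p.1.1 ((extChartAt (𝓡∂ n) x).symm z) * fderiv ℝ ψ z v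
  set J := ∫ z in K, chartPairing g p.1.2 x v z * ψ z
  set E := ∫ y in U, g.inner y (p.1.2 y) (p.1.2 y) ∂(vol g)
  set Q := ∫ y in U, p.1.1 y ^ 2 ∂(vol g)
  have e3 : (I + J) ^ 2 ≤ 2 * I ^ 2 + 2 * J ^ 2 := by nlinarith [sq_nonneg (I - J)]
  have q1 : 0 ≤ C * A * E := by positivity
  have q2 : 0 ≤ C * ‖v‖ ^ 2 * B * Q := by positivity
  nlinarith

/-- The difference of the two sides in the definition of the weak gradient. -/
noncomputable def weakFunctional (g : Metric n M) (hU : IsOpen U) (x : M)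
    (v : EuclideanSpace ℝ (Fin n)) {ψ : EuclideanSpace ℝ (Fin n) → ℝ} (hψ : ContDiff ℝ ∞ ψ)
    (hc : HasCompactSupport ψ) (hs : tsupport ψ ⊆ chartDomain n x U) :
    l2Pairs g hU →ₗ[ℝ] ℝ where
  toFun p := (∫ z in chartDomain n x U, p.1.1 ((extChartAt (𝓡∂ n) x).symm z) * fderiv ℝ ψ z v) +
    ∫ z in chartDomain n x U, chartPairing g p.1.2 x v z * ψ z
  map_add' p q := by
    obtain ⟨C, -, hC⟩ := exists_weak_bound hU g x v hψ hc hs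
    have h1 := integral_add (hC p).1 (hC q).1
    have h2 := integral_add (hC p).2.1 (hC q).2.1
    simp only [Submodule.coe_add, Prod.fst_add, Prod.snd_add, Pi.add_apply, chartPairing_add,
      add_mul]
    rw [h1, h2]; ring
  map_smul' c p := by
    simp only [Submodule.coe_smul, Prod.smul_fst, Prod.smul_snd, Pi.smul_apply, chartPairing_smul,
      smul_eq_mul, mul_assoc, integral_const_mul, RingHom.id_apply]
    ring

lemma isWeakGradient_iff (p : l2Pairs g hU) :
    IsWeakGradient g U p.1.1 p.1.2 ↔ ∀ (x : M) (v : EuclideanSpace ℝ (Fin n))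
      (ψ : EuclideanSpace ℝ (Fin n) → ℝ) (hψ : ContDiff ℝ ∞ ψ) (hc : HasCompactSupport ψ)
      (hs : tsupport ψ ⊆ chartDomain n x U), weakFunctional g hU x v hψ hc hs p = 0 := by
  simp only [IsWeakGradient, weakFunctional, LinearMap.coe_mk, AddHom.coe_mk,
    eq_neg_iff_add_eq_zero]

/-- The space of pairs of a function of `H¹(U)` and its weak gradient. -/
noncomputable def h1 (g : Metric n M) (hU : IsOpen U) : Submodule ℝ (l2Pairs g hU) where
  carrier := {p | IsWeakGradient g U p.1.1 p.1.2}
  add_mem' := by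
    intro p q hp hq
    simp only [mem_ofPred_eq, isWeakGradient_iff] at *
    intro x v ψ hψ hc hs
    rw [map_add, hp, hq, add_zero]
  zero_mem' := by
    simp only [mem_ofPred_eq, isWeakGradient_iff, map_zero, implies_true]
  smul_mem' := by
    intro c p hp
    simp only [mem_ofPred_eq, isWeakGradient_iff] at *
    intro x v ψ hψ hc hs
    rw [map_smul, hp, smul_zero]

lemma mem_h1_iff {p : l2Pairs g hU} : p ∈ h1 g hU ↔ IsH1 g U p.1.1 p.1.2 :=
  ⟨fun h => ⟨p.2.1, p.2.2, p.2.3, h⟩, fun h => h.weak⟩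

/-- For each test function the defect in the weak gradient equation is a linear functional bounded
in the norm of `H¹`. It vanishes along the sequence, hence at the limit. -/
lemma mem_h1_of_tendsto {v : ℕ → l2Pairs g hU} (hv : ∀ k, v k ∈ h1 g hU) {u : l2Pairs g hU}
    (h : Tendsto (fun k => energyForm g hU (v k - u) (v k - u) +
      massForm g hU (v k - u) (v k - u)) atTop (𝓝 0)) : u ∈ h1 g hU := by
  show IsWeakGradient g U u.1.1 u.1.2
  rw [isWeakGradient_iff]
  intro x w ψ hψ hc hs
  obtain ⟨C, hC0, hC⟩ := exists_weak_bound hU g x w hψ hc hs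
  have h1 : ∀ k, weakFunctional g hU x w hψ hc hs u ^ 2 ≤
      C * (energyForm g hU (v k - u) (v k - u) + massForm g hU (v k - u) (v k - u)) := by
    intro k
    have h2 := (hC (v k - u)).2.2
    have h3 : weakFunctional g hU x w hψ hc hs (v k - u) = - weakFunctional g hU x w hψ hc hs u := by
      rw [map_sub, (isWeakGradient_iff (v k)).1 (hv k), zero_sub]
    have h4 : weakFunctional g hU x w hψ hc hs (v k - u) ^ 2 ≤ _ := h2
    rwa [h3, neg_sq] at h4
  have h2 := ge_of_tendsto' (h.const_mul C) h1
  rw [mul_zero] at h2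
  exact pow_eq_zero_iff two_ne_zero |>.1 (le_antisymm h2 (sq_nonneg _))

/-- The space of smooth functions with compact support in `U \ ∂M`, with their gradients. -/
noncomputable def testPairs (g : Metric n M) (hU : IsOpen U) : Submodule ℝ (l2Pairs g hU) where
  carrier := {p | p ∈ h1 g hU ∧ ContMDiff (𝓡∂ n) 𝓘(ℝ, ℝ) ∞ p.1.1 ∧ HasCompactSupport p.1.1 ∧
    tsupport p.1.1 ⊆ U ∩ (𝓡∂ n).interior M}
  add_mem' := by
    rintro p q ⟨hp1, hp2, hp3, hp4⟩ ⟨hq1, hq2, hq3, hq4⟩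
    exact ⟨add_mem hp1 hq1, hp2.add hq2, hp3.add hq3,
      (tsupport_add p.1.1 q.1.1).trans (union_subset hp4 hq4)⟩
  zero_mem' := by
    refine ⟨zero_mem _, contMDiff_const, HasCompactSupport.zero, ?_⟩
    show tsupport (0 : M → ℝ) ⊆ _
    simp [tsupport]
  smul_mem' := by
    rintro c p ⟨hp1, hp2, hp3, hp4⟩
    refine ⟨Submodule.smul_mem _ c hp1, (contDiff_const.mul contDiff_id).comp_contMDiff hp2, ?_, ?_⟩
    · exact hp3.smul_left (f := fun _ => c)
    · exact (closure_mono (Function.support_const_smul_subset c p.1.1)).trans hp4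

/-- The space of pairs of a function of `H¹₀(U)` and its weak gradient. -/
noncomputable def h10 (g : Metric n M) (hU : IsOpen U) : Submodule ℝ (l2Pairs g hU) where
  carrier := {p | p ∈ h1 g hU ∧ ∀ ε > 0, ∃ t ∈ testPairs g hU,
    (energyForm g hU + massForm g hU) (p - t) (p - t) < ε}
  add_mem' := by
    rintro p q ⟨hp1, hp⟩ ⟨hq1, hq⟩
    refine ⟨add_mem hp1 hq1, fun ε hε => ?_⟩
    obtain ⟨s, hs, hs'⟩ := hp (ε / 4) (by positivity)
    obtain ⟨t, ht, ht'⟩ := hq (ε / 4) (by positivity)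
    refine ⟨s + t, add_mem hs ht, ?_⟩
    have h := form_add_le (b := energyForm g hU + massForm g hU)
      (fun u v => by simp only [LinearMap.add_apply, energyForm_symm u v, massForm_symm u v])
      (fun u => add_nonneg (energyForm_nonneg u) (massForm_nonneg u)) (p - s) (q - t)
    rw [add_sub_add_comm]
    linarith
  zero_mem' := ⟨zero_mem _, fun ε hε => ⟨0, zero_mem _, by
    rw [sub_zero, map_zero]; exact hε⟩⟩
  smul_mem' := by
    rintro c p ⟨hp1, hp⟩
    refine ⟨Submodule.smul_mem _ c hp1, fun ε hε => ?_⟩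
    obtain ⟨t, ht, ht'⟩ := hp (ε / (c ^ 2 + 1)) (by positivity)
    refine ⟨c • t, Submodule.smul_mem _ c ht, ?_⟩
    rw [← smul_sub, map_smul, map_smul, LinearMap.smul_apply, smul_eq_mul, smul_eq_mul, ← mul_assoc,
      ← sq]
    rw [lt_div_iff₀ (by positivity)] at ht'
    have := add_nonneg (energyForm_nonneg (p - t)) (massForm_nonneg (p - t))
    change 0 ≤ (energyForm g hU + massForm g hU) (p - t) (p - t) at this
    linarith

lemma mem_h10_iff {p : l2Pairs g hU} : p ∈ h10 g hU ↔ IsH10 g U p.1.1 p.1.2 := by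
  have key : ∀ t : l2Pairs g hU, (energyForm g hU + massForm g hU) (p - t) (p - t) =
      ∫ y in U, (p.1.1 y - t.1.1 y) ^ 2 ∂(vol g) +
        ∫ y in U, g.inner y (p.1.2 y - t.1.2 y) (p.1.2 y - t.1.2 y) ∂(vol g) := by
    intro t
    show energyForm g hU (p - t) (p - t) + massForm g hU (p - t) (p - t) = _
    rw [add_comm, massForm_self, energyForm_apply]
    rfl
  constructor
  · rintro ⟨h1, h2⟩
    refine ⟨mem_h1_iff.1 h1, fun ε hε => ?_⟩
    obtain ⟨t, ht, ht'⟩ := h2 ε hε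
    rw [key] at ht'
    exact ⟨t.1.1, t.1.2, ht.2.1, ht.2.2.1, ht.2.2.2, mem_h1_iff.1 ht.1, ht'⟩
  · rintro ⟨h1, h2⟩
    refine ⟨mem_h1_iff.2 h1, fun ε hε => ?_⟩
    obtain ⟨ψ, Y, q1, q2, q3, q4, q5⟩ := h2 ε hε
    refine ⟨⟨(ψ, Y), q4.isL2Pair⟩, ⟨mem_h1_iff.2 q4, q1, q2, q3⟩, ?_⟩
    rw [key]
    exact q5

lemma h10_le_h1 : h10 g hU ≤ h1 g hU := fun _ h => h.1

lemma testPairs_le_h10 : testPairs g hU ≤ h10 g hU := fun p hp =>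
  ⟨hp.1, fun ε hε => ⟨p, hp, by rw [sub_self, map_zero]; exact hε⟩⟩

lemma mem_h10_of_tendsto {v : ℕ → l2Pairs g hU} (hv : ∀ k, v k ∈ h10 g hU) {u : l2Pairs g hU}
    (h : Tendsto (fun k => energyForm g hU (v k - u) (v k - u) +
      massForm g hU (v k - u) (v k - u)) atTop (𝓝 0)) : u ∈ h10 g hU := by
  refine ⟨mem_h1_of_tendsto (fun k => (hv k).1) h, fun ε hε => ?_⟩
  obtain ⟨k, hk⟩ := (h.eventually_lt_const (show 0 < ε / 4 by positivity)).exists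
  obtain ⟨t, ht, ht'⟩ := (hv k).2 (ε / 4) (by positivity)
  refine ⟨t, ht, ?_⟩
  have h := form_add_le (b := energyForm g hU + massForm g hU)
    (fun u v => by simp only [LinearMap.add_apply, energyForm_symm u v, massForm_symm u v])
    (fun u => add_nonneg (energyForm_nonneg u) (massForm_nonneg u)) (-(v k - u)) (v k - t)
  have h1 : -(v k - u) + (v k - t) = u - t := by abel
  have h2 : (energyForm g hU + massForm g hU) (-(v k - u)) (-(v k - u)) =
    energyForm g hU (v k - u) (v k - u) + massForm g hU (v k - u) (v k - u) := by
    rw [map_neg, map_neg, LinearMap.neg_apply, neg_neg]; rfl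
  rw [h1, h2] at h
  linarith

end

end NeumannDirichlet

/-- Successive extraction of subsequences. -/
lemma exists_subseq_cauchy_finset {ι : Type*} (s : Finset ι) {d : ι → ℕ → ℕ → ℝ}
    (h : ∀ i ∈ s, ∀ ψ : ℕ → ℕ, StrictMono ψ → ∃ φ : ℕ → ℕ, StrictMono φ ∧
      ∀ ε > 0, ∃ N, ∀ k ≥ N, ∀ l ≥ N, d i (ψ (φ k)) (ψ (φ l)) < ε) :
    ∃ φ : ℕ → ℕ, StrictMono φ ∧
      ∀ ε > 0, ∃ N, ∀ k ≥ N, ∀ l ≥ N, ∀ i ∈ s, d i (φ k) (φ l) < ε := by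
  classical
  induction s using Finset.induction_on with
  | empty => exact ⟨id, strictMono_id, fun ε _ => ⟨0, fun k _ l _ i hi => absurd hi (by simp)⟩⟩
  | insert i s his ih =>
    obtain ⟨ψ, hψ, hψ'⟩ := ih fun j hj => h j (Finset.mem_insert_of_mem hj)
    obtain ⟨φ, hφ, hφ'⟩ := h i (Finset.mem_insert_self i s) ψ hψ
    refine ⟨ψ ∘ φ, hψ.comp hφ, fun ε hε => ?_⟩
    obtain ⟨N, hN⟩ := hψ' ε hε
    obtain ⟨N', hN'⟩ := hφ' ε hε
    refine ⟨max N N', fun k hk l hl j hj => ?_⟩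
    rcases Finset.mem_insert.1 hj with rfl | hj
    · exact hN' k ((le_max_right _ _).trans hk) l ((le_max_right _ _).trans hl)
    · exact hN _ (((le_max_left _ _).trans hk).trans (hφ.id_le k)) _
        (((le_max_left _ _).trans hl).trans (hφ.id_le l)) j hj

/-! ### Rellich's theorem and Lipschitz partitions -/

namespace NeumannDirichlet

section

variable {n : ℕ} [NeZero n] {M : Type*} [TopologicalSpace M]
  [ChartedSpace (EuclideanHalfSpace n) M] [IsManifold (𝓡∂ n) ∞ M]
  [MeasurableSpace M] [BorelSpace M] [CompactSpace M]

variable {g : Metric n M} {U : Set M} {hU : IsOpen U}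

/-- Bounded sequences of `H¹(U)` have subsequences that converge in `L²(U ∩ S)`. -/
def RellichOn (g : Metric n M) (hU : IsOpen U) (S : Set M) : Prop :=
  ∀ v : ℕ → l2Pairs g hU, (∀ k, v k ∈ h1 g hU) →
    (∃ C : ℝ, ∀ k, energyForm g hU (v k) (v k) + massForm g hU (v k) (v k) ≤ C) →
    ∃ φ : ℕ → ℕ, StrictMono φ ∧ ∀ ε > 0, ∃ N, ∀ k ≥ N, ∀ l ≥ N,
      ∫ y in U ∩ S, (v (φ k) - v (φ l)).1.1 y ^ 2 ∂(vol g) < ε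

lemma integrableOn_sq (p : l2Pairs g hU) {A : Set M} (hA : A ⊆ U) :
    IntegrableOn (fun y => p.1.1 y ^ 2) A (vol g) :=
  IntegrableOn.mono_set (s := A) (t := U) p.2.memLp.integrable_sq hA

lemma RellichOn.mono {S T : Set M} (h : RellichOn g hU T) (hST : S ⊆ T) : RellichOn g hU S := by
  intro v hv hC
  obtain ⟨φ, hφ, h'⟩ := h v hv hC
  refine ⟨φ, hφ, fun ε hε => ?_⟩
  obtain ⟨N, hN⟩ := h' ε hε
  refine ⟨N, fun k hk l hl => lt_of_le_of_lt ?_ (hN k hk l hl)⟩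
  exact setIntegral_mono_set (integrableOn_sq _ inter_subset_left)
    (Eventually.of_forall fun y => sq_nonneg _)
    (Eventually.of_forall (inter_subset_inter_right U hST))

lemma RellichOn.union {S T : Set M} (hS : RellichOn g hU S) (hT : RellichOn g hU T) :
    RellichOn g hU (S ∪ T) := by
  intro v hv hC
  obtain ⟨φ, hφ, h⟩ := exists_subseq_cauchy_finset (Finset.univ : Finset Bool)
    (d := fun i k l => ∫ y in U ∩ (if i then S else T), (v k - v l).1.1 y ^ 2 ∂(vol g)) (by
      intro i _ ψ hψ
      have hC' : ∃ C : ℝ, ∀ k, energyForm g hU (v (ψ k)) (v (ψ k)) +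
          massForm g hU (v (ψ k)) (v (ψ k)) ≤ C := hC.imp fun C hC k => hC _
      cases i
      · exact hT (fun k => v (ψ k)) (fun k => hv _) hC'
      · exact hS (fun k => v (ψ k)) (fun k => hv _) hC')
  refine ⟨φ, hφ, fun ε hε => ?_⟩
  obtain ⟨N, hN⟩ := h (ε / 2) (half_pos hε)
  refine ⟨N, fun k hk l hl => ?_⟩
  have h1 := hN k hk l hl true (Finset.mem_univ _)
  have h2 := hN k hk l hl false (Finset.mem_univ _)
  simp only [if_true, Bool.false_eq_true, if_false] at h1 h2
  have hle : (vol g).restrict (U ∩ (S ∪ T)) ≤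
      (vol g).restrict (U ∩ S) + (vol g).restrict (U ∩ T) := by
    rw [inter_union_distrib_left]; exact Measure.restrict_union_le _ _
  have hi1 := integrableOn_sq (v (φ k) - v (φ l)) (inter_subset_left (s := U) (t := S))
  have hi2 := integrableOn_sq (v (φ k) - v (φ l)) (inter_subset_left (s := U) (t := T))
  refine lt_of_le_of_lt (integral_mono_measure hle (Eventually.of_forall fun y => sq_nonneg _)
    (Integrable.add_measure hi1 hi2)) ?_
  rw [integral_add_measure hi1 hi2]
  linarith

lemma setIntegral_chartDomain_eq {x : M} {D : Set (EuclideanSpace ℝ (Fin n))}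
    {ψ : EuclideanSpace ℝ (Fin n) → ℝ} (hs : tsupport ψ ⊆ D)
    {V : Set M} (hV : IsOpen V) (hDV : D ⊆ chartDomain n x V)
    (u : M → ℝ) (X : ∀ y : M, TangentSpace (𝓡∂ n) y) (v : EuclideanSpace ℝ (Fin n)) :
    (∫ z in chartDomain n x V, u ((extChartAt (𝓡∂ n) x).symm z) * fderiv ℝ ψ z v =
      ∫ z in D, u ((extChartAt (𝓡∂ n) x).symm z) * fderiv ℝ ψ z v) ∧
    ∫ z in chartDomain n x V, chartPairing g X x v z * ψ z =
      ∫ z in D, chartPairing g X x v z * ψ z := by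
  constructor
  · refine setIntegral_eq_of_subset_of_forall_sdiff_eq_zero
      (isOpen_chartDomain x hV).measurableSet hDV fun z hz => ?_
    rw [fderiv_of_notMem_tsupport ℝ fun h => hz.2 (hs h), zero_apply, mul_zero]
  · refine setIntegral_eq_of_subset_of_forall_sdiff_eq_zero
      (isOpen_chartDomain x hV).measurableSet hDV fun z hz => ?_
    rw [image_eq_zero_of_notMem_tsupport fun h => hz.2 (hs h), mul_zero]

/-- Near `p` the Lebesgue measure and the volume bound each other. This turns an `H¹` bound into
bounds for the coordinate expressions, to which the local compactness for the cone condition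
applies, and carries the convergence back. -/
lemma RellichOn.exists_coordBall (hU : IsOpen U) (hlip : HasLipschitzBoundary n U) {p : M}
    (hp : p ∈ closure (U ∩ (𝓡∂ n).interior M)) :
    ∃ r > 0, RellichOn g hU (coordBall n p r) := by
  obtain ⟨ζ₀, r, η, ρ, hr, hη, hρ, hcone⟩ := hlip.exists_hasConeAt hU hp
  obtain ⟨R, hR, hKt, hK⟩ := exists_closedBall_inter_range_subset (n := n) p
  set z₀ := extChartAt (𝓡∂ n) p p with hz₀
  set D := chartDomain n p U with hD
  have hDo : IsOpen D := isOpen_chartDomain p hU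
  obtain ⟨c, hc0, hc⟩ := exists_map_restrict_le g p hK hKt
  obtain ⟨C₁, hC₁0, hC₁⟩ := exists_coord_bound (g := g) p hK hKt (U := U)
  obtain ⟨r', hr', hr'R, hsub⟩ :=
    exists_subseq_cauchy_of_cone volume hDo hr hη hρ hR hcone
  have hsubK : D ∩ Metric.ball z₀ R ⊆ Metric.closedBall z₀ R ∩ range (𝓡∂ n) := fun z hz =>
    ⟨Metric.ball_subset_closedBall hz.2, extChartAt_target_subset_range p hz.1.1⟩
  have hbig : MeasurableSet (D ∩ Metric.ball z₀ R) :=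
    (hDo.inter Metric.isOpen_ball).measurableSet
  refine ⟨r', hr', fun v hv ⟨C, hC⟩ => ?_⟩
  have hloc := fun k => hC₁ _ (subset_inter hsubK inter_subset_left) hbig _ _ (v k).2
  have hE : ∀ k, energyForm g hU (v k) (v k) ≤ C := fun k =>
    (le_add_of_nonneg_right (massForm_nonneg _)).trans (hC k)
  have hQ : ∀ k, massForm g hU (v k) (v k) ≤ C := fun k =>
    (le_add_of_nonneg_left (energyForm_nonneg _)).trans (hC k)
  obtain ⟨φ, hφ, hφ'⟩ := hsub (fun k z => (v k).1.1 ((extChartAt (𝓡∂ n) p).symm z))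
    (fun k w => chartPairing g (v k).1.2 p w) (C₁ * C) (fun k => (hloc k).1)
    (fun k => (hloc k).2.1.trans (mul_le_mul_of_nonneg_left
      ((massForm_self (v k)).symm.trans_le (hQ k)) hC₁0.le))
    (fun k w => ((hloc k).2.2 w).1)
    (fun k w => ((hloc k).2.2 w).2.trans (by
      rw [mul_right_comm]
      exact mul_le_mul_of_nonneg_right (mul_le_mul_of_nonneg_left (hE k) hC₁0.le)
        (sq_nonneg _)))
    (fun k w ψ hψ hψc hψs => by
      obtain ⟨q1, q2⟩ := setIntegral_chartDomain_eq (g := g) hψs hU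
        inter_subset_left (v k).1.1 (v k).1.2 w
      rw [← q1, ← q2]
      exact hv k p w ψ hψ hψc (hψs.trans inter_subset_left))
  refine ⟨φ, hφ, fun ε hε => ?_⟩
  have hc0' : (0 : ℝ) < c := hc0
  obtain ⟨N, hN⟩ := hφ' (ε / c) (by positivity)
  refine ⟨N, fun k hk l hl => ?_⟩
  have h := hN k hk l hl
  rw [lt_div_iff₀ hc0', mul_comm] at h
  refine lt_of_le_of_lt ?_ h
  set S := D ∩ Metric.ball z₀ r' with hS
  have hSm : MeasurableSet S := (hDo.inter Metric.isOpen_ball).measurableSet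
  have hSb : S ⊆ D ∩ Metric.ball z₀ R :=
    inter_subset_inter_right _ (Metric.ball_subset_ball hr'R.le)
  have hSU : (extChartAt (𝓡∂ n) p).symm '' S ⊆ U := by
    rintro _ ⟨z, hz, rfl⟩; exact hz.1.2.1
  have h2 := (hc S (hSb.trans hsubK) hSm).2
  have hae : AEMeasurable (extChartAt (𝓡∂ n) p).symm (volume.restrict S) :=
    (aemeasurable_symm p).mono_measure (Measure.restrict_mono (fun z hz => hz.1.1) le_rfl)
  have hmem := (hC₁ S (subset_inter (hSb.trans hsubK) (fun z hz => hz.1)) hSm _ _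
    (v (φ k) - v (φ l)).2).1
  set F : M → ℝ := fun y => (v (φ k) - v (φ l)).1.1 y ^ 2 with hF
  have hFm : AEStronglyMeasurable F ((volume.restrict S).map (extChartAt (𝓡∂ n) p).symm) := by
    have h3 := (integrableOn_sq (v (φ k) - v (φ l)) hSU).1
    refine AEStronglyMeasurable.mono_ac ?_ h3
    exact (Measure.absolutelyContinuous_of_le (hc S (hSb.trans hsubK) hSm).1).trans
      Measure.smul_absolutelyContinuous
  have hFi : Integrable F ((volume.restrict S).map (extChartAt (𝓡∂ n) p).symm) :=
    (integrable_map_measure hFm hae).2 hmem.integrable_sq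
  calc ∫ y in U ∩ coordBall n p r', F y ∂(vol g)
      ≤ ∫ y in (extChartAt (𝓡∂ n) p).symm '' S, F y ∂(vol g) := by
        refine setIntegral_mono_set (integrableOn_sq _ hSU)
          (Eventually.of_forall fun y => sq_nonneg _) ?_
        filter_upwards [measure_eq_zero_iff_ae_notMem.1 (vol_boundary g)] with y hy hyU
        have hyi : y ∈ (𝓡∂ n).interior M := by
          rw [← ModelWithCorners.compl_boundary]; exact hy
        rw [coordBall_eq_image] at hyU
        obtain ⟨hyU, z, hz, rfl⟩ := hyU
        exact ⟨z, ⟨⟨hz.1, hyU, hyi⟩, hz.2⟩, rfl⟩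
    _ ≤ ∫ y, F y ∂(c • (volume.restrict S).map (extChartAt (𝓡∂ n) p).symm) :=
        integral_mono_measure h2 (Eventually.of_forall fun y => sq_nonneg _)
          hFi.smul_measure_nnreal
    _ = c * ∫ z in S, F ((extChartAt (𝓡∂ n) p).symm z) := by
        rw [integral_smul_nnreal_measure, integral_map hae hFm]; rfl

/-- Rellich's theorem for open sets with Lipschitz boundary. -/
theorem HasLipschitzBoundary.exists_subseq_cauchy (hlip : HasLipschitzBoundary n U)
    (v : ℕ → l2Pairs g hU) (hv : ∀ k, v k ∈ h1 g hU)
    (hC : ∃ C : ℝ, ∀ k, energyForm g hU (v k) (v k) + massForm g hU (v k) (v k) ≤ C) :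
    ∃ φ : ℕ → ℕ, StrictMono φ ∧ ∀ ε > 0, ∃ N, ∀ k ≥ N, ∀ l ≥ N,
      massForm g hU (v (φ k) - v (φ l)) (v (φ k) - v (φ l)) < ε := by
  have h : RellichOn g hU (closure (U ∩ (𝓡∂ n).interior M)) := by
    -- The closure of `U \ ∂M` is compact, so finitely many coordinate balls suffice. It contains
    -- almost all of `U`, because `∂M` is null.
    refine isClosed_closure.isCompact.induction_on (p := RellichOn g hU) ?_
      (fun s t hst ht => ht.mono hst) (fun s t hs ht => hs.union ht) ?_
    · exact fun v hv hC => ⟨id, strictMono_id, fun ε hε => ⟨0, fun k _ l _ => by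
        rw [inter_empty, setIntegral_empty]; exact hε⟩⟩
    · intro p hp
      obtain ⟨r, hr, h⟩ := RellichOn.exists_coordBall (g := g) hU hlip hp
      exact ⟨_, mem_nhdsWithin_of_mem_nhds
        ((isOpen_coordBall p r).mem_nhds (mem_coordBall p hr)), h⟩
  obtain ⟨φ, hφ, h⟩ := h v hv hC
  refine ⟨φ, hφ, fun ε hε => ?_⟩
  obtain ⟨N, hN⟩ := h ε hε
  refine ⟨N, fun k hk l hl => lt_of_le_of_lt ?_ (hN k hk l hl)⟩
  rw [massForm_self]
  refine setIntegral_mono_set (integrableOn_sq _ inter_subset_left)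
    (Eventually.of_forall fun y => sq_nonneg _) ?_
  filter_upwards [measure_eq_zero_iff_ae_notMem.1 (vol_boundary g)] with y hy hyU
  refine ⟨hyU, subset_closure ⟨hyU, ?_⟩⟩
  rw [← ModelWithCorners.compl_boundary]; exact hy

/-- Restriction of square integrable pairs to a smaller open set. -/
noncomputable def restrictPairs (g : Metric n M) {V : Set M} (hU : IsOpen U) (hV : IsOpen V)
    (h : V ⊆ U) : l2Pairs g hU →ₗ[ℝ] l2Pairs g hV where
  toFun p := ⟨p.1, p.2.memLp.mono_measure (Measure.restrict_mono h le_rfl),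
    fun x v => (p.2.2 x v).mono_measure (Measure.restrict_mono (chartDomain_mono x h) le_rfl),
    p.2.integrable.mono_measure (Measure.restrict_mono h le_rfl)⟩
  map_add' _ _ := rfl
  map_smul' _ _ := rfl

lemma restrictPairs_mem_h1 {V : Set M} {hV : IsOpen V} (h : V ⊆ U) {p : l2Pairs g hU}
    (hp : p ∈ h1 g hU) : restrictPairs g hU hV h p ∈ h1 g hV := by
  intro x v ψ hψ hc hs
  have hsub := chartDomain_mono (n := n) x h
  obtain ⟨q1, q2⟩ := setIntegral_chartDomain_eq (g := g) hs hU hsub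
    p.1.1 p.1.2 v
  show ∫ z in chartDomain n x V, p.1.1 _ * _ = -∫ z in chartDomain n x V, chartPairing g p.1.2 x v z * _
  rw [← q1, ← q2]
  exact hp x v ψ hψ hc (hs.trans hsub)

lemma energyForm_restrictPairs_le {V : Set M} (hV : IsOpen V) (h : V ⊆ U) (p : l2Pairs g hU) :
    energyForm g hV (restrictPairs g hU hV h p) (restrictPairs g hU hV h p) ≤
      energyForm g hU p p :=
  setIntegral_mono_set p.2.integrable (Eventually.of_forall fun y => inner_self_nonneg g y _)
    (Eventually.of_forall h)

lemma massForm_restrictPairs_le {V : Set M} (hV : IsOpen V) (h : V ⊆ U) (p : l2Pairs g hU) :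
    massForm g hV (restrictPairs g hU hV h p) (restrictPairs g hU hV h p) ≤ massForm g hU p p := by
  rw [massForm_self, massForm_self]
  exact setIntegral_mono_set p.2.memLp.integrable_sq (Eventually.of_forall fun y => sq_nonneg _)
    (Eventually.of_forall h)

/-- In the interior of the manifold, `closure U` agrees with the closure of `U \ ∂M`. The cone
condition makes its difference with `U` null in coordinates, and the boundary of the manifold is
null anyway. -/
lemma vol_closure_diff_eq_zero (g : Metric n M) (hU : IsOpen U) (hlip : HasLipschitzBoundary n U) :
    vol g (closure U \ U) = 0 := by
  have h1 : vol g ((closure U \ U) ∩ (𝓡∂ n).interior M) = 0 := by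
    refine vol_eq_zero_of_chart g ((isClosed_closure.measurableSet.diff hU.measurableSet).inter
      isOpen_interior_manifold.measurableSet) fun p hp => ?_
    have hcl : ∀ y ∈ (closure U \ U) ∩ (𝓡∂ n).interior M,
        y ∈ closure (U ∩ (𝓡∂ n).interior M) := by
      intro y hy
      rw [inter_comm U]
      exact isOpen_interior_manifold.inter_closure ⟨hy.2, hy.1.1⟩
    obtain ⟨ζ₀, hcone⟩ := hlip.exists_hasConeAt hU (hcl p hp)
    obtain ⟨r, hr, h0⟩ := hcone.exists_ball_frontier_null volume (isOpen_chartDomain p hU)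
    refine ⟨r, hr, measure_mono_null (inter_subset_inter_left _ ?_) h0⟩
    rintro z ⟨hz, hzA⟩
    refine ⟨?_, fun h => hzA.1.2 h.2.1⟩
    have h2 : (extChartAt (𝓡∂ n) p).symm z ∈ (extChartAt (𝓡∂ n) p).source :=
      (extChartAt (𝓡∂ n) p).map_target hz
    have h3 : (extChartAt (𝓡∂ n) p).symm z ∈
        closure ((extChartAt (𝓡∂ n) p).source ∩ (U ∩ (𝓡∂ n).interior M)) :=
      (isOpen_extChartAt_source p).inter_closure ⟨h2, hcl _ hzA⟩
    have h4 : ContinuousWithinAt (extChartAt (𝓡∂ n) p)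
        ((extChartAt (𝓡∂ n) p).source ∩ (U ∩ (𝓡∂ n).interior M))
        ((extChartAt (𝓡∂ n) p).symm z) :=
      (continuousAt_extChartAt' h2).continuousWithinAt
    have h5 := h4.mem_closure h3 (t := chartDomain n p U) (by
      intro y hy
      refine ⟨(extChartAt (𝓡∂ n) p).map_source hy.1, ?_⟩
      rw [mem_preimage, (extChartAt (𝓡∂ n) p).left_inv hy.1]
      exact hy.2)
    rwa [(extChartAt (𝓡∂ n) p).right_inv hz] at h5
  refine measure_mono_null (t := ((closure U \ U) ∩ (𝓡∂ n).interior M) ∪ (𝓡∂ n).boundary M) ?_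
    (measure_union_null h1 (vol_boundary g))
  intro y hy
  by_cases hb : y ∈ (𝓡∂ n).boundary M
  · exact Or.inr hb
  · left
    refine ⟨hy, ?_⟩
    rw [← ModelWithCorners.compl_boundary]; exact hb

/-- Integrals over `M` are sums of integrals over the pieces of a Lipschitz partition. -/
lemma integral_eq_sum_of_partition {ι : Type*} [Fintype ι] {U : ι → Set M}
    (hopen : ∀ i, IsOpen (U i)) (hlip : ∀ i, HasLipschitzBoundary n (U i))
    (hdisj : Pairwise fun i j => Disjoint (U i) (U j)) (hcover : ⋃ i, closure (U i) = univ)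
    {F : M → ℝ} (hF : IntegrableOn F univ (vol g)) :
    ∫ y in univ, F y ∂(vol g) = ∑ i, ∫ y in U i, F y ∂(vol g) := by
  have hnull : vol g (⋃ i, U i)ᶜ = 0 := by
    refine measure_mono_null (t := ⋃ i, closure (U i) \ U i) ?_
      (measure_iUnion_null fun i => vol_closure_diff_eq_zero g (hopen i) (hlip i))
    intro y hy
    obtain ⟨i, hi⟩ := mem_iUnion.1 (hcover.symm ▸ mem_univ y : y ∈ ⋃ i, closure (U i))
    exact mem_iUnion.2 ⟨i, hi, fun h => hy (mem_iUnion.2 ⟨i, h⟩)⟩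
  rw [← integral_iUnion_fintype (fun i => (hopen i).measurableSet) hdisj
    fun i => hF.mono_set (subset_univ _)]
  refine setIntegral_congr_set ?_
  exact (ae_eq_univ.2 hnull).symm

/-- Rellich's theorem for a manifold with a partition into sets with Lipschitz boundary. -/
theorem exists_subseq_cauchy_univ {ι : Type*} [Fintype ι] {U : ι → Set M}
    (hopen : ∀ i, IsOpen (U i)) (hlip : ∀ i, HasLipschitzBoundary n (U i))
    (hdisj : Pairwise fun i j => Disjoint (U i) (U j)) (hcover : ⋃ i, closure (U i) = univ)
    (v : ℕ → l2Pairs g (isOpen_univ : IsOpen (univ : Set M))) (hv : ∀ k, v k ∈ h1 g isOpen_univ)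
    (hC : ∃ C : ℝ, ∀ k, energyForm g isOpen_univ (v k) (v k) +
      massForm g isOpen_univ (v k) (v k) ≤ C) :
    ∃ φ : ℕ → ℕ, StrictMono φ ∧ ∀ ε > 0, ∃ N, ∀ k ≥ N, ∀ l ≥ N,
      massForm g isOpen_univ (v (φ k) - v (φ l)) (v (φ k) - v (φ l)) < ε := by
  obtain ⟨C, hC⟩ := hC
  set ρ := fun i => restrictPairs g isOpen_univ (hopen i) (subset_univ _) with hρ
  -- Compactness on `M` is obtained piece by piece with successive subsequences, so no regularity of
  -- `∂M` is invoked beyond that of the pieces.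
  obtain ⟨φ, hφ, h⟩ := exists_subseq_cauchy_finset (Finset.univ : Finset ι)
    (d := fun i k l => massForm g (hopen i) (ρ i (v k - v l)) (ρ i (v k - v l))) (by
      intro i _ ψ hψ
      simp only [map_sub (ρ i)]
      exact (hlip i).exists_subseq_cauchy (fun k => ρ i (v (ψ k)))
        (fun k => restrictPairs_mem_h1 _ (hv _))
        ⟨C, fun k => (add_le_add (energyForm_restrictPairs_le _ _ _)
          (massForm_restrictPairs_le _ _ _)).trans (hC _)⟩)
  refine ⟨φ, hφ, fun ε hε => ?_⟩
  obtain ⟨N, hN⟩ := h (ε / (Fintype.card ι + 1)) (by positivity)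
  refine ⟨N, fun k hk l hl => ?_⟩
  have h1 : massForm g isOpen_univ (v (φ k) - v (φ l)) (v (φ k) - v (φ l)) =
      ∑ i, massForm g (hopen i) (ρ i (v (φ k) - v (φ l))) (ρ i (v (φ k) - v (φ l))) := by
    simp only [massForm_self]
    exact integral_eq_sum_of_partition hopen hlip hdisj hcover
      (v (φ k) - v (φ l)).2.memLp.integrable_sq
  rw [h1]
  refine lt_of_le_of_lt (Finset.sum_le_sum fun i hi => (hN k hk l hl i hi).le) ?_
  rw [Finset.sum_const, Finset.card_univ, nsmul_eq_mul, mul_div_assoc',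
    div_lt_iff₀ (by positivity)]
  linarith

end

end NeumannDirichlet

/-! ### Eigenspaces, counting and orthonormal families -/

namespace NeumannDirichlet

section

variable {n : ℕ} [NeZero n] {M : Type*} [TopologicalSpace M]
  [ChartedSpace (EuclideanHalfSpace n) M] [IsManifold (𝓡∂ n) ∞ M]
  [MeasurableSpace M] [BorelSpace M] [CompactSpace M]

variable {g : Metric n M} {U : Set M} {hU : IsOpen U}

variable (g hU) in
/-- The class in `L²(U)` of the function of a pair. -/
noncomputable def pairToLp : l2Pairs g hU →ₗ[ℝ] Lp ℝ 2 ((vol g).restrict U) where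
  toFun p := p.2.memLp.toLp p.1.1
  map_add' p q := MemLp.toLp_add p.2.memLp q.2.memLp
  map_smul' c p := MemLp.toLp_const_smul c p.2.memLp

lemma inner_pairToLp (p q : l2Pairs g hU) :
    inner ℝ (pairToLp g hU p) (pairToLp g hU q) = massForm g hU p q := by
  rw [L2.inner_def, massForm_apply]
  refine integral_congr_ae ?_
  filter_upwards [p.2.memLp.coeFn_toLp, q.2.memLp.coeFn_toLp] with y hp hq
  show inner ℝ ((p.2.memLp.toLp p.1.1 : M → ℝ) y) ((q.2.memLp.toLp q.1.1 : M → ℝ) y) = _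
  rw [hp, hq, Real.inner_apply]

/-- The pairs of an eigenfunction for the eigenvalue `μ` and its gradient, for the form
domain `W`. -/
noncomputable def eigenpairs (W : Submodule ℝ (l2Pairs g hU)) (μ : ℝ) :
    Submodule ℝ (l2Pairs g hU) where
  carrier := {p | p ∈ W ∧ ∀ q ∈ W, energyForm g hU p q = μ * massForm g hU p q}
  add_mem' := by
    rintro p p' ⟨h1, h2⟩ ⟨h3, h4⟩
    refine ⟨add_mem h1 h3, fun q hq => ?_⟩
    rw [map_add, map_add, LinearMap.add_apply, LinearMap.add_apply, h2 q hq, h4 q hq]; ring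
  zero_mem' := ⟨zero_mem _, fun q _ => by simp⟩
  smul_mem' := by
    rintro c p ⟨h1, h2⟩
    refine ⟨Submodule.smul_mem _ c h1, fun q hq => ?_⟩
    rw [map_smul, map_smul, LinearMap.smul_apply, LinearMap.smul_apply, h2 q hq, smul_eq_mul,
      smul_eq_mul]
    ring

/-- Eigenfunctions in the definition are representatives of classes in `L²`, whereas pairs contain
actual functions. Invariance of the form domain under almost everywhere changes identifies the two;
since the image is a subspace, the span adds nothing. -/
lemma eigenspace_eq_map {D : (M → ℝ) → (∀ y : M, TangentSpace (𝓡∂ n) y) → Prop}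
    {W : Submodule ℝ (l2Pairs g hU)}
    (hD : ∀ u X, D u X ↔ ∃ h : IsL2Pair g U u X, (⟨(u, X), h⟩ : l2Pairs g hU) ∈ W)
    (hW : ∀ p ∈ W, ∀ p' : l2Pairs g hU, p'.1.2 = p.1.2 → p'.1.1 =ᵐ[(vol g).restrict U] p.1.1 →
      p' ∈ W) (μ : ℝ) :
    eigenspace g U D μ = (eigenpairs W μ).map (pairToLp g hU) := by
  have h : {f : Lp ℝ 2 ((vol g).restrict U) | IsEigenfunction g U D μ f} =
      ((eigenpairs W μ).map (pairToLp g hU) : Set (Lp ℝ 2 ((vol g).restrict U))) := by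
    ext f
    simp only [mem_ofPred_eq, SetLike.mem_coe, Submodule.mem_map]
    constructor
    · rintro ⟨X, hX, hf⟩
      obtain ⟨h1, h2⟩ := (hD _ _).1 hX
      exact ⟨⟨(f, X), h1⟩, ⟨h2, fun q hq => hf _ _ ((hD _ _).2 ⟨q.2, hq⟩)⟩,
        Lp.toLp_coeFn f h1.memLp⟩
    · rintro ⟨p, ⟨hp, hpe⟩, rfl⟩
      have hae : (pairToLp g hU p : M → ℝ) =ᵐ[(vol g).restrict U] p.1.1 := p.2.memLp.coeFn_toLp
      refine ⟨p.1.2, (hD _ _).2 ⟨⟨Lp.memLp _, p.2.2, p.2.3⟩, hW p hp _ rfl hae⟩, fun v Y hvY => ?_⟩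
      obtain ⟨h1, h2⟩ := (hD _ _).1 hvY
      have h3 := hpe _ h2
      rw [energyForm_apply, massForm_apply] at h3
      refine h3.trans (congrArg (μ * ·) (integral_congr_ae ?_))
      filter_upwards [hae] with y hy
      rw [hy]
  rw [eigenspace, h, Submodule.span_eq]

lemma form_sub_eq_zero_of_ae {p p' : l2Pairs g hU} (h1 : p'.1.2 = p.1.2)
    (h2 : p'.1.1 =ᵐ[(vol g).restrict U] p.1.1) :
    energyForm g hU (p - p') (p - p') + massForm g hU (p - p') (p - p') = 0 := by
  have e1 : energyForm g hU (p - p') (p - p') = 0 := by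
    rw [energyForm_apply]
    refine integral_eq_zero_of_ae (Eventually.of_forall fun y => ?_)
    have : (p - p').1.2 y = 0 := by
      show p.1.2 y - p'.1.2 y = 0
      rw [h1, sub_self]
    simp only [this, map_zero, Pi.zero_apply]
  have e2 : massForm g hU (p - p') (p - p') = 0 := by
    rw [massForm_self]
    refine integral_eq_zero_of_ae ?_
    filter_upwards [h2] with y hy
    show (p.1.1 y - p'.1.1 y) ^ 2 = 0
    rw [hy, sub_self, zero_pow two_ne_zero]
  rw [e1, e2, add_zero]

lemma eigenspace_isH1 (hU : IsOpen U) (μ : ℝ) :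
    eigenspace g U (IsH1 g U) μ = (eigenpairs (h1 g hU) μ).map (pairToLp g hU) := by
  refine eigenspace_eq_map (fun u X => ⟨fun h => ⟨h.isL2Pair, h.weak⟩, fun ⟨h, h'⟩ =>
    mem_h1_iff.1 h'⟩) (fun p hp p' e1 e2 => ?_) μ
  -- A change on a null set is at distance zero, so the constant sequence converges to the changed
  -- pair and closedness applies.
  exact mem_h1_of_tendsto (v := fun _ => p) (fun _ => hp)
    (by simp only [form_sub_eq_zero_of_ae e1 e2, tendsto_const_nhds])

lemma eigenspace_isH10 (hU : IsOpen U) (μ : ℝ) :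
    eigenspace g U (IsH10 g U) μ = (eigenpairs (h10 g hU) μ).map (pairToLp g hU) := by
  refine eigenspace_eq_map (fun u X => ⟨fun h => ⟨h.1.isL2Pair, mem_h10_iff.2 h⟩, fun ⟨h, h'⟩ =>
    mem_h10_iff.1 h'⟩) (fun p hp p' e1 e2 => ?_) μ
  exact mem_h10_of_tendsto (v := fun _ => p) (fun _ => hp)
    (by simp only [form_sub_eq_zero_of_ae e1 e2, tendsto_const_nhds])

/-- An orthonormal family of eigenfunctions, for the form domain `W`, with eigenvalues
at most `l`. -/
structure IsEigenfamily (W : Submodule ℝ (l2Pairs g hU)) (l : ℝ) {ι : Type*}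
    (e : ι → l2Pairs g hU) (μ : ι → ℝ) : Prop where
  mem : ∀ i, e i ∈ eigenpairs W (μ i)
  le : ∀ i, μ i ≤ l
  norm : ∀ i, massForm g hU (e i) (e i) = 1
  orth : ∀ i j, i ≠ j → massForm g hU (e i) (e j) = 0

lemma massForm_eq_zero_of_eigenpairs {W : Submodule ℝ (l2Pairs g hU)} {μ ν : ℝ} (h : μ ≠ ν)
    {p q : l2Pairs g hU} (hp : p ∈ eigenpairs W μ) (hq : q ∈ eigenpairs W ν) :
    massForm g hU p q = 0 := by
  have h1 := hp.2 q hq.1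
  have h2 := hq.2 p hp.1
  rw [energyForm_symm, h1, massForm_symm q p] at h2
  have h3 : (μ - ν) * massForm g hU p q = 0 := by linarith
  exact (mul_eq_zero.1 h3).resolve_left (sub_ne_zero.2 h)

/-- The rank may be infinite; an orthonormal basis is taken in the span of `d` independent vectors.
-/
lemma exists_orthonormal_of_le_rank {H : Type*} [NormedAddCommGroup H] [InnerProductSpace ℝ H]
    {d : ℕ} (h : (d : ℕ∞) ≤ Cardinal.toENat (Module.rank ℝ H)) :
    ∃ w : Fin d → H, Orthonormal ℝ w := by
  rw [Cardinal.natCast_le_toENat, le_rank_iff_exists_linearIndependent] at h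
  obtain ⟨s', hs', hli⟩ := h
  obtain ⟨s, rfl, hs⟩ := Cardinal.mk_set_eq_nat_iff_finset.1 hs'
  have hfr : Module.finrank ℝ (Submodule.span ℝ (s : Set H)) = d := by
    rw [finrank_span_finset_eq_card hli, hs]
  let b := (stdOrthonormalBasis ℝ (Submodule.span ℝ (s : Set H))).reindex (finCongr hfr)
  exact ⟨fun i => (b i : H), b.orthonormal.comp_linearIsometry (Submodule.subtypeₗᵢ _)⟩

/-- The number of eigenvalues at most `l`, for the form domain `W`, counted with multiplicity. -/
noncomputable def eigenCount (W : Submodule ℝ (l2Pairs g hU)) (l : ℝ) : ℕ∞ :=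
  Set.encard {p : ℝ × ℕ | p.1 ≤ l ∧ (p.2 : ℕ∞) <
    Cardinal.toENat (Module.rank ℝ ((eigenpairs W p.1).map (pairToLp g hU)))}

lemma neumannCount_eq (hU : IsOpen U) :
    neumannCount g U = eigenCount (h1 g hU) (firstDirichletEigenvalue g U) := by
  unfold neumannCount eigenCount neumannMultiplicity
  congr 1
  ext p
  rw [mem_ofPred_eq, mem_ofPred_eq, eigenspace_isH1 hU]

/-- A choice of `m` of the counted pairs `(μ, k)` turns into eigenfunctions: within one eigenvalue,
`k` indexes an orthonormal family; between distinct eigenvalues orthogonality is automatic. -/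
lemma exists_eigenfamily_of_le_eigenCount {W : Submodule ℝ (l2Pairs g hU)} {l : ℝ} {m : ℕ}
    (h : (m : ℕ∞) ≤ eigenCount W l) :
    ∃ (e : Fin m → l2Pairs g hU) (μ : Fin m → ℝ), IsEigenfamily W l e μ := by
  classical
  obtain ⟨F, hF, hFm⟩ := exists_subset_encard_eq h
  have hfin : F.Finite := finite_of_encard_eq_coe hFm
  -- The multiplicity may be infinite, so a finite `d` is chosen for each `μ`: one more than the
  -- largest `k` in use, or `0` if there is none.
  have hd : ∀ μ : ℝ, ∃ d : ℕ, (d : ℕ∞) ≤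
      Cardinal.toENat (Module.rank ℝ ((eigenpairs W μ).map (pairToLp g hU))) ∧
      ∀ k, (μ, k) ∈ F → k < d := by
    intro μ
    by_cases hne : {k | (μ, k) ∈ F}.Nonempty
    · have hf : {k | (μ, k) ∈ F}.Finite :=
        hfin.preimage (f := fun k => (μ, k)) (fun a _ b _ hab => (Prod.mk.inj hab).2)
      obtain ⟨k₀, hk₀, hmax⟩ := hf.exists_maximalFor id _ hne
      refine ⟨k₀ + 1, ?_, fun k hk => ?_⟩
      · push_cast
        exact Order.add_one_le_of_lt (hF hk₀).2
      · rcases le_total k k₀ with h | h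
        · omega
        · exact Nat.lt_succ_of_le (hmax hk h)
    · exact ⟨0, by simp, fun k hk => absurd ⟨k, hk⟩ hne⟩
  choose d hd1 hd2 using hd
  choose w hw using fun μ => exists_orthonormal_of_le_rank (hd1 μ)
  have hlift : ∀ μ k, ∃ p ∈ eigenpairs W μ, pairToLp g hU p = (w μ k : Lp ℝ 2 _) :=
    fun μ k => (w μ k).2
  choose q hq hqw using hlift
  have hcard : Nat.card F = m := by
    rw [Nat.card_coe_set_eq, ncard_def, hFm]; rfl
  have : Finite F := hfin
  let σ : Fin m ≃ F := (Finite.equivFinOfCardEq hcard).symm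
  have hinner : ∀ μ k k', massForm g hU (q μ k) (q μ k') = if k = k' then 1 else 0 := by
    intro μ k k'
    rw [← inner_pairToLp, hqw, hqw]
    exact orthonormal_iff_ite.1 (hw μ) k k'
  refine ⟨fun i => q (σ i).1.1 ⟨(σ i).1.2, hd2 _ _ (σ i).2⟩, fun i => (σ i).1.1,
    fun i => hq _ _, fun i => (hF (σ i).2).1, fun i => ?_, fun i j hij => ?_⟩
  · rw [hinner, if_pos rfl]
  · by_cases hμ : (σ i).1.1 = (σ j).1.1
    · have hne : (σ i).1.2 ≠ (σ j).1.2 := fun h =>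
        hij (σ.injective (Subtype.ext (Prod.ext hμ h)))
      have key : ∀ (a b : ℝ × ℕ) (ha : a.2 < d a.1) (hb : b.2 < d b.1), a.1 = b.1 → a.2 ≠ b.2 →
          massForm g hU (q a.1 ⟨a.2, ha⟩) (q b.1 ⟨b.2, hb⟩) = 0 := by
        rintro ⟨a, k⟩ ⟨b, k'⟩ ha hb rfl hk
        rw [hinner, if_neg fun h => hk (Fin.mk.inj_iff.1 h)]
      exact key _ _ _ _ hμ hne
    · exact massForm_eq_zero_of_eigenpairs hμ (hq _ _) (hq _ _)

lemma IsEigenfamily.le_eigenCount {W : Submodule ℝ (l2Pairs g hU)} {l : ℝ} {m : ℕ}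
    {e : Fin m → l2Pairs g hU} {μ : Fin m → ℝ} (h : IsEigenfamily W l e μ) :
    (m : ℕ∞) ≤ eigenCount W l := by
  classical
  -- The `i`-th eigenfunction is sent to its eigenvalue and the number of earlier members with the
  -- same eigenvalue. These pairs are distinct, and the `r i + 1` members up to `i` are independent
  -- in the eigenspace, so `r i` lies below the multiplicity.
  set r : Fin m → ℕ := fun i => (Finset.univ.filter fun j => j < i ∧ μ j = μ i).card with hr
  have hinj : Function.Injective fun i => (μ i, r i) := by
    have key : ∀ i j, i < j → μ i = μ j → r i < r j := by
      intro i j hij hμ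
      refine Finset.card_lt_card ⟨fun k hk => ?_, fun hsub => ?_⟩
      · simp only [Finset.mem_filter, Finset.mem_univ, true_and] at hk ⊢
        exact ⟨hk.1.trans hij, hk.2.trans hμ⟩
      · have : i ∈ Finset.univ.filter fun k => k < i ∧ μ k = μ i :=
          hsub (by simp [hij, hμ])
        simp at this
    intro i j hij
    obtain ⟨h1, h2⟩ := Prod.mk.inj hij
    rcases lt_trichotomy i j with h3 | h3 | h3
    · exact absurd h2 (key i j h3 h1).ne
    · exact h3
    · exact absurd h2 (key j i h3 h1.symm).ne'
  have hcard : (m : ℕ∞) = (range fun i => (μ i, r i)).encard := by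
    rw [← image_univ, hinj.encard_image, encard_univ]; simp
  rw [hcard]
  refine encard_le_encard ?_
  rintro _ ⟨i, rfl⟩
  refine ⟨h.le i, ?_⟩
  set S := (eigenpairs W (μ i)).map (pairToLp g hU) with hS
  have hE : ∀ j, μ j = μ i → e j ∈ eigenpairs W (μ i) := fun j hj => by
    rw [← hj]; exact h.mem j
  let v : (Finset.univ.filter fun j => j ≤ i ∧ μ j = μ i) → S := fun j =>
    ⟨pairToLp g hU (e j), e j, hE j (Finset.mem_filter.1 j.2).2.2, rfl⟩
  have hv : Orthonormal ℝ v := by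
    rw [orthonormal_iff_ite]
    intro j k
    show inner ℝ (pairToLp g hU (e j)) (pairToLp g hU (e k)) = _
    rw [inner_pairToLp]
    split_ifs with hjk
    · rw [hjk, h.norm]
    · exact h.orth _ _ fun h' => hjk (Subtype.ext h')
  have h2 := hv.linearIndependent.cardinal_lift_le_rank
  have hc : (Finset.univ.filter fun j => j ≤ i ∧ μ j = μ i) =
      insert i (Finset.univ.filter fun j => j < i ∧ μ j = μ i) := by
    ext j
    simp only [Finset.mem_filter, Finset.mem_univ, true_and, Finset.mem_insert]
    constructor
    · rintro ⟨h1, h2⟩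
      rcases h1.eq_or_lt with h3 | h3
      · exact Or.inl h3
      · exact Or.inr ⟨h3, h2⟩
    · rintro (rfl | ⟨h1, h2⟩)
      · exact ⟨le_rfl, rfl⟩
      · exact ⟨h1.le, h2⟩
  rw [Cardinal.mk_coe_finset, hc, Finset.card_insert_of_notMem (by simp)] at h2
  rw [Cardinal.lift_natCast, Cardinal.nat_le_lift_iff] at h2
  have h3 := Cardinal.natCast_le_toENat.2 h2
  refine lt_of_lt_of_le ?_ h3
  show (r i : ℕ∞) < ((r i + 1 : ℕ) : ℕ∞)
  exact_mod_cast Nat.lt_succ_self _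

lemma IsEigenfamily.cons {W : Submodule ℝ (l2Pairs g hU)} {l : ℝ} {m : ℕ}
    {e : Fin m → l2Pairs g hU} {μ : Fin m → ℝ} (h : IsEigenfamily W l e μ) {ν : ℝ}
    {u : l2Pairs g hU} (hu : u ∈ eigenpairs W ν) (hν : ν ≤ l) (hu1 : massForm g hU u u = 1)
    (hue : ∀ i, massForm g hU u (e i) = 0) :
    IsEigenfamily W l (Fin.cons u e : Fin (m + 1) → l2Pairs g hU)
      (Fin.cons ν μ : Fin (m + 1) → ℝ) where
  mem i := by cases i using Fin.cases <;> simp [hu, h.mem]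
  le i := by cases i using Fin.cases <;> simp [hν, h.le]
  norm i := by cases i using Fin.cases <;> simp [hu1, h.norm]
  orth i j hij := by
    cases i using Fin.cases with
    | zero => cases j using Fin.cases with
      | zero => exact absurd rfl hij
      | succ j => simpa using hue j
    | succ i => cases j using Fin.cases with
      | zero => simpa [massForm_symm (e i)] using hue i
      | succ j => simpa using h.orth i j fun h' => hij (congrArg Fin.succ h')

end

end NeumannDirichlet

/-! ### Gradients of smooth functions -/

namespace NeumannDirichlet

section

variable {n : ℕ} [NeZero n] {M : Type*} [TopologicalSpace M]
  [ChartedSpace (EuclideanHalfSpace n) M] [IsManifold (𝓡∂ n) ∞ M]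

variable {g : Metric n M} {U : Set M}

variable (g) in
lemma exists_inner_eq {y : M} (ℓ : TangentSpace (𝓡∂ n) y →L[ℝ] ℝ) :
    ∃ Y : TangentSpace (𝓡∂ n) y, ∀ w, g.inner y Y w = ℓ w := by
  let B : EuclideanSpace ℝ (Fin n) →L[ℝ] EuclideanSpace ℝ (Fin n) →L[ℝ] ℝ := g.inner y
  let L : EuclideanSpace ℝ (Fin n) →ₗ[ℝ] Module.Dual ℝ (EuclideanSpace ℝ (Fin n)) :=
    (ContinuousLinearMap.coeLM ℝ).comp B.toLinearMap
  have hL : Function.Injective L := by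
    rw [injective_iff_map_eq_zero]
    intro X hX
    by_contra h
    have h1 : 0 < B X X := g.pos y X h
    have h2 : B X X = 0 := LinearMap.congr_fun hX X
    exact h1.ne' h2
  have hs := (LinearMap.injective_iff_surjective_of_finrank_eq_finrank
    (Subspace.dual_finrank_eq (K := ℝ) (V := EuclideanSpace ℝ (Fin n))).symm).1 hL
  let ℓ' : EuclideanSpace ℝ (Fin n) →L[ℝ] ℝ := ℓ
  obtain ⟨Y, hY⟩ := hs ℓ'.toLinearMap
  exact ⟨Y, fun w => LinearMap.congr_fun hY w⟩

variable (g) in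
/-- The gradient of a differentiable function. -/
noncomputable def gradient (ψ : M → ℝ) (y : M) : TangentSpace (𝓡∂ n) y :=
  (exists_inner_eq g (mfderiv (𝓡∂ n) 𝓘(ℝ, ℝ) ψ y)).choose

lemma inner_gradient (ψ : M → ℝ) (y : M) (w : TangentSpace (𝓡∂ n) y) :
    g.inner y (gradient g ψ y) w = mfderiv (𝓡∂ n) 𝓘(ℝ, ℝ) ψ y w :=
  (exists_inner_eq g (mfderiv (𝓡∂ n) 𝓘(ℝ, ℝ) ψ y)).choose_spec w

lemma gradient_eq_zero {ψ : M → ℝ} {y : M} (hy : y ∉ tsupport ψ) : gradient g ψ y = 0 := by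
  by_contra h
  have h1 := g.pos y _ h
  have h2 : ψ =ᶠ[𝓝 y] fun _ => (0 : ℝ) := notMem_tsupport_iff_eventuallyEq.1 hy
  rw [inner_gradient, h2.mfderiv_eq, mfderiv_const] at h1
  exact lt_irrefl _ h1

lemma contDiffOn_comp_symm {ψ : M → ℝ} (hψ : ContMDiff (𝓡∂ n) 𝓘(ℝ, ℝ) ∞ ψ) (x : M) :
    ContDiffOn ℝ ∞ (fun z => ψ ((extChartAt (𝓡∂ n) x).symm z)) (extChartAt (𝓡∂ n) x).target :=
  (hψ.comp_contMDiffOn (contMDiffOn_extChartAt_symm x)).contDiffOn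

/-- At points of the chart domain the range of the model is a neighbourhood, so the derivative
within the half-space that defines the coordinate vectors is a full derivative and the chain rule
applies. -/
lemma chartPairing_gradient {ψ : M → ℝ} (hψ : ContMDiff (𝓡∂ n) 𝓘(ℝ, ℝ) ∞ ψ) (x : M)
    (v : EuclideanSpace ℝ (Fin n)) {z : EuclideanSpace ℝ (Fin n)} (hz : z ∈ chartDomain n x univ) :
    chartPairing g (gradient g ψ) x v z =
      fderiv ℝ (fun z => ψ ((extChartAt (𝓡∂ n) x).symm z)) z v := by
  set y := (extChartAt (𝓡∂ n) x).symm z with hy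
  have hys : y ∈ (chartAt (EuclideanHalfSpace n) x).source := mapsTo_symm_source x hz.1
  have hyz : extChartAt (𝓡∂ n) x y = z := (extChartAt (𝓡∂ n) x).right_inv hz.1
  have hrange : range (𝓡∂ n) ∈ 𝓝 z :=
    mem_of_superset ((isOpen_chartDomain x isOpen_univ).mem_nhds hz) fun w hw =>
      extChartAt_target_subset_range x hw.1
  rw [chartPairing, inner_gradient, coordVector, TangentBundle.symmL_trivializationAt hys, hyz]
  have h1 : MDifferentiableWithinAt 𝓘(ℝ, EuclideanSpace ℝ (Fin n)) (𝓡∂ n)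
      (extChartAt (𝓡∂ n) x).symm (range (𝓡∂ n)) z := mdifferentiableWithinAt_extChartAt_symm hz.1
  have h2 : MDifferentiableAt (𝓡∂ n) 𝓘(ℝ, ℝ) ψ ((extChartAt (𝓡∂ n) x).symm z) :=
    hψ.mdifferentiable (by simp) _
  have h3 := mfderiv_comp_mfderivWithin z h2 h1
    (uniqueDiffWithinAt_of_mem_nhds hrange).uniqueMDiffWithinAt
  rw [mfderivWithin_eq_fderivWithin, fderivWithin_of_mem_nhds hrange] at h3
  exact (congrArg (fun L => L v) h3).symm

lemma continuousOn_chartPairing_gradient {ψ : M → ℝ} (hψ : ContMDiff (𝓡∂ n) 𝓘(ℝ, ℝ) ∞ ψ) (x : M)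
    (v : EuclideanSpace ℝ (Fin n)) :
    ContinuousOn (chartPairing g (gradient g ψ) x v) (chartDomain n x univ) := by
  have h1 : ContDiffOn ℝ ∞ (fun z => ψ ((extChartAt (𝓡∂ n) x).symm z)) (chartDomain n x univ) :=
    (contDiffOn_comp_symm hψ x).mono inter_subset_left
  have h2 := (h1.continuousOn_fderiv_of_isOpen (isOpen_chartDomain x isOpen_univ)
    (by simp)).clm_apply (continuousOn_const (c := v))
  exact h2.congr fun z hz => chartPairing_gradient hψ x v hz

lemma isWeakGradient_gradient {ψ : M → ℝ} (hψ : ContMDiff (𝓡∂ n) 𝓘(ℝ, ℝ) ∞ ψ) (hU : IsOpen U) :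
    IsWeakGradient g U ψ (gradient g ψ) := by
  intro x v φ hφ hc hs
  set f : EuclideanSpace ℝ (Fin n) → ℝ := fun z => ψ ((extChartAt (𝓡∂ n) x).symm z) with hf
  have hDo := isOpen_chartDomain (n := n) x hU
  have hfD : ContDiffOn ℝ ∞ f (chartDomain n x U) :=
    (contDiffOn_comp_symm hψ x).mono inter_subset_left
  have hfd : ContinuousOn (fun z => fderiv ℝ f z v) (chartDomain n x U) :=
    (hfD.continuousOn_fderiv_of_isOpen hDo (by simp)).clm_apply continuousOn_const
  have hφd : Continuous (fun z => fderiv ℝ φ z v) :=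
    (hφ.continuous_fderiv (by simp)).clm_apply continuous_const
  have hint : ∀ (F G : EuclideanSpace ℝ (Fin n) → ℝ), ContinuousOn F (chartDomain n x U) →
      Continuous G → tsupport G ⊆ tsupport φ → Integrable (fun z => F z * G z) volume := by
    intro F G hF hG hGs
    have h1 : tsupport (fun z => F z * G z) ⊆ tsupport φ := (tsupport_mul_subset_right).trans hGs
    refine Continuous.integrable_of_hasCompactSupport ?_ (hc.of_isClosed_subset
      (isClosed_tsupport _) h1)
    exact (hF.mul hG.continuousOn).continuous_of_tsupport_subset hDo (h1.trans hs)
  have hds : tsupport (fun z => fderiv ℝ φ z v) ⊆ tsupport φ := tsupport_fderiv_apply_subset ℝ v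
  have key := integral_mul_fderiv_eq_neg_fderiv_mul_of_integrable (μ := volume) (v := v)
    (hint _ φ hfd hφ.continuous subset_rfl) (hint f _ hfD.continuousOn hφd hds)
    (hint f φ hfD.continuousOn hφ.continuous subset_rfl)
    (fun z hz => ((hfD.contDiffAt (hDo.mem_nhds (hs hz))).differentiableAt (by simp)))
    (fun z _ => (hφ.differentiable (by simp)) z)
  rw [setIntegral_eq_integral_of_forall_compl_eq_zero, key,
    ← setIntegral_eq_integral_of_forall_compl_eq_zero (s := chartDomain n x U)]
  · congr 1
    refine setIntegral_congr_fun hDo.measurableSet fun z hz => ?_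
    simp only [chartPairing_gradient (g := g) hψ x v (chartDomain_mono (n := n) x (subset_univ U) hz), hf]
  · intro z hz
    rw [image_eq_zero_of_notMem_tsupport fun h => hz (hs h), mul_zero]
  · intro z hz
    rw [fderiv_of_notMem_tsupport ℝ fun h => hz (hs h), zero_apply, mul_zero]

/-- The gradient is chosen pointwise by duality. On the support, which avoids the boundary,
continuity is read off from the coordinate formula; elsewhere the gradient vanishes near the point.
-/
lemma continuous_inner_gradient {ψ : M → ℝ} (hψ : ContMDiff (𝓡∂ n) 𝓘(ℝ, ℝ) ∞ ψ)
    (hs : tsupport ψ ⊆ (𝓡∂ n).interior M) :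
    Continuous fun y => g.inner y (gradient g ψ y) (gradient g ψ y) := by
  rw [continuous_iff_continuousAt]
  intro p
  by_cases hp : p ∈ tsupport ψ
  · set F : EuclideanSpace ℝ (Fin n) → ℝ := fun z => ∑ i, ∑ j,
      (gram g p ((extChartAt (𝓡∂ n) p).symm z))⁻¹ i j *
        (chartPairing g (gradient g ψ) p (EuclideanSpace.single i 1) z *
          chartPairing g (gradient g ψ) p (EuclideanSpace.single j 1) z) with hF
    have hFc : ContinuousOn F (chartDomain n p univ) := by
      refine continuousOn_finsetSum _ fun i _ => continuousOn_finsetSum _ fun j _ => ?_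
      exact ((continuousOn_inv_gram g p i j).mono inter_subset_left).mul
        ((continuousOn_chartPairing_gradient hψ p _).mul
          (continuousOn_chartPairing_gradient hψ p _))
    have hz : extChartAt (𝓡∂ n) p p ∈ chartDomain n p univ := by
      refine ⟨mem_extChartAt_target p, ?_⟩
      rw [mem_preimage, extChartAt_to_inv]
      exact ⟨mem_univ _, hs hp⟩
    have h1 : ContinuousAt (fun y => F (extChartAt (𝓡∂ n) p y)) p :=
      ContinuousAt.comp (f := extChartAt (𝓡∂ n) p) (g := F)
        (hFc.continuousAt ((isOpen_chartDomain p isOpen_univ).mem_nhds hz))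
        (continuousAt_extChartAt p)
    refine h1.congr ?_
    filter_upwards [(chartAt (EuclideanHalfSpace n) p).open_source.mem_nhds
      (mem_chart_source _ p)] with y hy
    have hy' : y ∈ (extChartAt (𝓡∂ n) p).source := by rwa [extChartAt_source]
    simp only [hF, chartPairing]
    rw [(extChartAt (𝓡∂ n) p).left_inv hy']
    exact (inner_eq_sum_inv_gram g hy _ _).symm
  · have h1 : (fun _ : M => (0 : ℝ)) =ᶠ[𝓝 p]
        fun y => g.inner y (gradient g ψ y) (gradient g ψ y) := by
      filter_upwards [(isClosed_tsupport ψ).isOpen_compl.mem_nhds hp] with y hy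
      rw [gradient_eq_zero hy, map_zero]
    exact continuousAt_const.congr h1

variable [MeasurableSpace M] [BorelSpace M] [CompactSpace M] {hU : IsOpen U}

lemma isH1_gradient {ψ : M → ℝ} (hψ : ContMDiff (𝓡∂ n) 𝓘(ℝ, ℝ) ∞ ψ)
    (hs : tsupport ψ ⊆ (𝓡∂ n).interior M) (hU : IsOpen U) : IsH1 g U ψ (gradient g ψ) := by
  have := isFiniteMeasure_vol g
  refine ⟨hψ.continuous.memLp_of_hasCompactSupport (HasCompactSupport.of_compactSpace ψ),
    fun x v => ?_, (continuous_inner_gradient hψ hs).integrable_of_hasCompactSupport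
      (HasCompactSupport.of_compactSpace _), isWeakGradient_gradient hψ hU⟩
  exact ((continuousOn_chartPairing_gradient hψ x v).mono
    (chartDomain_mono (n := n) x (subset_univ U))).aestronglyMeasurable (measurableSet_chartDomain x hU)

/-- The weak gradient of the zero function vanishes. -/
lemma energyForm_eq_zero_of_fst {p : l2Pairs g hU} (hp : p ∈ h1 g hU) (h0 : p.1.1 = 0) :
    energyForm g hU p p = 0 := by
  have h1 : ∀ x v, ∀ᵐ z ∂volume.restrict (chartDomain n x U), chartPairing g p.1.2 x v z = 0 := by
    intro x v
    have hDo := isOpen_chartDomain (n := n) x hU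
    rw [ae_restrict_iff' hDo.measurableSet]
    -- When `u = 0`, the weak gradient equation says that each component of the gradient annihilates
    -- all test functions.
    refine hDo.ae_eq_zero_of_integral_contDiff_smul_eq_zero ?_ ?_
    · rw [locallyIntegrableOn_iff hDo.isLocallyClosed]
      intro K hKD hK
      obtain ⟨C, -, hC⟩ := exists_coord_bound (g := g) x hK (hKD.trans inter_subset_left) (U := U)
      have h2 := ((hC K (subset_inter subset_rfl hKD) hK.measurableSet _ _ p.2).2.2 v).1
      have : IsFiniteMeasure (volume.restrict K) := ⟨by
        rw [Measure.restrict_apply_univ]; exact hK.measure_lt_top⟩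
      exact h2.integrable one_le_two
    · intro φ hφ hc hs
      have h2 := hp x v φ hφ hc hs
      simp only [h0, Pi.zero_apply, zero_mul, integral_zero] at h2
      rw [setIntegral_eq_integral_of_forall_compl_eq_zero fun z hz => by
        rw [image_eq_zero_of_notMem_tsupport fun h => hz (hs h), mul_zero]] at h2
      simp only [smul_eq_mul, mul_comm (φ _)]
      linarith
  rw [energyForm_apply]
  refine integral_eq_zero_of_ae ?_
  refine ae_of_ae_chartDomain g hU fun x => ?_
  filter_upwards [ae_all_iff.2 fun i => h1 x (EuclideanSpace.single i 1),
    ae_restrict_mem (measurableSet_chartDomain x hU)] with z hz hzD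
  rw [inner_eq_sum_inv_gram g (mapsTo_symm_source x hzD.1)]
  refine Finset.sum_eq_zero fun i _ => Finset.sum_eq_zero fun j _ => ?_
  have := hz i
  rw [chartPairing] at this
  rw [this, zero_mul, mul_zero]

end

end NeumannDirichlet

/-! ### Variational principles and the comparison -/

namespace NeumannDirichlet

section

variable {n : ℕ} [NeZero n] {M : Type*} [TopologicalSpace M]
  [ChartedSpace (EuclideanHalfSpace n) M] [IsManifold (𝓡∂ n) ∞ M]
  [MeasurableSpace M] [BorelSpace M] [CompactSpace M]

variable {g : Metric n M} {U : Set M} {hU : IsOpen U}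

/-- The embedding of `H¹(U)` into `L²(U)` is compact. -/
def IsRellich (g : Metric n M) (hU : IsOpen U) : Prop :=
  ∀ v : ℕ → l2Pairs g hU, (∀ k, v k ∈ h1 g hU) →
    (∃ C : ℝ, ∀ k, energyForm g hU (v k) (v k) + massForm g hU (v k) (v k) ≤ C) →
    ∃ φ : ℕ → ℕ, StrictMono φ ∧ ∀ ε > 0, ∃ N, ∀ k ≥ N, ∀ l ≥ N,
      massForm g hU (v (φ k) - v (φ l)) (v (φ k) - v (φ l)) < ε

/-- The subspace `W` is closed for the norm of `H¹(U)`. -/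
def IsClosedDomain (W : Submodule ℝ (l2Pairs g hU)) : Prop :=
  ∀ v : ℕ → l2Pairs g hU, (∀ k, v k ∈ W) → ∀ u, Tendsto (fun k =>
    energyForm g hU (v k - u) (v k - u) + massForm g hU (v k - u) (v k - u)) atTop (𝓝 0) → u ∈ W

lemma isClosedDomain_h1 : IsClosedDomain (h1 g hU) := fun _ hv _ h => mem_h1_of_tendsto hv h

lemma isClosedDomain_h10 : IsClosedDomain (h10 g hU) := fun _ hv _ h => mem_h10_of_tendsto hv h

lemma exists_eigenpair_of_orthogonal (hR : IsRellich g hU) {W : Submodule ℝ (l2Pairs g hU)}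
    (hW : IsClosedDomain W) (hW1 : W ≤ h1 g hU) {l : ℝ} {m : ℕ} {e : Fin m → l2Pairs g hU}
    {μ : Fin m → ℝ} (he : IsEigenfamily W l e μ) {f : l2Pairs g hU} (hf : f ∈ W)
    (hfe : ∀ i, massForm g hU f (e i) = 0) (hf0 : 0 < massForm g hU f f) :
    ∃ (ν : ℝ) (u : l2Pairs g hU), ν * massForm g hU f f ≤ energyForm g hU f f ∧
      u ∈ eigenpairs W ν ∧ massForm g hU u u = 1 ∧ ∀ i, massForm g hU u (e i) = 0 := by
  obtain ⟨ν, u, h1, h2, h3, h4⟩ := exists_eigenvector_of_orthogonal (V := W)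
    (a := (energyForm g hU).domRestrict₁₂ W W) (b := (massForm g hU).domRestrict₁₂ W W)
    (fun u v => energyForm_symm u.1 v.1) (fun u => energyForm_nonneg u.1)
    (fun u v => massForm_symm u.1 v.1) (fun u => massForm_nonneg u.1)
    (fun v hv => hR (fun k => v k) (fun k => hW1 (v k).2) hv)
    (fun v hv => by
      obtain ⟨u, hu⟩ := exists_tendsto_of_cauchy (fun k => (v k : l2Pairs g hU)) hv
      exact ⟨⟨u, hW _ (fun k => (v k).2) u hu⟩, hu⟩)
    (e := fun i => ⟨e i, (he.mem i).1⟩) (μ := μ) he.norm he.orth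
    (fun i v => (he.mem i).2 v.1 v.2) (f := ⟨f, hf⟩) hfe hf0
  exact ⟨ν, u, h1, ⟨u.2, fun q hq => h4 ⟨q, hq⟩⟩, h2, h3⟩

lemma exists_eigenpair_of_eigenspace_ne_bot {W : Submodule ℝ (l2Pairs g hU)} {l : ℝ}
    (h : (eigenpairs W l).map (pairToLp g hU) ≠ ⊥) :
    ∃ u ∈ eigenpairs W l, 0 < massForm g hU u u := by
  obtain ⟨_, ⟨u, hu, rfl⟩, h0⟩ := Submodule.exists_mem_ne_zero_of_ne_bot h
  refine ⟨u, hu, ?_⟩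
  rw [← inner_pairToLp]
  exact real_inner_self_pos.2 h0

lemma eigenspace_ne_bot_of_eigenpair {W : Submodule ℝ (l2Pairs g hU)} {l : ℝ}
    {u : l2Pairs g hU} (hu : u ∈ eigenpairs W l) (h : massForm g hU u u = 1) :
    (eigenpairs W l).map (pairToLp g hU) ≠ ⊥ := by
  intro hb
  have h1 : pairToLp g hU u ∈ (eigenpairs W l).map (pairToLp g hU) := ⟨u, hu, rfl⟩
  rw [hb, Submodule.mem_bot] at h1
  rw [← inner_pairToLp, h1, inner_zero_left] at h
  exact zero_ne_one h

lemma isEigenfamily_empty (W : Submodule ℝ (l2Pairs g hU)) (l : ℝ) :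
    IsEigenfamily W l (Fin.elim0 : Fin 0 → l2Pairs g hU) Fin.elim0 :=
  ⟨fun i => i.elim0, fun i => i.elim0, fun i => i.elim0, fun i => i.elim0⟩

/-- The Poincaré inequality. -/
lemma firstDirichletEigenvalue_mul_le (hR : IsRellich g hU) {f : l2Pairs g hU}
    (hf : f ∈ h10 g hU) :
    firstDirichletEigenvalue g U * massForm g hU f f ≤ energyForm g hU f f := by
  rcases (massForm_nonneg f).eq_or_lt with h0 | h0
  · rw [← h0, mul_zero]; exact energyForm_nonneg f
  -- The minimiser without orthogonality constraints: its eigenvalue is at most the Rayleigh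
  -- quotient of `f` and is one of those over which the infimum is taken.
  obtain ⟨ν, u, h1, h2, h3, -⟩ := exists_eigenpair_of_orthogonal hR isClosedDomain_h10 h10_le_h1
    (isEigenfamily_empty _ 0) hf (fun i => i.elim0) h0
  refine le_trans (mul_le_mul_of_nonneg_right (csInf_le ⟨0, ?_⟩ ?_) h0.le) h1
  · intro l hl
    rw [mem_ofPred_eq, eigenspace_isH10 hU] at hl
    obtain ⟨w, hw, hw0⟩ := exists_eigenpair_of_eigenspace_ne_bot hl
    have h4 := hw.2 w hw.1
    exact nonneg_of_mul_nonneg_left (h4 ▸ energyForm_nonneg w) hw0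
  · rw [mem_ofPred_eq, eigenspace_isH10 hU]
    exact eigenspace_ne_bot_of_eigenpair h2 h3

/-- Extension of test functions by zero. -/
lemma exists_extension_of_mem_testPairs {V : Set M} (hV : IsOpen V) (hUV : U ⊆ V)
    {t : l2Pairs g hU} (ht : t ∈ testPairs g hU) : ∃ s ∈ testPairs g hV,
      massForm g hV s s = massForm g hU t t ∧ energyForm g hV s s = energyForm g hU t t := by
  obtain ⟨ht1, ht2, ht3, ht4⟩ := ht
  have hint : tsupport t.1.1 ⊆ (𝓡∂ n).interior M := ht4.trans inter_subset_right
  have hV1 := isH1_gradient (g := g) ht2 hint hV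
  have hU1 := isH1_gradient (g := g) ht2 hint hU
  set s : l2Pairs g hV := ⟨(t.1.1, gradient g t.1.1), hV1.isL2Pair⟩ with hs
  set s' : l2Pairs g hU := ⟨(t.1.1, gradient g t.1.1), hU1.isL2Pair⟩ with hs'
  have hsupp : ∀ y ∈ V \ U, y ∉ tsupport t.1.1 := fun y hy h => hy.2 (ht4 h).1
  have e1 : energyForm g hV s s = energyForm g hU s' s' := by
    refine setIntegral_eq_of_subset_of_forall_sdiff_eq_zero hV.measurableSet hUV fun y hy => ?_
    show g.inner y (gradient g t.1.1 y) _ = 0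
    rw [gradient_eq_zero (hsupp y hy), map_zero]
    rfl
  have e2 : massForm g hV s s = massForm g hU t t := by
    refine setIntegral_eq_of_subset_of_forall_sdiff_eq_zero hV.measurableSet hUV fun y hy => ?_
    show t.1.1 y * _ = 0
    rw [image_eq_zero_of_notMem_tsupport (hsupp y hy), zero_mul]
  have hs'1 : s' ∈ h1 g hU := mem_h1_iff.2 hU1
  -- The gradient stored in `t` is only a weak gradient. It differs from the classical one by a weak
  -- gradient of zero, which has zero energy, so the two energies coincide.
  have hd : energyForm g hU (s' - t) (s' - t) = 0 :=
    energyForm_eq_zero_of_fst (sub_mem hs'1 ht1) (sub_self t.1.1)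
  have hd' : energyForm g hU (s' - t) (s' + t) = 0 := by
    have := form_sq_le (b := energyForm g hU) energyForm_symm energyForm_nonneg (s' - t) (s' + t)
    rw [hd, zero_mul] at this
    exact pow_eq_zero_iff two_ne_zero |>.1 (le_antisymm this (sq_nonneg _))
  refine ⟨s, ⟨mem_h1_iff.2 hV1, ht2, ht3, ht4.trans (inter_subset_inter_left _ hUV)⟩, e2, ?_⟩
  rw [e1]
  simp only [map_sub, map_add, LinearMap.sub_apply, energyForm_symm t s'] at hd'
  linarith

/-- Test functions approximate `f`, and their extensions by zero satisfy the Poincaré inequality of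
the larger set `V`. Only compactness on `V` is needed. -/
lemma firstDirichletEigenvalue_mul_le_of_subset {V : Set M} {hV : IsOpen V} (hR : IsRellich g hV)
    (hUV : U ⊆ V) {f : l2Pairs g hU} (hf : f ∈ h10 g hU) :
    firstDirichletEigenvalue g V * massForm g hU f f ≤ energyForm g hU f f := by
  have h1 : ∀ k : ℕ, ∃ t ∈ testPairs g hU, (energyForm g hU + massForm g hU) (f - t) (f - t) <
      1 / ((k : ℝ) + 1) := fun k => hf.2 _ (by positivity)
  choose t ht hft using h1
  have hneg : ∀ (b : l2Pairs g hU →ₗ[ℝ] l2Pairs g hU →ₗ[ℝ] ℝ) k,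
      b (t k - f) (t k - f) = b (f - t k) (f - t k) := by
    intro b k
    rw [← neg_sub f, map_neg, map_neg, LinearMap.neg_apply, neg_neg]
  have hE : Tendsto (fun k => energyForm g hU (t k - f) (t k - f)) atTop (𝓝 0) := by
    refine squeeze_zero (fun k => energyForm_nonneg _) (fun k => ?_)
      tendsto_one_div_add_atTop_nhds_zero_nat
    rw [hneg]
    exact (le_add_of_nonneg_right (massForm_nonneg _)).trans (hft k).le
  have hM : Tendsto (fun k => massForm g hU (t k - f) (t k - f)) atTop (𝓝 0) := by
    refine squeeze_zero (fun k => massForm_nonneg _) (fun k => ?_)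
      tendsto_one_div_add_atTop_nhds_zero_nat
    rw [hneg]
    exact (le_add_of_nonneg_left (energyForm_nonneg _)).trans (hft k).le
  refine le_of_tendsto_of_tendsto'
    ((form_tendsto_self massForm_symm massForm_nonneg hM).const_mul _)
    (form_tendsto_self energyForm_symm energyForm_nonneg hE) fun k => ?_
  obtain ⟨s, hs, e1, e2⟩ := exists_extension_of_mem_testPairs hV hUV (ht k)
  rw [← e1, ← e2]
  exact firstDirichletEigenvalue_mul_le hR (testPairs_le_h10 hs)

/-- This nonzero function of `H¹₀(U)` guarantees that Dirichlet eigenvalues exist. Without one, the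
infimum defining `firstDirichletEigenvalue` would be over the empty set and have the default value
`0`. -/
lemma exists_mem_h10_massForm_pos [T2Space M] (hU : IsOpen U) (h0 : vol g U ≠ 0) :
    ∃ f ∈ h10 g hU, 0 < massForm g hU f f := by
  have hex : ∃ p, p ∈ U ∩ (𝓡∂ n).interior M := by
    by_contra hno
    push Not at hno
    refine h0 (measure_mono_null (fun y hy => ?_) (vol_boundary g))
    rw [← ModelWithCorners.compl_interior]
    exact fun h => hno y ⟨hy, h⟩
  obtain ⟨p, hp⟩ := hex
  have hUo : IsOpen (U ∩ (𝓡∂ n).interior M) := hU.inter isOpen_interior_manifold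
  obtain ⟨t, htp, htc, htU⟩ := exists_mem_nhds_isClosed_subset (hUo.mem_nhds hp)
  set s := interior t
  have hs : IsOpen s := isOpen_interior
  have hps : p ∈ s := mem_interior_iff_mem_nhds.2 htp
  have hsU : closure s ⊆ U ∩ (𝓡∂ n).interior M :=
    (closure_minimal interior_subset htc).trans htU
  obtain ⟨ψ, hψs, hψ, -⟩ := hs.exists_contMDiff_support_eq (n := ⊤) (𝓡∂ n)
  have hts : tsupport ψ ⊆ U ∩ (𝓡∂ n).interior M := by rw [tsupport, hψs]; exact hsU
  have h1 := isH1_gradient (g := g) hψ (hts.trans inter_subset_right) hU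
  refine ⟨⟨(ψ, gradient g ψ), h1.isL2Pair⟩, testPairs_le_h10 ⟨mem_h1_iff.2 h1, hψ,
    HasCompactSupport.of_compactSpace ψ, hts⟩, ?_⟩
  rw [massForm_self]
  have hsupp : Function.support (fun y => ψ y ^ 2) = s := by
    rw [← hψs]; ext y; simp
  refine (integral_pos_iff_support_of_nonneg (fun y => sq_nonneg _) h1.memLp.integrable_sq).2 ?_
  show 0 < (vol g).restrict U (Function.support fun y => ψ y ^ 2)
  rw [hsupp, Measure.restrict_apply hs.measurableSet,
    inter_eq_left.2 (subset_closure.trans (hsU.trans inter_subset_left)), pos_iff_ne_zero]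
  intro hvol
  have h2 := (vol_eq_zero_iff g p (hs.inter (chartAt (EuclideanHalfSpace n) p).open_source).measurableSet
    inter_subset_right).1 (measure_mono_null inter_subset_left hvol)
  refine ((isOpen_chartDomain p hs).measure_pos volume ⟨extChartAt (𝓡∂ n) p p, ?_⟩).ne'
    (measure_mono_null ?_ h2)
  · refine ⟨mem_extChartAt_target p, ?_⟩
    rw [mem_preimage, extChartAt_to_inv]
    exact ⟨hps, hp.2⟩
  · exact fun z hz => ⟨hz.1, hz.2.1, mapsTo_symm_source p hz.1⟩

/-- Monotonicity of the first Dirichlet eigenvalue. -/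
lemma firstDirichletEigenvalue_anti [T2Space M] {V : Set M} {hV : IsOpen V}
    (hRU : IsRellich g hU) (hRV : IsRellich g hV) (hUV : U ⊆ V) (h0 : vol g U ≠ 0) :
    firstDirichletEigenvalue g V ≤ firstDirichletEigenvalue g U := by
  obtain ⟨f, hf, hf0⟩ := exists_mem_h10_massForm_pos hU h0
  obtain ⟨ν, u, -, h2, h3, -⟩ := exists_eigenpair_of_orthogonal hRU isClosedDomain_h10 h10_le_h1
    (isEigenfamily_empty _ 0) hf (fun i => i.elim0) hf0
  refine le_csInf ⟨ν, ?_⟩ fun l hl => ?_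
  · rw [mem_ofPred_eq, eigenspace_isH10 hU]
    exact eigenspace_ne_bot_of_eigenpair h2 h3
  · rw [mem_ofPred_eq, eigenspace_isH10 hU] at hl
    obtain ⟨w, hw, hw0⟩ := exists_eigenpair_of_eigenspace_ne_bot hl
    have h4 := firstDirichletEigenvalue_mul_le_of_subset hRV hUV hw.1
    rw [hw.2 w hw.1] at h4
    exact le_of_mul_le_mul_right h4 hw0

/-- A function of `H¹(U)` orthogonal to a maximal family of eigenfunctions with eigenvalues at
most `l` has a Rayleigh quotient above `l`. -/
lemma lt_energyForm_of_orthogonal (hR : IsRellich g hU) {l : ℝ} {m : ℕ}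
    (hm : eigenCount (h1 g hU) l ≤ m) {e : Fin m → l2Pairs g hU} {μ : Fin m → ℝ}
    (he : IsEigenfamily (h1 g hU) l e μ) {f : l2Pairs g hU} (hf : f ∈ h1 g hU)
    (hfe : ∀ i, massForm g hU f (e i) = 0) (hf0 : 0 < massForm g hU f f) :
    l * massForm g hU f f < energyForm g hU f f := by
  obtain ⟨ν, u, h1, h2, h3, h4⟩ :=
    exists_eigenpair_of_orthogonal hR isClosedDomain_h1 le_rfl he hf hfe hf0
  -- If the inequality failed, the minimiser orthogonal to the family would have eigenvalue at most
  -- `l`, and adjoining it would give `m + 1` counted eigenfunctions.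
  by_contra hcon
  have hν : ν ≤ l := le_of_mul_le_mul_right (h1.trans (not_lt.1 hcon)) hf0
  have h5 := (he.cons h2 hν h3 h4).le_eigenCount.trans hm
  have h6 : m + 1 ≤ m := by exact_mod_cast h5
  omega

/-- The Rayleigh quotient on the span of eigenfunctions with eigenvalues at most `l`. -/
lemma IsEigenfamily.energyForm_sum_le {W : Submodule ℝ (l2Pairs g hU)} {l : ℝ} {m : ℕ}
    {e : Fin m → l2Pairs g hU} {μ : Fin m → ℝ} (he : IsEigenfamily W l e μ) (c : Fin m → ℝ) :
    massForm g hU (∑ i, c i • e i) (∑ i, c i • e i) = ∑ i, c i ^ 2 ∧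
      energyForm g hU (∑ i, c i • e i) (∑ i, c i • e i) ≤ l * ∑ i, c i ^ 2 := by
  classical
  have hon : ∀ i j, massForm g hU (e i) (e j) = if i = j then 1 else 0 := fun i j => by
    split_ifs with h
    · rw [h, he.norm]
    · exact he.orth i j h
  have h1 : ∀ i, massForm g hU (e i) (∑ j, c j • e j) = c i := by
    intro i
    simp only [map_sum, map_smul, hon, smul_eq_mul, mul_ite, mul_one, mul_zero]
    simp
  have hW : ∑ j, c j • e j ∈ W :=
    Submodule.sum_mem _ fun j _ => Submodule.smul_mem _ _ (he.mem j).1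
  have h2 : ∀ b : l2Pairs g hU →ₗ[ℝ] l2Pairs g hU →ₗ[ℝ] ℝ, ∀ w,
      b (∑ i, c i • e i) w = ∑ i, c i * b (e i) w := by
    intro b w
    simp only [map_sum, map_smul, LinearMap.sum_apply, LinearMap.smul_apply, smul_eq_mul]
  constructor
  · rw [h2]
    exact Finset.sum_congr rfl fun i _ => by rw [h1, sq]
  · rw [h2, Finset.mul_sum]
    refine Finset.sum_le_sum fun i _ => ?_
    rw [(he.mem i).2 _ hW, h1]
    nlinarith [mul_le_mul_of_nonneg_right (he.le i) (sq_nonneg (c i))]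

/-- The comparison of Neumann counting functions. -/
theorem neumannCount_univ_le_sum [T2Space M] {ι : Type*} [Fintype ι] {U : ι → Set M}
    (hopen : ∀ i, IsOpen (U i)) (hlip : ∀ i, HasLipschitzBoundary n (U i))
    (hdisj : Pairwise fun i j => Disjoint (U i) (U j)) (hcover : ⋃ i, closure (U i) = univ) :
    neumannCount g univ ≤ ∑ i, neumannCount g (U i) := by
  classical
  have hR : ∀ i, IsRellich g (hopen i) := fun i v hv hC => (hlip i).exists_subseq_cauchy v hv hC
  have hR' : IsRellich g (isOpen_univ : IsOpen (univ : Set M)) := fun v hv hC =>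
    exists_subseq_cauchy_univ hopen hlip hdisj hcover v hv hC
  -- An infinite count on one piece makes the claim trivial, so the counts may be taken finite;
  -- their finiteness need not be proved.
  by_cases htop : ∀ i, neumannCount g (U i) ≠ ⊤
  swap
  · push Not at htop
    obtain ⟨i, hi⟩ := htop
    have h1 := Finset.single_le_sum (f := fun i => neumannCount g (U i)) (fun _ _ => zero_le)
      (Finset.mem_univ i)
    rw [show neumannCount g (U i) = ⊤ from hi, top_le_iff] at h1
    rw [h1]; exact le_top
  have hm : ∀ i, ∃ m : ℕ, neumannCount g (U i) = m := fun i =>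
    ⟨_, (ENat.natCast_toNat (htop i)).symm⟩
  choose m hm using hm
  have hm' : ∀ i, eigenCount (h1 g (hopen i)) (firstDirichletEigenvalue g (U i)) = m i := fun i => by
    rw [← neumannCount_eq, hm]
  choose e μ he using fun i => exists_eigenfamily_of_le_eigenCount (hm' i).ge
  simp only [hm]
  by_contra hcon
  rw [not_le, ← Nat.cast_sum] at hcon
  have hcon' := Order.add_one_le_of_lt hcon
  rw [neumannCount_eq isOpen_univ] at hcon'
  obtain ⟨w, ν, hw⟩ := exists_eigenfamily_of_le_eigenCount (m := ∑ i, m i + 1) (by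
    push_cast at hcon' ⊢; exact hcon')
  set ρ := fun i => restrictPairs g isOpen_univ (hopen i) (subset_univ _) with hρ
  set l := firstDirichletEigenvalue g (univ : Set M) with hl
  -- The map sends coefficients of a combination of the `w j` to all the `L²(Uᵢ)` products of its
  -- restrictions with the chosen eigenfunctions `e i k`. The domain has one dimension more than the
  -- target, so the kernel is not zero.
  let L : (Fin (∑ i, m i + 1) → ℝ) →ₗ[ℝ] ((Σ i, Fin (m i)) → ℝ) :=
    LinearMap.pi fun q => (((massForm g (hopen q.1)).flip (e q.1 q.2)).comp (ρ q.1)).comp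
      (Fintype.linearCombination ℝ w)
  have hker : LinearMap.ker L ≠ ⊥ := LinearMap.ker_ne_bot_of_finrank_lt (by simp)
  obtain ⟨c, hc, hc0⟩ := Submodule.exists_mem_ne_zero_of_ne_bot hker
  set f := ∑ j, c j • w j with hf
  have hfL : ∀ i k, massForm g (hopen i) (ρ i f) (e i k) = 0 := by
    intro i k
    have h1 := congrFun (LinearMap.mem_ker.1 hc) ⟨i, k⟩
    exact h1
  have hfh : f ∈ h1 g isOpen_univ :=
    Submodule.sum_mem _ fun j _ => Submodule.smul_mem _ _ (hw.mem j).1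
  obtain ⟨hfm, hfe⟩ := hw.energyForm_sum_le c
  rw [← hf] at hfm hfe
  rw [← hfm] at hfe
  have hpos : 0 < massForm g isOpen_univ f f := by
    rw [hfm]
    obtain ⟨j, hj⟩ := Function.ne_iff.1 hc0
    exact Finset.sum_pos' (fun _ _ => sq_nonneg _) ⟨j, Finset.mem_univ j, sq_pos_of_ne_zero hj⟩
  have hms : massForm g isOpen_univ f f =
      ∑ i, massForm g (hopen i) (ρ i f) (ρ i f) := by
    simp only [massForm_self]
    exact integral_eq_sum_of_partition hopen hlip hdisj hcover f.2.memLp.integrable_sq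
  have hes : energyForm g isOpen_univ f f =
      ∑ i, energyForm g (hopen i) (ρ i f) (ρ i f) :=
    integral_eq_sum_of_partition hopen hlip hdisj hcover f.2.integrable
  have hpiece : ∀ i, 0 < massForm g (hopen i) (ρ i f) (ρ i f) →
      l * massForm g (hopen i) (ρ i f) (ρ i f) < energyForm g (hopen i) (ρ i f) (ρ i f) := by
    intro i hi
    -- Monotonicity of the first Dirichlet eigenvalue fails for null pieces, where the default value
    -- `0` appears; a piece that carries mass is not null.
    have h0 : vol g (U i) ≠ 0 := by
      intro h0
      rw [massForm_self, Measure.restrict_eq_zero.2 h0, integral_zero_measure] at hi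
      exact lt_irrefl _ hi
    refine lt_of_le_of_lt (mul_le_mul_of_nonneg_right
      (firstDirichletEigenvalue_anti (hR i) hR' (subset_univ _) h0) hi.le) ?_
    exact lt_energyForm_of_orthogonal (hR i) (hm' i).le (he i) (restrictPairs_mem_h1 _ hfh)
      (hfL i) hi
  have hpiece' : ∀ i, l * massForm g (hopen i) (ρ i f) (ρ i f) ≤
      energyForm g (hopen i) (ρ i f) (ρ i f) := by
    intro i
    rcases (massForm_nonneg (ρ i f)).eq_or_lt with h | h
    · rw [← h, mul_zero]; exact energyForm_nonneg _
    · exact (hpiece i h).le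
  have hex : ∃ i, 0 < massForm g (hopen i) (ρ i f) (ρ i f) := by
    by_contra hno
    push Not at hno
    rw [hms] at hpos
    exact absurd hpos (not_lt.2 (Finset.sum_nonpos fun i _ => hno i))
  obtain ⟨i, hi⟩ := hex
  -- One piece with positive mass makes the summed inequality strict, against the bound `hfe` for
  -- the Rayleigh quotient of `f` on `Ω`.
  have hlt := Finset.sum_lt_sum (fun i _ => hpiece' i) ⟨i, Finset.mem_univ i, hpiece i hi⟩
  rw [← Finset.mul_sum, ← hms, ← hes] at hlt
  exact absurd hfe (not_le.2 hlt)

end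

end NeumannDirichlet

theorem lemma6p6 (n : ℕ) [NeZero n] (Ω : Type*) [TopologicalSpace Ω] [T2Space Ω] [CompactSpace Ω]
    [ChartedSpace (EuclideanHalfSpace n) Ω] [IsManifold (𝓡∂ n) ∞ Ω]
    [MeasurableSpace Ω] [BorelSpace Ω]
    (hbd : ((𝓡∂ n).boundary Ω).Nonempty)
    (g : NeumannDirichlet.Metric n Ω)
    (K : ℕ) (U : Fin K → Set Ω)
    (hopen : ∀ i, IsOpen (U i))
    (hlip : ∀ i, NeumannDirichlet.HasLipschitzBoundary n (U i))
    (hdisj : Pairwise fun i j => Disjoint (U i) (U j))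
    (hcover : ⋃ i, closure (U i) = univ) :
    NeumannDirichlet.neumannCount g univ ≤ ∑ i, NeumannDirichlet.neumannCount g (U i) :=
  NeumannDirichlet.neumannCount_univ_le_sum hopen hlip hdisj hcover
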